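/- Let $d\in\{2,3\}$, let $z_1,\dots,z_n\in\mathbb R^d$ be distinct and $\alpha_1,\dots,\alpha_n\in\mathbb R$. For $a\in\mathbb C^d$ and $b\in\mathbb C^d$ write $ab=\sum_i a_ib_i$, $a^2=aa$. For real $N>0$ put $$\varepsilon_j(N)=\alpha_j\Big(1-\frac{\alpha_jN}{2\pi^2}\Big)^{-1}\ (d=3),\qquad \varepsilon_j(N)=\alpha_j\Big(1-\frac{\alpha_j}{2\pi}\ln N\Big)^{-1}\ (d=2),$$ and let $\hat u_{j,N}(\xi)=e^{-i\xi z_j}$ for $|\xi|\le N$, $\hat u_{j,N}(\xi)=0$ for $|\xi|>N$, let $u_{j,N}$ be the inverse Fourier transform of $\hat u_{j,N}$, and $V_N(x,x')=\sum_j\varepsilon_j(N)u_{j,N}(x)u_{j,N}(x')$. For $k\in\mathbb C^d\setminus\mathbb R^d$ with $k^2\in\mathbb R$ put $$\mu_N(x,k)=1+\frac1{(2\pi)^d}\int_{\mathbb R^d}\tilde\mu_N(\xi,k)e^{i\xi x}d\xi,\qquad \tilde\mu_N(\xi,k)=-\frac{\sum_jc_{j,N}(k)\hat u_{j,N}(\xi)}{\xi^2+2k\xi},$$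 where $A_N(k)c_N(k)=(\varepsilon_m(N))_m$ and $$A_{m,j,N}(k)=\delta_{m,j}+\frac{\varepsilon_m(N)}{(2\pi)^d}\int_{\mathbb R^d}\frac{\hat u_{m,N}(-\xi)\hat u_{j,N}(\xi)}{\xi^2+2k\xi}d\xi.$$ Let, for $x\neq0$, $$g(x,k)=-\frac1{(2\pi)^d}\lim_{R\to\infty}\int_{|\xi|\le R}\frac{e^{i\xi x}}{\xi^2+2k\xi}d\xi,\qquad g_\gamma(x,k)=\lim_{\varepsilon\to0+}g(x,k+i\varepsilon\gamma),$$ the second for $k\in\mathbb R^d\setminus0$, $|\gamma|=1$, $k\gamma=0$. Put $q(k)=\frac{|\mathrm{Im}\,k|}{4\pi}$ for $d=3$ and $q(k)=\frac1{2\pi}\ln(|\mathrm{Re}\,k|+|\mathrm{Im}\,k|)$ for $d=2$, and consider the system $\tilde A(k)c(k)=\tilde b(k)$ with $$\tilde A_{m,m}=1,\qquad \tilde A_{m,j}=-\frac{\alpha_m}{1-\alpha_mq(k)}\,g(z_m-z_j,k)\ (m\ne j),\qquad \tilde b_m=\frac{\alpha_m}{1-\alpha_mq(k)}.$$ If some $1-\alpha_mq(k)$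 vanishes, the system is understood after multiplication of its $m$-th row by $1-\alpha_mq(k)$ for each $m$. If all $\alpha_m\neq0$, this is the system $\sum_j\mathcal A_{m,j}\mathcal C_j=e^{ikz_m}$ with $\mathcal C_j=e^{ikz_j}c_j$, $\mathcal A_{m,m}=\alpha_m^{-1}-q(k)$, $\mathcal A_{m,j}=-e^{ik(z_m-z_j)}g(z_m-z_j,k)$ for $m\ne j$. The momentum $k$ is called a spectral singularity if the determinant of the (row-multiplied) system vanishes. For $k\in\mathbb R^d\setminus 0$, $|\gamma|=1$, $k\gamma=0$, let $\tilde A_\gamma(k)=\tilde A(k+i0\gamma)$, $\tilde b_\gamma(k)=\tilde b(k+i0\gamma)$; that is, $g$ is replaced by $g_\gamma$, and $q$ by $0$ for $d=3$ and by $\frac{1}{2\pi}\ln|k|$ for $d=2$. The same conventions apply to this system. Theorem. The limits defining $g$ and $g_\gamma$ exist for $x\ne0$, and the (row-multiplied) system at $k+i\varepsilon\gamma$ converges as $\varepsilon\to0+$ to the one at $k+i0\gamma$. Moreover: 1. Let $k\in\mathbb C^d\setminus\mathbb R^d$, $k^2=E\in\mathbb R$, not be a spectral singularity. For all large $N$ the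 matrix $A_N(k)$ is invertible and $\tilde\mu_N$ is the unique solution (up to null sets) of the Fourier-transformed equation $-\Delta\mu-2ik\nabla\mu+V_N\mu=0$ with $\mu=1+(2\pi)^{-d}\int\tilde\mu(\xi)e^{i\xi x}d\xi$. For every $x\in\mathbb R^d\setminus\{z_1,\dots,z_n\}$ the limit $\psi(x,k)=e^{ikx}\lim_{N\to+\infty}\mu_N(x,k)$ exists. 2. For these $k$ and $x$, $$\psi(x,k)=e^{ikx}\Big[1+\sum_{j=1}^nc_j(k)g(x-z_j,k)\Big],$$ where $c(k)$ is the unique solution of $\tilde A(k)c(k)=\tilde b(k)$. If $k\in\mathbb R^d\setminus0$, $|\gamma|=1$, $k\gamma=0$, and $k+i0\gamma$ is not a spectral singularity, then for $x\notin\{z_1,\dots,z_n\}$ the limit $\psi_\gamma(x,k)=\lim_{\varepsilon\to0+}\psi(x,k+i\varepsilon\gamma)$ exists and $$\psi_\gamma(x,k)=e^{ikx}\Big[1+\sum_{j=1}^nc_{\gamma,j}(k)g_\gamma(x-z_j,k)\Big],$$ where $c_\gamma(k)$ is the unique solution of $\tilde A_\gamma(k)c_\gamma(k)=\tilde b_\gamma(k)$.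 3. In the situations of 1 and 2 there are unique continuous functions $H(k,\cdot)$ and $H_\gamma(k,\cdot)$ on $\mathbb R^d$, of at most polynomial growth, such that $$e^{-ikx}\psi(x,k)=1-\int_{\mathbb R^d}\frac{e^{i\xi x}H(k,-\xi)}{\xi^2+2k\xi}d\xi,\qquad e^{-ikx}\psi_\gamma(x,k)=1-\int_{\mathbb R^d}\frac{e^{i\xi x}H_\gamma(k,-\xi)}{\xi^2+2(k+i0\gamma)\xi}d\xi$$ as tempered distributions in $x$. The generalized scattering data $h(k,l)=H(k,k-l)$, for $l\in\mathbb C^d$ with $\mathrm{Im}\,l=\mathrm{Im}\,k$, $l^2=k^2=E$, and $h_\gamma(k,l)=H_\gamma(k,k-l)$, for $l\in\mathbb R^d\setminus0$ with $l^2=k^2$, are $$h(k,l)=\frac1{(2\pi)^d}\sum_{j=1}^nc_j(k)e^{i(k-l)z_j},\qquad h_\gamma(k,l)=\frac1{(2\pi)^d}\sum_{j=1}^nc_{\gamma,j}(k)e^{i(k-l)z_j}.$$ -/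

import Mathlib

open Filter Topology MeasureTheory
open scoped SchwartzMap

namespace MultipointFaddeev

/-- Real momentum or position space `ℝᵈ`. -/
abbrev RVec (d : ℕ) : Type := EuclideanSpace ℝ (Fin d)

/-- Complex momentum space `ℂᵈ`. -/
abbrev CVec (d : ℕ) : Type := EuclideanSpace ℂ (Fin d)

/-- `Re k`. -/
noncomputable def reVec {d : ℕ} (k : CVec d) : RVec d := WithLp.toLp 2 (fun i => (k i).re)

/-- `Im k`. -/
noncomputable def imVec {d : ℕ} (k : CVec d) : RVec d := WithLp.toLp 2 (fun i => (k i).im)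

/-- The bilinear (not sesquilinear) square `k² = k₁² + ... + k_d²`. -/
noncomputable def csq {d : ℕ} (k : CVec d) : ℂ := ∑ i, k i ^ 2

/-- The bilinear product `k x = k₁ x₁ + ... + k_d x_d`. -/
noncomputable def cdot {d : ℕ} (k : CVec d) (x : RVec d) : ℂ := ∑ i, k i * ((x i : ℝ) : ℂ)

/-- The complex momentum `k + i ε γ` for real `k`, `γ`. -/
noncomputable def shift {d : ℕ} (k γ : RVec d) (ε : ℝ) : CVec d :=
  WithLp.toLp 2 (fun i => ((k i : ℝ) : ℂ) + Complex.I * ((ε * γ i : ℝ) : ℂ))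

/-- The plane wave `e^{i ξ x}` with real `ξ`. -/
noncomputable def planeWave {d : ℕ} (ξ x : RVec d) : ℂ :=
  Complex.exp (Complex.I * ((inner ℝ ξ x : ℝ) : ℂ))

/-- The exponential `e^{i k x}` with complex `k`. -/
noncomputable def expWave {d : ℕ} (k : CVec d) (x : RVec d) : ℂ :=
  Complex.exp (Complex.I * cdot k x)

/-- The symbol `ξ² + 2 k ξ` of the operator `-Δ - 2 i k ∇`. -/
noncomputable def symb {d : ℕ} (k : CVec d) (ξ : RVec d) : ℂ :=
  ((‖ξ‖ ^ 2 : ℝ) : ℂ) + 2 * cdot k ξ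

/-- The constant `(2π)^{-d}`. -/
noncomputable def fourierConst (d : ℕ) : ℂ := ((((2 * Real.pi) ^ d)⁻¹ : ℝ) : ℂ)

/-! ### Green functions -/

/-- The integral defining the Green function, restricted to the ball `|ξ| ≤ R`. -/
noncomputable def greenTrunc {d : ℕ} (k : CVec d) (R : ℝ) (x : RVec d) : ℂ :=
  -fourierConst d * ∫ ξ in Metric.closedBall (0 : RVec d) R, planeWave ξ x / symb k ξ

/-- The Faddeev Green function
`g(x,k) = -(2π)^{-d} ∫ e^{iξx} / (ξ² + 2kξ) dξ`. The integral is only conditionally convergent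
at infinity, and is taken as the limit of the integrals over the balls `|ξ| ≤ R`. -/
noncomputable def green {d : ℕ} (k : CVec d) (x : RVec d) : ℂ :=
  limUnder atTop (fun R : ℝ => greenTrunc k R x)

/-- The boundary value `g_γ(x,k) = g(x, k + i0γ)`. -/
noncomputable def greenBdry {d : ℕ} (k γ : RVec d) (x : RVec d) : ℂ :=
  limUnder (𝓝[>] (0 : ℝ)) (fun ε => green (shift k γ ε) x)

/-! ### The approximating non-local potentials and their Faddeev eigenfunctions -/

/-- The coupling constant `ε(N)` for strength `a`; the dimension `d` is `2` or `3`. -/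
noncomputable def coupling (d : ℕ) (a N : ℝ) : ℝ :=
  if d = 3 then a * (1 - a * N / (2 * Real.pi ^ 2))⁻¹
  else a * (1 - a / (2 * Real.pi) * Real.log N)⁻¹

/-- The Fourier transform `û_N` of the form factor at the point `z`. -/
noncomputable def uHat {d : ℕ} (z : RVec d) (N : ℝ) (ξ : RVec d) : ℂ :=
  if ‖ξ‖ ≤ N then planeWave (-ξ) z else 0

/-- The matrix `A_N(k)`. -/
noncomputable def matN {d n : ℕ} (α : Fin n → ℝ) (z : Fin n → RVec d) (N : ℝ) (k : CVec d) :
    Matrix (Fin n) (Fin n) ℂ :=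
  Matrix.of fun m j => (if m = j then 1 else 0) +
    (coupling d (α m) N : ℂ) * (fourierConst d *
      ∫ ξ, uHat (z m) N (-ξ) * uHat (z j) N ξ / symb k ξ)

/-- The solution `c_N(k)` of `A_N(k) c_N(k) = b_N`, `b_N = (ε_m(N))_m`. -/
noncomputable def coeffN {d n : ℕ} (α : Fin n → ℝ) (z : Fin n → RVec d) (N : ℝ) (k : CVec d) :
    Fin n → ℂ :=
  Matrix.mulVec (matN α z N k)⁻¹ (fun m => (coupling d (α m) N : ℂ))

/-- The function `μ̃_N(ξ,k)`. -/
noncomputable def muTildeN {d n : ℕ} (α : Fin n → ℝ) (z : Fin n → RVec d) (N : ℝ) (k : CVec d)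
    (ξ : RVec d) : ℂ :=
  -(∑ j, coeffN α z N k j * uHat (z j) N ξ) / symb k ξ

/-- The function `μ_N(x,k) = 1 + (2π)^{-d} ∫ μ̃_N(ξ,k) e^{iξx} dξ`. -/
noncomputable def muN {d n : ℕ} (α : Fin n → ℝ) (z : Fin n → RVec d) (N : ℝ) (k : CVec d)
    (x : RVec d) : ℂ :=
  1 + fourierConst d * ∫ ξ, muTildeN α z N k ξ * planeWave ξ x

/-- The equation `-Δμ - 2ik∇μ + V_N μ = 0` for
`V_N(x,x') = ∑ j, ε_j(N) u_{j,N}(x) u_{j,N}(x')` and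
`μ(x) = 1 + (2π)^{-d} ∫ w(ξ) e^{iξx} dξ`, written in the Fourier variable `ξ`.
Here `∫ u_{j,N}(x) μ(x) dx` is `û_{j,N}(0) + (2π)^{-d} ∫ û_{j,N}(-η) w(η) dη`. -/
def SolvesNonlocal {d n : ℕ} (α : Fin n → ℝ) (z : Fin n → RVec d) (N : ℝ) (k : CVec d)
    (w : RVec d → ℂ) : Prop :=
  (∀ j, Integrable (fun η => uHat (z j) N (-η) * w η)) ∧
  ∀ᵐ ξ : RVec d, symb k ξ * w ξ +
    ∑ j, (coupling d (α j) N : ℂ) * uHat (z j) N ξ *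
      (uHat (z j) N 0 + fourierConst d * ∫ η, uHat (z j) N (-η) * w η) = 0

/-! ### The limiting eigenfunctions -/

/-- `ψ(x,k) = e^{ikx} lim_{N → +∞} μ_N(x,k)`. -/
noncomputable def psi {d n : ℕ} (α : Fin n → ℝ) (z : Fin n → RVec d) (k : CVec d)
    (x : RVec d) : ℂ :=
  expWave k x * limUnder atTop (fun N : ℝ => muN α z N k x)

/-- `ψ_γ(x,k) = ψ(x, k + i0γ)`. -/
noncomputable def psiBdry {d n : ℕ} (α : Fin n → ℝ) (z : Fin n → RVec d) (k γ : RVec d)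
    (x : RVec d) : ℂ :=
  limUnder (𝓝[>] (0 : ℝ)) (fun ε => psi α z (shift k γ ε) x)

/-! ### The limiting linear systems

They depend on a real number `q` (the explicit diagonal term) and a function `g` (the Green
function); both are specialized below to `k` complex and to the boundary values. -/

/-- `|Im k| / (4π)` for `d = 3`, `ln(|Re k| + |Im k|) / (2π)` for `d = 2`. -/
noncomputable def diagTerm {d : ℕ} (k : CVec d) : ℝ :=
  if d = 3 then ‖imVec k‖ / (4 * Real.pi)
  else Real.log (‖reVec k‖ + ‖imVec k‖) / (2 * Real.pi)

/-- The value of `diagTerm` at `k + i0γ` for real `k`. -/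
noncomputable def diagTermBdry {d : ℕ} (k : RVec d) : ℝ :=
  if d = 3 then 0 else Real.log ‖k‖ / (2 * Real.pi)

/-- The matrix `Ã`. -/
noncomputable def matTilde {d n : ℕ} (α : Fin n → ℝ) (z : Fin n → RVec d) (q : ℝ)
    (g : RVec d → ℂ) : Matrix (Fin n) (Fin n) ℂ :=
  Matrix.of fun m j =>
    if m = j then 1 else -((α m * (1 - α m * q)⁻¹ : ℝ) : ℂ) * g (z m - z j)

/-- The vector `b̃`. -/
noncomputable def vecTilde {n : ℕ} (α : Fin n → ℝ) (q : ℝ) : Fin n → ℂ :=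
  fun m => ((α m * (1 - α m * q)⁻¹ : ℝ) : ℂ)

/-- The matrix of the system `Ã c = b̃` after its `m`-th row is multiplied by `1 - α_m q`, so that
the right hand side becomes `α`. It makes sense also if some `1 - α_m q` vanishes. -/
noncomputable def matReg {d n : ℕ} (α : Fin n → ℝ) (z : Fin n → RVec d) (q : ℝ)
    (g : RVec d → ℂ) : Matrix (Fin n) (Fin n) ℂ :=
  Matrix.of fun m j =>
    if m = j then ((1 - α m * q : ℝ) : ℂ) else -(α m : ℂ) * g (z m - z j)

/-- The matrix `𝒜` with diagonal `α_m⁻¹ - q` and off-diagonal entries `-G(z_m - z_j)`, where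
`G(x) = e^{ikx} g(x)`; it is used for `α_m ≠ 0`. -/
noncomputable def matCal {d n : ℕ} (α : Fin n → ℝ) (z : Fin n → RVec d) (q : ℝ)
    (e : RVec d → ℂ) (g : RVec d → ℂ) : Matrix (Fin n) (Fin n) ℂ :=
  Matrix.of fun m j =>
    if m = j then (((α m)⁻¹ - q : ℝ) : ℂ) else -(e (z m - z j) * g (z m - z j))

/-- `c` is the solution of the limiting linear system. The system is `matReg c = α`; it is
`Ã c = b̃` if `b̃` is finite, and `𝒜 𝒞 = ℬ` with `𝒞_j = e^{ikz_j} c_j`, `ℬ_m = e^{ikz_m}` if all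
`α_m ≠ 0`. Here `e` is the function `x ↦ e^{ikx}`. -/
def IsCoeff {d n : ℕ} (α : Fin n → ℝ) (z : Fin n → RVec d) (q : ℝ)
    (e : RVec d → ℂ) (g : RVec d → ℂ) (c : Fin n → ℂ) : Prop :=
  (Matrix.mulVec (matReg α z q g) c = fun m => (α m : ℂ)) ∧
  (∀ c', (Matrix.mulVec (matReg α z q g) c' = fun m => (α m : ℂ)) → c' = c) ∧
  ((∀ m, 1 - α m * q ≠ 0) → Matrix.mulVec (matTilde α z q g) c = vecTilde α q) ∧
  ((∀ m, α m ≠ 0) →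
    Matrix.mulVec (matCal α z q e g) (fun j => e (z j) * c j) = fun m => e (z m))

/-- The spectral singularities: zeros of the determinant of the limiting system. -/
def IsSpectralSingularity {d n : ℕ} (α : Fin n → ℝ) (z : Fin n → RVec d) (q : ℝ)
    (g : RVec d → ℂ) : Prop :=
  (matReg α z q g).det = 0

/-! ### Generalized scattering data -/

/-- `H` is the function `H(k,·)` of the representation
`e^{-ikx} ψ(x) = 1 - ∫ e^{iξx} H(k,-ξ) / (ξ² + 2kξ) dξ`, an identity of tempered distributions in
`x`, with `H` continuous and of at most polynomial growth. -/
def IsScatteringData {d : ℕ} (k : CVec d) (ψ : RVec d → ℂ) (H : RVec d → ℂ) : Prop :=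
  Continuous H ∧ (∃ (C : ℝ) (s : ℕ), ∀ p, ‖H p‖ ≤ C * (1 + ‖p‖) ^ s) ∧
  ∀ φ : 𝓢(RVec d, ℂ),
    Integrable (fun x => (ψ x / expWave k x - 1) * φ x) ∧
    ∫ x, (ψ x / expWave k x - 1) * φ x =
      -∫ ξ, H (-ξ) * (∫ x, planeWave ξ x * φ x) / symb k ξ

/-- `H` is the function `H_γ(k,·)` of the representation
`e^{-ikx} ψ(x) = 1 - ∫ e^{iξx} H_γ(k,-ξ) / (ξ² + 2(k + i0γ)ξ) dξ`, an identity of tempered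
distributions in `x`, with `H` continuous and of at most polynomial growth. -/
def IsScatteringDataBdry {d : ℕ} (k γ : RVec d) (ψ : RVec d → ℂ) (H : RVec d → ℂ) : Prop :=
  Continuous H ∧ (∃ (C : ℝ) (s : ℕ), ∀ p, ‖H p‖ ≤ C * (1 + ‖p‖) ^ s) ∧
  ∀ φ : 𝓢(RVec d, ℂ),
    Integrable (fun x => (ψ x / planeWave k x - 1) * φ x) ∧
    Tendsto (fun ε : ℝ =>
        -∫ ξ, H (-ξ) * (∫ x, planeWave ξ x * φ x) / symb (shift k γ ε) ξ)
      (𝓝[>] 0) (𝓝 (∫ x, (ψ x / planeWave k x - 1) * φ x))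

end MultipointFaddeev

open MultipointFaddeev

/-! The potential `V_N` has finite rank. Dividing its equation by the symbol therefore leaves only
finitely many unknown charges `c_N`, which solve `A_N c_N = b_N`, and `μ_N(x) = 1 + ∑ c_{N,j} g_N(x
- z_j)`, where `g_N` is the Green integral cut off at `|ξ| ≤ N` (`solvesNonlocal_muTildeN`,
`muN_eq`). The entries of `A_N` are built from the same numbers `g_N(z_m - z_j)`. Off the diagonal
they converge; on the diagonal `-g_N(0)` grows like `D(N) = N/(2π²)` or `ln N/(2π)`. Multiplying row
`m` by `1 - α_m D(N)` clears the denominator of `ε_m(N)` and turns the diagonal entry into `1 +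
α_m(-g_N(0) - D(N))`, in which the divergence cancels. So the scaled matrix tends to `matReg`
(`tendsto_scaledMatN`), and Cramer's rule passes the convergence on to the charges when the limiting
determinant is nonzero (`tendsto_solution`).

Three analytic facts carry this.

Convergence of `g_N(x)` for `x ≠ 0` (`tendsto_greenTrunc`). Near its zero set the inverse symbol is
locally integrable, because in polar coordinates about `-Re k` it is dominated by a product of
inverse square roots of the radial and the angular distance to that set. At infinity it is `|ξ|⁻² -
2kξ|ξ|⁻⁴ + O(|ξ|⁻⁴)`. The remainder is absolutely integrable since `d < 4`. The borderline terms of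
degree `-d` are controlled by the oscillation of `e^{irs}/r` along rays, averaged over the sphere,
and `|ξ|⁻²` for `d = 3` by the explicit spherical mean of a plane wave.

The finite part of the diagonal (`tendsto_diag`). The radial integral is elementary and produces
logarithms of `2kω`. For `d = 2` their angular mean is given by Jensen's formula. For `d = 3`
averaging over `ω` and `-ω` leaves only the jump of the argument, and Archimedes' theorem on the
sphere finishes the computation.

Boundary values (`tendsto_green_shift`). As `ε → 0` the symbol at `k + iεγ` degenerates only on the
sphere `|ξ + k| = |k|`. Near it, a radial integration by parts replaces the pole by a logarithm,
which is integrable uniformly in `ε`; this gives both the limit and a bound by a locally integrable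
weight of polynomial growth.

For the scattering data, the uniform bounds allow pairing with Schwartz functions and passing to the
limit, so the transform of `g(x - z_j)` is an explicit plane wave over the symbol, and a
superposition of Green functions has `sourceData` as its `H`. Uniqueness holds because the symbol,
or its boundary value, is nonzero almost everywhere and `H` is continuous. -/

namespace MultipointFaddeev

/-! ### Polar coordinates and integration over the unit sphere. -/

/-- The unit sphere of `ℝᵈ`. -/
abbrev Sph (d : ℕ) : Type := Metric.sphere (0 : RVec d) 1

/-- The surface measure of the unit sphere. -/
noncomputable abbrev sphMeas (d : ℕ) : Measure (Sph d) := (volume : Measure (RVec d)).toSphere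

theorem map_coe_volumeIoiPow (n : ℕ) :
    (Measure.volumeIoiPow n).map (Subtype.val : Set.Ioi (0 : ℝ) → ℝ) =
      (volume.restrict (Set.Ioi 0)).withDensity (fun r => ENNReal.ofReal (r ^ n)) := by
  have hemb : MeasurableEmbedding (Subtype.val : Set.Ioi (0 : ℝ) → ℝ) :=
    MeasurableEmbedding.subtype_coe measurableSet_Ioi
  ext s hs
  rw [Measure.map_apply measurable_subtype_coe hs, Measure.volumeIoiPow,
    withDensity_apply _ (measurable_subtype_coe hs), withDensity_apply _ hs,
    ← map_comap_subtype_coe measurableSet_Ioi, hemb.restrict_map, hemb.lintegral_map]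

/-- The homeomorphism `homeomorphUnitSphereProd` gives polar coordinates on the complement of the
origin, with radii in a subtype. Pushing forward along both inclusions gives a statement on whole
spaces, since the origin is null. -/
theorem map_polar (d : ℕ) [NeZero d] :
    ((sphMeas d).prod ((volume.restrict (Set.Ioi (0:ℝ))).withDensity
      (fun r => ENNReal.ofReal (r ^ (d - 1))))).map (fun p => p.2 • (p.1 : RVec d)) = volume := by
  have hd : Module.finrank ℝ (RVec d) = d := by simp
  have h1 := (Measure.measurePreserving_homeomorphUnitSphereProd
    (volume : Measure (RVec d))).symm (homeomorphUnitSphereProd (RVec d)).toMeasurableEquiv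
  have h2 := h1.map_eq
  rw [hd] at h2
  rw [← map_coe_volumeIoiPow]
  have h3 : (sphMeas d).prod ((Measure.volumeIoiPow (d-1)).map
      (Subtype.val : Set.Ioi (0 : ℝ) → ℝ)) =
      ((sphMeas d).prod (Measure.volumeIoiPow (d-1))).map (Prod.map id Subtype.val) := by
    have : SFinite ((Measure.volumeIoiPow (d-1)).map
      (Subtype.val : Set.Ioi (0 : ℝ) → ℝ)) := inferInstance
    conv_lhs => rw [← Measure.map_id (μ := sphMeas d)]
    exact Measure.map_prod_map _ _ measurable_id measurable_subtype_coe
  rw [h3, Measure.map_map (by fun_prop) (by fun_prop)]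
  have h4 : (volume : Measure (RVec d)) =
      (Measure.comap (Subtype.val : ({0}ᶜ : Set (RVec d)) → RVec d) volume).map Subtype.val := by
    rw [map_comap_subtype_coe (measurableSet_singleton _).compl, restrict_compl_singleton]
  conv_rhs => rw [h4, ← h2]
  rw [Measure.map_map (by fun_prop) (MeasurableEquiv.measurable _)]
  rfl

/-- Polar coordinates. -/
theorem integrable_polar {d : ℕ} [NeZero d] {f : RVec d → ℂ} (hf : AEStronglyMeasurable f volume) :
    Integrable f ↔ Integrable (fun p : Sph d × ℝ => ((p.2 ^ (d - 1) : ℝ) : ℂ) * f (p.2 • (p.1 : RVec d)))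
      ((sphMeas d).prod (volume.restrict (Set.Ioi 0))) := by
  rw [← map_polar d] at hf
  conv_lhs => rw [← map_polar d]
  rw [integrable_map_measure hf (by fun_prop)]
  rw [prod_withDensity_right (by fun_prop)]
  rw [integrable_withDensity_iff_integrable_smul' (by fun_prop) (by simp)]
  apply integrable_congr
  have : ∀ᵐ p ∂((sphMeas d).prod (volume.restrict (Set.Ioi (0:ℝ)))), 0 < p.2 :=
    (Measure.quasiMeasurePreserving_snd).ae (ae_restrict_mem measurableSet_Ioi)
  filter_upwards [this] with p hp
  rw [ENNReal.toReal_ofReal (by positivity)]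
  simp

theorem integral_polar {d : ℕ} [NeZero d] {f : RVec d → ℂ} (hf : AEStronglyMeasurable f volume) :
    ∫ ξ, f ξ = ∫ p : Sph d × ℝ, ((p.2 ^ (d - 1) : ℝ) : ℂ) * f (p.2 • (p.1 : RVec d))
      ∂((sphMeas d).prod (volume.restrict (Set.Ioi 0))) := by
  rw [← map_polar d] at hf
  conv_lhs => rw [← map_polar d]
  rw [integral_map (by fun_prop) hf]
  rw [prod_withDensity_right (by fun_prop)]
  rw [integral_withDensity_eq_integral_toReal_smul (by fun_prop) (by simp)]
  apply integral_congr_ae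
  have : ∀ᵐ p ∂((sphMeas d).prod (volume.restrict (Set.Ioi (0:ℝ)))), 0 < p.2 :=
    (Measure.quasiMeasurePreserving_snd).ae (ae_restrict_mem measurableSet_Ioi)
  filter_upwards [this] with p hp
  rw [ENNReal.toReal_ofReal (by positivity)]
  simp

section Pointwise

open scoped Pointwise

/-- The spherical shell `p < |ξ| ≤ q`. -/
def shell (d : ℕ) (p q : ℝ) : Set (RVec d) := {ξ | p < ‖ξ‖ ∧ ‖ξ‖ ≤ q}

theorem measurableSet_shell (d : ℕ) (p q : ℝ) : MeasurableSet (shell d p q) :=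
  (measurableSet_lt measurable_const measurable_norm).inter
    (measurableSet_le measurable_norm measurable_const)

theorem shell_subset_closedBall (d : ℕ) (p q : ℝ) : shell d p q ⊆ Metric.closedBall 0 q :=
  fun ξ hξ => by simpa using hξ.2

theorem volume_shell_lt_top (d : ℕ) (p q : ℝ) : volume (shell d p q) < ⊤ :=
  (measure_mono (shell_subset_closedBall d p q)).trans_lt measure_closedBall_lt_top

theorem norm_smul_sph {d : ℕ} {r : ℝ} (hr : 0 ≤ r) (ω : Sph d) : ‖r • (ω : RVec d)‖ = r := by
  have : ‖(ω : RVec d)‖ = 1 := by simp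
  rw [norm_smul, this, Real.norm_eq_abs, abs_of_nonneg hr, mul_one]

theorem polar_indicator_shell {d : ℕ} {p q : ℝ} (f : RVec d → ℂ) :
    (fun v : Sph d × ℝ => ((v.2 ^ (d - 1) : ℝ) : ℂ) *
      (shell d p q).indicator f (v.2 • (v.1 : RVec d))) =ᵐ[(sphMeas d).prod (volume.restrict (Set.Ioi 0))]
    (Set.univ ×ˢ Set.Ioc p q).indicator
      (fun v : Sph d × ℝ => ((v.2 ^ (d - 1) : ℝ) : ℂ) * f (v.2 • (v.1 : RVec d))) := by
  have : ∀ᵐ p ∂((sphMeas d).prod (volume.restrict (Set.Ioi (0:ℝ)))), 0 < p.2 :=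
    (Measure.quasiMeasurePreserving_snd).ae (ae_restrict_mem measurableSet_Ioi)
  filter_upwards [this] with v hv
  by_cases h : v.2 ∈ Set.Ioc p q
  · rw [Set.indicator_of_mem, Set.indicator_of_mem]
    · exact ⟨trivial, h⟩
    · simpa [shell, norm_smul_sph hv.le] using h
  · rw [Set.indicator_of_notMem, Set.indicator_of_notMem, mul_zero]
    · exact fun h' => h h'.2
    · simpa [shell, norm_smul_sph hv.le] using h

theorem restrict_prod_Ioc {d : ℕ} {p q : ℝ} (hp : 0 ≤ p) :
    ((sphMeas d).prod (volume.restrict (Set.Ioi 0))).restrict (Set.univ ×ˢ Set.Ioc p q) =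
      (sphMeas d).prod (volume.restrict (Set.Ioc p q)) := by
  rw [← Measure.prod_restrict, Measure.restrict_univ, Measure.restrict_restrict measurableSet_Ioc,
    Set.inter_eq_left.2]
  exact fun r hr => hp.trans_lt hr.1

theorem integrableOn_shell {d : ℕ} [NeZero d] {f : RVec d → ℂ} {p q : ℝ} (hp : 0 ≤ p)
    (hf : AEStronglyMeasurable f volume) :
    IntegrableOn f (shell d p q) ↔
      Integrable (fun v : Sph d × ℝ => ((v.2 ^ (d - 1) : ℝ) : ℂ) * f (v.2 • (v.1 : RVec d)))
        ((sphMeas d).prod (volume.restrict (Set.Ioc p q))) := by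
  rw [← integrable_indicator_iff (measurableSet_shell d p q),
    integrable_polar (hf.indicator (measurableSet_shell d p q)),
    integrable_congr (polar_indicator_shell f),
    integrable_indicator_iff (MeasurableSet.univ.prod measurableSet_Ioc), IntegrableOn,
    restrict_prod_Ioc hp]

theorem setIntegral_shell {d : ℕ} [NeZero d] {f : RVec d → ℂ} {p q : ℝ} (hp : 0 ≤ p)
    (hf : AEStronglyMeasurable f volume) :
    ∫ ξ in shell d p q, f ξ =
      ∫ v : Sph d × ℝ, ((v.2 ^ (d - 1) : ℝ) : ℂ) * f (v.2 • (v.1 : RVec d))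
        ∂((sphMeas d).prod (volume.restrict (Set.Ioc p q))) := by
  rw [← integral_indicator (measurableSet_shell d p q),
    integral_polar (hf.indicator (measurableSet_shell d p q)),
    integral_congr_ae (polar_indicator_shell f),
    integral_indicator (MeasurableSet.univ.prod measurableSet_Ioc), restrict_prod_Ioc hp]

theorem setIntegral_shell_eq {d : ℕ} [NeZero d] {f : RVec d → ℂ} {p q : ℝ} (hp : 0 ≤ p) (hpq : p ≤ q)
    (hf : AEStronglyMeasurable f volume) (hi : IntegrableOn f (shell d p q)) :
    ∫ ξ in shell d p q, f ξ =
      ∫ ω : Sph d, (∫ r in p..q, ((r ^ (d - 1) : ℝ) : ℂ) * f (r • (ω : RVec d))) ∂(sphMeas d) := by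
  rw [setIntegral_shell hp hf, integral_prod _ ((integrableOn_shell hp hf).1 hi)]
  simp_rw [intervalIntegral.integral_of_le hpq]

/-- Integrals over the sphere as integrals of homogeneous functions over the unit ball. -/
theorem setIntegral_shell_angular {d : ℕ} [NeZero d] {f : RVec d → ℂ} (hf : Measurable f) :
    ∫ ξ in shell d 0 1, f (‖ξ‖⁻¹ • ξ) = (d : ℂ)⁻¹ * ∫ ω : Sph d, f ω ∂(sphMeas d) := by
  have hm : Measurable fun ξ : RVec d => f (‖ξ‖⁻¹ • ξ) :=
    hf.comp (measurable_norm.inv.smul measurable_id)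
  rw [setIntegral_shell le_rfl hm.aestronglyMeasurable]
  have h1 : (fun v : Sph d × ℝ => ((v.2 ^ (d - 1) : ℝ) : ℂ) *
      f (‖v.2 • (v.1 : RVec d)‖⁻¹ • v.2 • (v.1 : RVec d)))
      =ᵐ[(sphMeas d).prod (volume.restrict (Set.Ioc 0 1))]
      fun v => f v.1 * ((v.2 ^ (d - 1) : ℝ) : ℂ) := by
    have : ∀ᵐ p ∂((sphMeas d).prod (volume.restrict (Set.Ioc (0:ℝ) 1))), p.2 ∈ Set.Ioc (0:ℝ) 1 :=
      (Measure.quasiMeasurePreserving_snd).ae (ae_restrict_mem measurableSet_Ioc)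
    filter_upwards [this] with v hv
    rw [norm_smul_sph hv.1.le, smul_smul, inv_mul_cancel₀ hv.1.ne', one_smul, mul_comm]
  -- The integrand depends on the direction only, so the integral factors; the radial factor `∫₀¹
  -- r^(d-1) dr` is the source of `1/d`.
  rw [integral_congr_ae h1, integral_prod_mul (fun ω : Sph d => f ω)
    (fun r : ℝ => ((r ^ (d - 1) : ℝ) : ℂ)), mul_comm, ← intervalIntegral.integral_of_le zero_le_one,
    intervalIntegral.integral_ofReal, integral_pow]
  have hd : 0 < d := Nat.pos_of_ne_zero (NeZero.ne d)
  have : ((d - 1 : ℕ) : ℝ) + 1 = d := by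
    rw [Nat.cast_sub hd]; simp
  rw [this]
  simp

/-- The surface measure is invariant under isometries. -/
theorem integral_sph_comp_isometry {d : ℕ} [NeZero d] {f : RVec d → ℂ} (hf : Measurable f)
    (L : RVec d ≃ₗᵢ[ℝ] RVec d) :
    ∫ ω : Sph d, f (L ω) ∂(sphMeas d) = ∫ ω : Sph d, f ω ∂(sphMeas d) := by
  have hd : (d : ℂ)⁻¹ ≠ 0 := inv_ne_zero (Nat.cast_ne_zero.2 (NeZero.ne d))
  have hL : Measurable L := L.continuous.measurable
  apply mul_left_cancel₀ hd
  have hc := setIntegral_shell_angular (hf.comp hL)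
  simp only [Function.comp_apply] at hc
  rw [← hc, ← setIntegral_shell_angular hf]
  conv_rhs => rw [← (LinearIsometryEquiv.measurePreserving L).setIntegral_preimage_emb
    L.toHomeomorph.measurableEmbedding]
  have : L ⁻¹' shell d 0 1 = shell d 0 1 := by
    ext ξ; simp [shell]
  rw [this]
  simp

theorem exists_isometry {d : ℕ} {u v : RVec d} (h : ‖u‖ = ‖v‖) :
    ∃ L : RVec d ≃ₗᵢ[ℝ] RVec d, L u = v :=
  ⟨_, Submodule.reflection_sub h⟩

theorem inner_isometry {d : ℕ} (L : RVec d ≃ₗᵢ[ℝ] RVec d) (u ξ : RVec d) :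
    inner ℝ (L u) ξ = inner ℝ u (L.symm ξ) := by
  rw [← L.inner_map_map u, L.apply_symm_apply]

/-! ### Integrability of the inverse square root of a linear form. -/

theorem intervalIntegrable_abs_rpow (p q : ℝ) :
    IntervalIntegrable (fun t : ℝ => |t| ^ (-(1/2) : ℝ)) volume p q := by
  have h1 : ∀ q : ℝ, 0 ≤ q → IntervalIntegrable (fun t : ℝ => |t| ^ (-(1/2) : ℝ)) volume 0 q := by
    intro q hq
    refine (intervalIntegral.intervalIntegrable_rpow' (r := -(1/2)) (by norm_num)).congr ?_
    intro t ht
    rw [Set.uIoc_of_le hq] at ht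
    simp only [abs_of_pos ht.1]
  have h2 : ∀ q : ℝ, IntervalIntegrable (fun t : ℝ => |t| ^ (-(1/2) : ℝ)) volume 0 q := by
    intro q
    rcases le_total 0 q with h | h
    · exact h1 q h
    · rw [IntervalIntegrable.iff_comp_neg]
      simpa using h1 (-q) (by linarith)
  exact (h2 p).symm.trans (h2 q)

/-- The ball lies in a cube, and on the cube the function is a product of integrable functions of
single coordinates. -/
theorem integrableOn_rpow_coord {d : ℕ} [NeZero d] (R : ℝ) :
    IntegrableOn (fun ξ : RVec d => |ξ 0| ^ (-(1/2) : ℝ)) (Metric.closedBall 0 R) := by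
  have h1 : ∀ i : Fin d, Integrable (fun t : ℝ => (Set.Icc (-R) R).indicator
      (fun t : ℝ => if i = 0 then |t| ^ (-(1/2) : ℝ) else 1) t) := by
    intro i
    rw [integrable_indicator_iff measurableSet_Icc]
    by_cases h : i = 0
    · simp only [h, if_true]
      rcases le_or_gt (-R) R with hR | hR
      · exact (intervalIntegrable_iff_integrableOn_Icc_of_le hR).1 (intervalIntegrable_abs_rpow _ _)
      · simp [Set.Icc_eq_empty (not_le.2 hR)]
    · simp [h]
  have h2 := Integrable.fintype_prod h1
  rw [← volume_pi] at h2
  have h3 := ((EuclideanSpace.volume_preserving_symm_measurableEquiv_toLp (Fin d)).integrable_comp_emb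
    (MeasurableEquiv.measurableEmbedding _)).2 h2
  refine (h3.integrableOn (s := Metric.closedBall 0 R)).congr ?_
  filter_upwards [ae_restrict_mem Metric.isClosed_closedBall.measurableSet] with ξ hξ
  have hb : ∀ i, ξ i ∈ Set.Icc (-R) R := fun i => abs_le.1 ((PiLp.norm_apply_le ξ i).trans (by simpa using hξ))
  have : ∀ i, (Set.Icc (-R) R).indicator
      (fun t : ℝ => if i = 0 then |t| ^ (-(1/2) : ℝ) else 1) (ξ i) = if i = 0 then |ξ i| ^ (-(1/2) : ℝ) else 1 :=
    fun i => Set.indicator_of_mem (hb i) _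
  have h5 : ∏ i, (if i = 0 then |ξ i| ^ (-(1/2) : ℝ) else 1) = |ξ 0| ^ (-(1/2) : ℝ) := by simp
  rw [← h5]
  exact Finset.prod_congr rfl fun i _ => this i

theorem integrableOn_rpow_inner {d : ℕ} [NeZero d] {u : RVec d} (hu : ‖u‖ = 1) (R : ℝ) :
    IntegrableOn (fun ξ : RVec d => |inner ℝ u ξ| ^ (-(1/2) : ℝ)) (Metric.closedBall 0 R) := by
  obtain ⟨L, hL⟩ := exists_isometry (u := EuclideanSpace.single (0 : Fin d) (1:ℝ)) (v := u) (by simp [hu])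
  have h := ((LinearIsometryEquiv.measurePreserving L.symm).integrableOn_comp_preimage
    L.symm.toHomeomorph.measurableEmbedding).2 (integrableOn_rpow_coord (d := d) R)
  have h2 : L.symm ⁻¹' Metric.closedBall 0 R = Metric.closedBall 0 R := by
    ext ξ; simp
  rw [h2] at h
  refine h.congr_fun (fun ξ _ => ?_) Metric.isClosed_closedBall.measurableSet
  rw [← hL, inner_isometry]
  simp [EuclideanSpace.inner_single_left]

/-- Fubini on the shell `1 < |ξ| ≤ 2` makes the angular section integrable for almost every radius.
One such radius suffices, since homogeneity rescales it to the unit sphere. -/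
theorem integrable_sph_rpow {d : ℕ} [NeZero d] {u : RVec d} (hu : ‖u‖ = 1) :
    Integrable (fun ω : Sph d => |inner ℝ u (ω : RVec d)| ^ (-(1/2) : ℝ)) (sphMeas d) := by
  have hm : Measurable fun ξ : RVec d => |inner ℝ u ξ| ^ (-(1/2) : ℝ) := by fun_prop
  have h1 : IntegrableOn (fun ξ : RVec d => ((|inner ℝ u ξ| ^ (-(1/2) : ℝ) : ℝ) : ℂ)) (shell d 1 2) :=
    ((integrableOn_rpow_inner hu 2).mono_set (shell_subset_closedBall d 1 2)).ofReal
  have hm' : AEStronglyMeasurable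
      (fun ξ : RVec d => ((|inner ℝ u ξ| ^ (-(1/2) : ℝ) : ℝ) : ℂ)) volume :=
    (Complex.measurable_ofReal.comp hm).aestronglyMeasurable
  rw [integrableOn_shell zero_le_one hm'] at h1
  have h2 := h1.prod_left_ae
  have h3 : (ae (volume.restrict (Set.Ioc (1:ℝ) 2))).NeBot := by
    rw [ae_neBot, Ne, Measure.restrict_eq_zero]; norm_num
  obtain ⟨r, hr, hr1⟩ := (h2.and (ae_restrict_mem measurableSet_Ioc)).exists
  have hr0 : 0 < r := zero_lt_one.trans hr1.1
  have h4 := (hr.re.const_mul ((r ^ (d-1))⁻¹ * r ^ ((1/2) : ℝ)))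
  refine h4.congr (Eventually.of_forall fun ω => ?_)
  have : ((r ^ (d-1) : ℝ) : ℂ) * ((|inner ℝ u (r • (ω : RVec d))| ^ (-(1/2) : ℝ) : ℝ) : ℂ) =
    ((r ^ (d-1) * |inner ℝ u (r • (ω : RVec d))| ^ (-(1/2) : ℝ) : ℝ) : ℂ) := by push_cast; rfl
  simp only [this, Complex.ofReal_re, RCLike.re_to_complex]
  rw [real_inner_smul_right, abs_mul, abs_of_pos hr0, Real.mul_rpow hr0.le (abs_nonneg _),
    Real.rpow_neg hr0.le]
  have := Real.rpow_pos_of_pos hr0 (1/2)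
  field_simp

theorem integral_sph_rpow {d : ℕ} [NeZero d] {u v : RVec d} (hu : ‖u‖ = 1) (hv : ‖v‖ = 1) :
    ∫ ω : Sph d, |inner ℝ u (ω : RVec d)| ^ (-(1/2) : ℝ) ∂(sphMeas d) =
      ∫ ω : Sph d, |inner ℝ v (ω : RVec d)| ^ (-(1/2) : ℝ) ∂(sphMeas d) := by
  obtain ⟨L, hL⟩ := exists_isometry (u := u) (v := v) (by rw [hu, hv])
  have hm : Measurable fun ξ : RVec d => ((|inner ℝ u ξ| ^ (-(1/2) : ℝ) : ℝ) : ℂ) := by fun_prop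
  have := integral_sph_comp_isometry hm L.symm
  simp_rw [← inner_isometry, hL] at this
  exact Complex.ofReal_injective ((integral_complex_ofReal.symm.trans this.symm).trans
    integral_complex_ofReal)

theorem volume_inner_eq_zero {d : ℕ} {u : RVec d} (hu : u ≠ 0) :
    ∀ᵐ ξ : RVec d, inner ℝ u ξ ≠ 0 := by
  have h : ((innerSL ℝ u).toLinearMap.ker : Submodule ℝ (RVec d)) ≠ ⊤ := by
    intro h
    have : u ∈ ((innerSL ℝ u).toLinearMap.ker : Submodule ℝ (RVec d)) := h ▸ Submodule.mem_top
    simp at this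
    exact hu this
  have := Measure.addHaar_submodule volume _ h
  rw [ae_iff]
  convert this using 2
  ext ξ
  simp

/-- The surface measure of a set is a multiple of the volume of the cone over it, and here that cone
lies in a hyperplane. -/
theorem sph_inner_ne_zero {d : ℕ} [NeZero d] {u : RVec d} (hu : u ≠ 0) :
    ∀ᵐ ω : Sph d ∂(sphMeas d), inner ℝ u (ω : RVec d) ≠ 0 := by
  have hm : MeasurableSet {ω : Sph d | ¬ inner ℝ u (ω : RVec d) ≠ 0} := by
    simp only [not_not]
    exact measurableSet_eq_fun (by fun_prop) measurable_const
  rw [ae_iff, Measure.toSphere_apply' _ hm]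
  have : volume (Set.Ioo (0:ℝ) 1 • (Subtype.val '' {ω : Sph d | ¬ inner ℝ u (ω : RVec d) ≠ 0})) = 0 := by
    refine measure_mono_null ?_ (ae_iff.1 (volume_inner_eq_zero hu))
    rintro _ ⟨r, hr, _, ⟨ω, hω, rfl⟩, rfl⟩
    simp only [Set.mem_ofPred_eq, not_not] at hω ⊢
    simp [real_inner_smul_right, hω]
  rw [this, mul_zero]

end Pointwise

/-! ### The symbol -/

theorem cdot_eq {d : ℕ} (k : CVec d) (x : RVec d) :
    cdot k x = (inner ℝ (reVec k) x : ℝ) + Complex.I * (inner ℝ (imVec k) x : ℝ) := by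
  simp only [cdot, PiLp.inner_apply, reVec, imVec, RCLike.inner_apply, conj_trivial]
  push_cast
  rw [Finset.mul_sum, ← Finset.sum_add_distrib]
  refine Finset.sum_congr rfl fun i _ => ?_
  conv_lhs => rw [← Complex.re_add_im (k i)]
  ring

theorem symb_eq {d : ℕ} (k : CVec d) (ξ : RVec d) :
    symb k ξ = ((‖ξ‖ ^ 2 + 2 * inner ℝ (reVec k) ξ : ℝ) : ℂ) +
      Complex.I * ((2 * inner ℝ (imVec k) ξ : ℝ) : ℂ) := by
  rw [symb, cdot_eq]; push_cast; ring

theorem symb_re {d : ℕ} (k : CVec d) (ξ : RVec d) :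
    (symb k ξ).re = ‖ξ‖ ^ 2 + 2 * inner ℝ (reVec k) ξ := by
  rw [symb_eq]; simp [-Complex.ofReal_add, -Complex.ofReal_mul, -Complex.ofReal_pow]

theorem symb_im {d : ℕ} (k : CVec d) (ξ : RVec d) :
    (symb k ξ).im = 2 * inner ℝ (imVec k) ξ := by
  rw [symb_eq]; simp [-Complex.ofReal_add, -Complex.ofReal_mul, -Complex.ofReal_pow]

theorem continuous_cdot {d : ℕ} (k : CVec d) : Continuous (cdot k) := by
  unfold cdot; fun_prop

theorem continuous_symb {d : ℕ} (k : CVec d) : Continuous (symb k) := by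
  unfold symb
  have := continuous_cdot k
  fun_prop

theorem continuous_planeWave {d : ℕ} :
    Continuous (fun p : RVec d × RVec d => planeWave p.1 p.2) := by
  unfold planeWave; fun_prop

theorem norm_planeWave {d : ℕ} (ξ x : RVec d) : ‖planeWave ξ x‖ = 1 := by
  rw [planeWave, mul_comm, Complex.norm_exp_ofReal_mul_I]

theorem planeWave_add_left {d : ℕ} (ξ η x : RVec d) :
    planeWave (ξ + η) x = planeWave ξ x * planeWave η x := by
  simp only [planeWave, inner_add_left, Complex.ofReal_add, mul_add, Complex.exp_add]

theorem planeWave_add_right {d : ℕ} (ξ x y : RVec d) :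
    planeWave ξ (x + y) = planeWave ξ x * planeWave ξ y := by
  simp only [planeWave, inner_add_right, Complex.ofReal_add, mul_add, Complex.exp_add]

theorem planeWave_neg_left {d : ℕ} (ξ x : RVec d) : planeWave (-ξ) x = planeWave ξ (-x) := by
  simp [planeWave]

theorem planeWave_zero_right {d : ℕ} (ξ : RVec d) : planeWave ξ 0 = 1 := by
  simp [planeWave]

theorem planeWave_ne_zero {d : ℕ} (ξ x : RVec d) : planeWave ξ x ≠ 0 := Complex.exp_ne_zero _

theorem inner_re_im {d : ℕ} {k : CVec d} {E : ℝ} (h : csq k = (E : ℂ)) :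
    inner ℝ (imVec k) (reVec k) = 0 := by
  have := congrArg Complex.im h
  simp only [csq, Complex.im_sum, Complex.ofReal_im, pow_two, Complex.mul_im] at this
  simp only [PiLp.inner_apply, reVec, imVec, RCLike.inner_apply, conj_trivial]
  have h2 : ∑ i, ((k i).re * (k i).im + (k i).im * (k i).re) = 2 * ∑ i, (k i).re * (k i).im := by
    rw [Finset.mul_sum]; exact Finset.sum_congr rfl fun i _ => by ring
  linarith

/-- The symbol in the shifted variable. -/
theorem symb_sub_re {d : ℕ} {k : CVec d} (h : inner ℝ (imVec k) (reVec k) = 0) (ζ : RVec d) :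
    symb k (ζ - reVec k) = ((‖ζ‖ ^ 2 - ‖reVec k‖ ^ 2 : ℝ) : ℂ) +
      Complex.I * ((2 * inner ℝ (imVec k) ζ : ℝ) : ℂ) := by
  rw [symb_eq, inner_sub_right, inner_sub_right, h, norm_sub_sq_real, real_inner_self_eq_norm_sq,
    real_inner_comm ζ]
  push_cast; ring

theorem norm_inner_add_le {d : ℕ} (k : CVec d) (ξ : RVec d) :
    ‖cdot k ξ‖ ≤ (‖reVec k‖ + ‖imVec k‖) * ‖ξ‖ := by
  rw [cdot_eq, add_mul]
  refine (norm_add_le _ _).trans (add_le_add ?_ ?_)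
  · rw [Complex.norm_real]; exact norm_inner_le_norm _ _
  · rw [norm_mul, Complex.norm_I, one_mul, Complex.norm_real]; exact norm_inner_le_norm _ _

/-- The constant `4` makes the linear term at most half of the quadratic one: `2|kξ| ≤ |ξ|²/2`. -/
theorem symb_lower {d : ℕ} {k : CVec d} {ξ : RVec d}
    (h : 4 * (‖reVec k‖ + ‖imVec k‖) ≤ ‖ξ‖) : ‖ξ‖ ^ 2 / 2 ≤ ‖symb k ξ‖ := by
  have h1 := norm_inner_add_le k ξ
  have h2 : ‖(((‖ξ‖ ^ 2 : ℝ) : ℂ))‖ = ‖ξ‖ ^ 2 := by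
    rw [Complex.norm_real, Real.norm_of_nonneg (by positivity)]
  have h3 : ‖ξ‖ ^ 2 - 2 * ‖cdot k ξ‖ ≤ ‖symb k ξ‖ := by
    have := norm_sub_norm_le (((‖ξ‖ ^ 2 : ℝ) : ℂ)) (-(2 * cdot k ξ))
    rw [sub_neg_eq_add, h2, norm_neg, norm_mul, Complex.norm_ofNat] at this
    exact this
  nlinarith [norm_nonneg ξ]

theorem symb_ne_zero_ae {d : ℕ} {k : CVec d} (h : imVec k ≠ 0) : ∀ᵐ ξ, symb k ξ ≠ 0 := by
  filter_upwards [volume_inner_eq_zero h] with ξ hξ h0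
  apply hξ
  have := congrArg Complex.im h0
  rw [symb_im] at this
  simpa using this

/-! ### Local integrability of the inverse symbol -/

theorem rpow_neg_half_sq {t : ℝ} (ht : 0 < t) : t ^ (-(1/2) : ℝ) * t ^ (-(1/2) : ℝ) = t⁻¹ := by
  rw [← Real.rpow_add ht, ← Real.rpow_neg_one]; norm_num

/-- The modulus is at least `r|r - κ|` by its real part and at least `r|t|` by its imaginary part.
The geometric mean of the two bounds separates the radial from the angular singularity and leaves
exponent `1/2` on each, which is integrable. -/
theorem inv_shifted_bound {κ r : ℝ} (hκ : 0 ≤ κ) (hr : 0 < r) (hrκ : r ≠ κ) {t : ℝ} (ht : t ≠ 0) :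
    ‖(((r ^ 2 - κ ^ 2 : ℝ) : ℂ) + Complex.I * ((r * t : ℝ) : ℂ))⁻¹‖ ≤
      (r⁻¹ * |r - κ| ^ (-(1/2) : ℝ)) * |t| ^ (-(1/2) : ℝ) := by
  set w : ℂ := ((r ^ 2 - κ ^ 2 : ℝ) : ℂ) + Complex.I * ((r * t : ℝ) : ℂ) with hw
  have hre : w.re = r ^ 2 - κ ^ 2 := by rw [hw]; simp [-Complex.ofReal_mul, -Complex.ofReal_sub]
  have him : w.im = r * t := by rw [hw]; simp [-Complex.ofReal_mul, -Complex.ofReal_sub]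
  have h1 : |r ^ 2 - κ ^ 2| ≤ ‖w‖ := hre ▸ Complex.abs_re_le_norm w
  have h2 : |r * t| ≤ ‖w‖ := him ▸ Complex.abs_im_le_norm w
  have ha : 0 < |r - κ| := abs_pos.2 (sub_ne_zero.2 hrκ)
  have hb : 0 < |t| := abs_pos.2 ht
  have h3 : r * |r - κ| ≤ ‖w‖ := by
    refine le_trans ?_ h1
    rw [show r ^ 2 - κ ^ 2 = (r + κ) * (r - κ) by ring, abs_mul, abs_of_pos (by positivity : 0 < r + κ)]
    gcongr; linarith
  rw [abs_mul, abs_of_pos hr] at h2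
  have hw0 : 0 < ‖w‖ := lt_of_lt_of_le (by positivity) h2
  rw [norm_inv]
  apply le_of_sq_le_sq _ (by positivity)
  have h4 : ((r⁻¹ * |r - κ| ^ (-(1/2) : ℝ)) * |t| ^ (-(1/2) : ℝ)) ^ 2 =
      (r * |r - κ|)⁻¹ * (r * |t|)⁻¹ := by
    have e1 := rpow_neg_half_sq ha
    have e2 := rpow_neg_half_sq hb
    calc _ = r⁻¹ * r⁻¹ * (|r - κ| ^ (-(1/2) : ℝ) * |r - κ| ^ (-(1/2) : ℝ)) *
          (|t| ^ (-(1/2) : ℝ) * |t| ^ (-(1/2) : ℝ)) := by ring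
      _ = _ := by rw [e1, e2, mul_inv, mul_inv]; ring
  rw [h4, pow_two]
  gcongr

/-- In polar coordinates the bound of `inv_shifted_bound` is a product of an angular and a radial
function. The Jacobian `r^(d-1)` absorbs the factor `1/r`, which is where `d ≥ 2` enters. -/
theorem integrableOn_inv_shifted {d : ℕ} [NeZero d] (hd : 2 ≤ d) {κ : ℝ} (hκ : 0 ≤ κ) {b : RVec d}
    (hb : b ≠ 0) (R : ℝ) :
    IntegrableOn (fun ζ : RVec d => (((‖ζ‖ ^ 2 - κ ^ 2 : ℝ) : ℂ) +
      Complex.I * ((2 * inner ℝ b ζ : ℝ) : ℂ))⁻¹) (shell d 0 R) := by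
  have hm : Measurable (fun ζ : RVec d => (((‖ζ‖ ^ 2 - κ ^ 2 : ℝ) : ℂ) +
      Complex.I * ((2 * inner ℝ b ζ : ℝ) : ℂ))⁻¹) := by fun_prop
  rw [integrableOn_shell le_rfl hm.aestronglyMeasurable]
  have hb0 : 0 < ‖b‖ := norm_pos_iff.2 hb
  have h1 : Integrable (fun ω : Sph d => |2 * inner ℝ b (ω : RVec d)| ^ (-(1/2) : ℝ)) (sphMeas d) := by
    have hu : ‖‖b‖⁻¹ • b‖ = 1 := by
      rw [norm_smul, norm_inv, norm_norm, inv_mul_cancel₀ hb0.ne']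
    refine ((integrable_sph_rpow hu).const_mul ((2 * ‖b‖) ^ (-(1/2) : ℝ))).congr
      (Eventually.of_forall fun ω => ?_)
    simp only
    rw [← Real.mul_rpow (by positivity) (abs_nonneg _), real_inner_smul_left, abs_mul,
      abs_of_pos (inv_pos.2 hb0), abs_mul, abs_two]
    congr 1
    field_simp
  have h2 : Integrable (fun r : ℝ => r ^ (d - 2) * |r - κ| ^ (-(1/2) : ℝ))
      (volume.restrict (Set.Ioc 0 R)) := by
    rcases le_or_gt R 0 with hR | hR
    · simp [Set.Ioc_eq_empty (not_lt.2 hR)]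
    refine (intervalIntegrable_iff_integrableOn_Ioc_of_le hR.le).1 ?_
    refine IntervalIntegrable.continuousOn_mul ?_ (by fun_prop)
    simpa using (intervalIntegrable_abs_rpow (0 - κ) (R - κ)).comp_sub_right κ
  refine (h1.mul_prod h2).mono' ?_ ?_
  · refine Measurable.aestronglyMeasurable ?_
    fun_prop
  have e1 : ∀ᵐ p ∂((sphMeas d).prod (volume.restrict (Set.Ioc (0:ℝ) R))), p.2 ∈ Set.Ioc (0:ℝ) R :=
    (Measure.quasiMeasurePreserving_snd).ae (ae_restrict_mem measurableSet_Ioc)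
  have e2 : ∀ᵐ p ∂((sphMeas d).prod (volume.restrict (Set.Ioc (0:ℝ) R))), p.2 ≠ κ :=
    (Measure.quasiMeasurePreserving_snd).ae (ae_restrict_of_ae (Measure.ae_ne volume κ))
  have e3 : ∀ᵐ p ∂((sphMeas d).prod (volume.restrict (Set.Ioc (0:ℝ) R))), inner ℝ b (p.1 : RVec d) ≠ 0 :=
    (Measure.quasiMeasurePreserving_fst).ae (sph_inner_ne_zero hb)
  filter_upwards [e1, e2, e3] with p h1 h2 h3
  have h := inv_shifted_bound hκ h1.1 h2 (mul_ne_zero two_ne_zero h3)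
  rw [norm_mul, Complex.norm_real, Real.norm_of_nonneg (pow_nonneg h1.1.le _), norm_smul_sph h1.1.le,
    real_inner_smul_right, mul_left_comm]
  calc _ ≤ p.2 ^ (d - 1) * ((p.2⁻¹ * |p.2 - κ| ^ (-(1/2) : ℝ)) *
        |2 * inner ℝ b (p.1 : RVec d)| ^ (-(1/2) : ℝ)) := by
        have := pow_nonneg h1.1.le (d - 1)
        gcongr
    _ = _ := by
        rw [show d - 1 = (d - 2) + 1 by omega, pow_succ]
        field_simp [h1.1.ne']

theorem shell_zero_ae (d : ℕ) [NeZero d] (R : ℝ) :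
    (shell d 0 R : Set (RVec d)) =ᵐ[volume] Metric.closedBall 0 R := by
  filter_upwards [Measure.ae_ne volume (0 : RVec d)] with ξ hξ
  apply propext
  have : 0 < ‖ξ‖ := norm_pos_iff.2 hξ
  change (0 < ‖ξ‖ ∧ ‖ξ‖ ≤ R) ↔ dist ξ 0 ≤ R
  rw [dist_zero_right]
  tauto

/-- Translation by `Re k` brings the symbol to the shifted form, because `Re k` and `Im k` are
orthogonal; the radius grows by `|Re k|` to make room for it. -/
theorem integrableOn_inv_symb {d : ℕ} [NeZero d] (hd : 2 ≤ d) {k : CVec d}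
    (h : inner ℝ (imVec k) (reVec k) = 0) (hb : imVec k ≠ 0) (R : ℝ) :
    IntegrableOn (fun ξ => (symb k ξ)⁻¹) (Metric.closedBall 0 R) := by
  have h1 := integrableOn_inv_shifted hd (norm_nonneg (reVec k)) hb (R + ‖reVec k‖)
  rw [integrableOn_congr_set_ae (shell_zero_ae d _)] at h1
  simp_rw [← symb_sub_re h] at h1
  have h2 := ((measurePreserving_add_right (volume : Measure (RVec d)) (reVec k)).integrableOn_comp_preimage
    (measurableEmbedding_addRight (reVec k))).2 h1
  refine (h2.congr_fun (fun ξ _ => by simp) ?_).mono_set ?_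
  · exact Metric.isClosed_closedBall.measurableSet.preimage (measurable_add_const _)
  · intro ξ hξ
    simp only [Set.mem_preimage, mem_closedBall_zero_iff] at hξ ⊢
    exact (norm_add_le _ _).trans (by linarith)

theorem integrable_div_symb {d : ℕ} [NeZero d] (hd : 2 ≤ d) {k : CVec d}
    (h : inner ℝ (imVec k) (reVec k) = 0) (hb : imVec k ≠ 0) {F : RVec d → ℂ} (hF : Integrable F)
    {C : ℝ} (hC : ∀ ξ, ‖F ξ‖ ≤ C) : Integrable (fun ξ => F ξ / symb k ξ) := by
  -- The extra `1` gives `|ξ| ≥ 1` outside the ball, hence a symbol of modulus at least `1/2` there.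
  set R : ℝ := 4 * (‖reVec k‖ + ‖imVec k‖) + 1 with hR
  rw [← integrableOn_univ, ← Set.union_compl_self (Metric.closedBall (0 : RVec d) R)]
  simp_rw [div_eq_mul_inv]
  refine IntegrableOn.union ?_ ?_
  · exact (integrableOn_inv_symb hd h hb R).bdd_mul hF.aestronglyMeasurable.restrict
      (Eventually.of_forall hC)
  · refine Integrable.mul_bdd (c := 2) hF.integrableOn
      (continuous_symb k).measurable.inv.aestronglyMeasurable ?_
    filter_upwards [ae_restrict_mem Metric.isClosed_closedBall.measurableSet.compl] with ξ hξ
    simp only [Set.mem_compl_iff, mem_closedBall_zero_iff, not_le] at hξ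
    have h1 : 1 ≤ ‖ξ‖ := by
      have := norm_nonneg (reVec k); have := norm_nonneg (imVec k); linarith
    have h2 := symb_lower (k := k) (ξ := ξ) (by linarith)
    rw [norm_inv]
    refine inv_le_of_inv_le₀ (by norm_num) ?_
    nlinarith

/-! ### The oscillatory integral `∫ e^{irs} / r dr` -/

/-- `∫_p^R e^{irs} / r dr`. -/
noncomputable def oscInt (p R s : ℝ) : ℂ :=
  ∫ r in p..R, Complex.exp (Complex.I * ((r * s : ℝ) : ℂ)) * ((r⁻¹ : ℝ) : ℂ)

theorem norm_exp_I_mul_ofReal (t : ℝ) : ‖Complex.exp (Complex.I * (t : ℂ))‖ = 1 := by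
  rw [mul_comm, Complex.norm_exp_ofReal_mul_I]

theorem hasDerivAt_exp_I (s r : ℝ) :
    HasDerivAt (fun r : ℝ => Complex.exp (Complex.I * ((r * s : ℝ) : ℂ)))
      (Complex.I * s * Complex.exp (Complex.I * ((r * s : ℝ) : ℂ))) r := by
  have h1 : HasDerivAt (fun r : ℝ => ((r * s : ℝ) : ℂ)) (s : ℂ) r := by
    have := ((hasDerivAt_id r).mul_const s).ofReal_comp
    simpa using this
  have := (h1.const_mul Complex.I).cexp
  convert this using 1; ring

theorem hasDerivAt_inv_ofReal {r : ℝ} (hr : r ≠ 0) :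
    HasDerivAt (fun r : ℝ => ((r⁻¹ : ℝ) : ℂ)) ((-(r ^ 2)⁻¹ : ℝ) : ℂ) r := by
  have := (hasDerivAt_inv hr).ofReal_comp
  simpa using this

theorem continuousOn_inv_ofReal {p R : ℝ} (hp : 0 < p) (hR : p ≤ R) :
    ContinuousOn (fun r : ℝ => ((r⁻¹ : ℝ) : ℂ)) (Set.uIcc p R) := by
  intro r hr
  rw [Set.uIcc_of_le hR] at hr
  exact (hasDerivAt_inv_ofReal (hp.trans_le hr.1).ne').continuousAt.continuousWithinAt

theorem continuousOn_inv_sq_ofReal {p R : ℝ} (hp : 0 < p) (hR : p ≤ R) :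
    ContinuousOn (fun r : ℝ => ((-(r ^ 2)⁻¹ : ℝ) : ℂ)) (Set.uIcc p R) := by
  rw [Set.uIcc_of_le hR]
  refine Complex.continuous_ofReal.comp_continuousOn (ContinuousOn.neg (ContinuousOn.inv₀ (by fun_prop) ?_))
  intro r hr
  have := hp.trans_le hr.1
  positivity

/-- Integration by parts: integrating the exponential gains `1/s`, and differentiating `1/r` gives
an absolutely integrable tail. -/
theorem oscInt_eq {p R s : ℝ} (hp : 0 < p) (hR : p ≤ R) (hs : s ≠ 0) :
    oscInt p R s = (Complex.I * s)⁻¹ *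
      (((R⁻¹ : ℝ) : ℂ) * Complex.exp (Complex.I * ((R * s : ℝ) : ℂ)) -
        ((p⁻¹ : ℝ) : ℂ) * Complex.exp (Complex.I * ((p * s : ℝ) : ℂ)) -
      ∫ r in p..R, ((-(r ^ 2)⁻¹ : ℝ) : ℂ) * Complex.exp (Complex.I * ((r * s : ℝ) : ℂ))) := by
  have h := intervalIntegral.integral_mul_deriv_eq_deriv_mul
    (u := fun r : ℝ => ((r⁻¹ : ℝ) : ℂ)) (v := fun r : ℝ => Complex.exp (Complex.I * ((r * s : ℝ) : ℂ)))
    (u' := fun r : ℝ => ((-(r ^ 2)⁻¹ : ℝ) : ℂ))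
    (v' := fun r : ℝ => Complex.I * s * Complex.exp (Complex.I * ((r * s : ℝ) : ℂ)))
    (a := p) (b := R) (fun r hr => hasDerivAt_inv_ofReal (by
      rw [Set.uIcc_of_le hR] at hr; exact (hp.trans_le hr.1).ne'))
    (fun r _ => hasDerivAt_exp_I s r)
    (continuousOn_inv_sq_ofReal hp hR).intervalIntegrable
    (Continuous.intervalIntegrable (by fun_prop) _ _)
  have hI : Complex.I * (s : ℂ) ≠ 0 := mul_ne_zero Complex.I_ne_zero (Complex.ofReal_ne_zero.2 hs)
  rw [← h, eq_inv_mul_iff_mul_eq₀ hI, oscInt, ← intervalIntegral.integral_const_mul]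
  congr 1; ext r; ring

theorem norm_oscInt_le_log {p R : ℝ} (hp : 0 < p) (hR : p ≤ R) (s : ℝ) :
    ‖oscInt p R s‖ ≤ Real.log (R / p) := by
  rw [← integral_inv_of_pos hp (hp.trans_le hR), oscInt]
  refine intervalIntegral.norm_integral_le_of_norm_le hR (Eventually.of_forall fun r hr => ?_) ?_
  · rw [norm_mul, norm_exp_I_mul_ofReal, one_mul, Complex.norm_real,
      Real.norm_of_nonneg (inv_nonneg.2 (hp.trans hr.1).le)]
  · exact intervalIntegral.intervalIntegrable_inv (fun r hr => by
      rw [Set.uIcc_of_le hR] at hr; exact (hp.trans_le hr.1).ne') continuousOn_id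

theorem norm_oscInt_le_inv {p R s : ℝ} (hp : 0 < p) (hR : p ≤ R) (hs : s ≠ 0) :
    ‖oscInt p R s‖ ≤ 2 / (p * |s|) := by
  have h0 : 0 < |s| := abs_pos.2 hs
  have hR0 := hp.trans_le hR
  have h1 : ‖∫ r in p..R, ((-(r ^ 2)⁻¹ : ℝ) : ℂ) * Complex.exp (Complex.I * ((r * s : ℝ) : ℂ))‖ ≤
      p⁻¹ - R⁻¹ := by
    have h2 : ∫ r in p..R, (r ^ 2)⁻¹ = p⁻¹ - R⁻¹ := by
      have h := intervalIntegral.integral_eq_sub_of_hasDerivAt (a := p) (b := R)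
        (f := fun r : ℝ => -r⁻¹) (f' := fun r => (r^2)⁻¹) (fun r hr => by
          rw [Set.uIcc_of_le hR] at hr
          have := (hasDerivAt_inv (hp.trans_le hr.1).ne').fun_neg
          simpa using this) ?_
      · rw [h]; ring
      · refine ContinuousOn.intervalIntegrable ?_
        rw [Set.uIcc_of_le hR]
        exact ContinuousOn.inv₀ (by fun_prop) (fun r hr => by have := hp.trans_le hr.1; positivity)
    rw [← h2]
    refine intervalIntegral.norm_integral_le_of_norm_le hR (Eventually.of_forall fun r hr => ?_) ?_
    · rw [norm_mul, norm_exp_I_mul_ofReal, mul_one, Complex.norm_real, norm_neg,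
        Real.norm_of_nonneg (by positivity)]
    · refine ContinuousOn.intervalIntegrable ?_
      rw [Set.uIcc_of_le hR]
      exact ContinuousOn.inv₀ (by fun_prop) (fun r hr => by have := hp.trans_le hr.1; positivity)
  rw [oscInt_eq hp hR hs, norm_mul, norm_inv, norm_mul, Complex.norm_I, one_mul, Complex.norm_real,
    Real.norm_eq_abs]
  have h3 : ∀ t : ℝ, 0 < t → ‖((t⁻¹ : ℝ) : ℂ) * Complex.exp (Complex.I * ((t * s : ℝ) : ℂ))‖ = t⁻¹ := by
    intro t ht
    rw [norm_mul, norm_exp_I_mul_ofReal, mul_one, Complex.norm_real, Real.norm_of_nonneg (by positivity)]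
  have h4 := norm_sub_le (((R⁻¹ : ℝ) : ℂ) * Complex.exp (Complex.I * ((R * s : ℝ) : ℂ)))
    (((p⁻¹ : ℝ) : ℂ) * Complex.exp (Complex.I * ((p * s : ℝ) : ℂ)))
  rw [h3 R hR0, h3 p hp] at h4
  calc _ ≤ |s|⁻¹ * ((R⁻¹ + p⁻¹) + (p⁻¹ - R⁻¹)) := by
        gcongr
        exact (norm_sub_le _ _).trans (add_le_add h4 h1)
    _ = _ := by field_simp; ring

/-- Cut at `r = 1/|s|`. Below the cut there is no oscillation and the integral is at most a
logarithm, hence at most `2|s|^(-1/2)`; above it, integration by parts gives at most `2`. The bound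
is uniform in `p` and `R`, and with `s = ω·x` it is integrable over the sphere. -/
theorem norm_oscInt_le {p R : ℝ} (hp : 1 ≤ p) (hR : p ≤ R) {s : ℝ} (hs : s ≠ 0) :
    ‖oscInt p R s‖ ≤ 2 + 2 * |s| ^ (-(1/2) : ℝ) := by
  have h0 : 0 < |s| := abs_pos.2 hs
  have hp0 : 0 < p := by linarith
  have hpos : 0 ≤ |s| ^ (-(1/2) : ℝ) := by positivity
  have hlog : ∀ t, 0 < t → t ≤ |s|⁻¹ → Real.log (t / p) ≤ 2 * |s| ^ (-(1/2) : ℝ) := by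
    intro t ht hts
    have h1 : Real.log (t / p) ≤ Real.log |s|⁻¹ := by
      apply Real.log_le_log (by positivity)
      rw [div_le_iff₀ hp0]
      exact hts.trans (le_mul_of_one_le_right (by positivity) hp)
    refine h1.trans ((Real.log_le_rpow_div (by positivity) (by norm_num : (0:ℝ) < 1/2)).trans ?_)
    rw [Real.inv_rpow h0.le, ← Real.rpow_neg h0.le]
    linarith
  rcases le_or_gt R |s|⁻¹ with h | h
  · exact (norm_oscInt_le_log hp0 hR s).trans ((hlog R (by linarith) h).trans (by linarith))
  rcases le_or_gt |s|⁻¹ p with h' | h'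
  · refine (norm_oscInt_le_inv hp0 hR hs).trans ?_
    rw [div_le_iff₀ (by positivity)]
    have : 1 ≤ p * |s| := by rwa [inv_le_iff_one_le_mul₀ h0] at h'
    nlinarith
  · have hadd : oscInt p R s = oscInt p |s|⁻¹ s + oscInt |s|⁻¹ R s := by
      rw [oscInt, oscInt, oscInt, intervalIntegral.integral_add_adjacent_intervals]
      · exact ((Continuous.continuousOn (by fun_prop)).mul (continuousOn_inv_ofReal hp0 h'.le)).intervalIntegrable
      · exact ((Continuous.continuousOn (by fun_prop)).mul (continuousOn_inv_ofReal (by positivity) h.le)).intervalIntegrable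
    have h1 := norm_oscInt_le_log hp0 h'.le s
    have h2 := norm_oscInt_le_inv (by positivity) h.le hs
    have h3 := hlog |s|⁻¹ (by positivity) le_rfl
    rw [inv_mul_cancel₀ h0.ne', div_one] at h2
    rw [hadd]
    exact (norm_add_le _ _).trans (by linarith)

theorem tendsto_oscInt {p s : ℝ} (hp : 0 < p) (hs : s ≠ 0) :
    ∃ l, Tendsto (fun R => oscInt p R s) atTop (𝓝 l) := by
  have hint : IntegrableOn (fun r : ℝ => ((-(r ^ 2)⁻¹ : ℝ) : ℂ) *
      Complex.exp (Complex.I * ((r * s : ℝ) : ℂ))) (Set.Ioi p) := by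
    have h1 : IntegrableOn (fun r : ℝ => r ^ (-2 : ℝ)) (Set.Ioi p) :=
      integrableOn_Ioi_rpow_of_lt (by norm_num) hp
    refine h1.mono' ?_ ?_
    · exact Measurable.aestronglyMeasurable (by fun_prop)
    · filter_upwards [ae_restrict_mem measurableSet_Ioi] with r hr
      have hr0 : 0 < r := hp.trans hr
      rw [norm_mul, norm_exp_I_mul_ofReal, mul_one, Complex.norm_real, norm_neg,
        Real.norm_of_nonneg (by positivity), Real.rpow_neg hr0.le]
      norm_num
  have h1 := intervalIntegral_tendsto_integral_Ioi p hint tendsto_id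
  have h2 : Tendsto (fun R : ℝ => ((R⁻¹ : ℝ) : ℂ) * Complex.exp (Complex.I * ((R * s : ℝ) : ℂ)))
      atTop (𝓝 0) := by
    rw [tendsto_zero_iff_norm_tendsto_zero]
    refine tendsto_inv_atTop_zero.congr' ?_
    filter_upwards [eventually_gt_atTop 0] with R hR
    rw [norm_mul, norm_exp_I_mul_ofReal, mul_one, Complex.norm_real, Real.norm_of_nonneg (by positivity)]
  have h3 := ((h2.sub_const (((p⁻¹ : ℝ) : ℂ) * Complex.exp (Complex.I * ((p * s : ℝ) : ℂ)))).sub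
    h1).const_mul (Complex.I * (s:ℂ))⁻¹
  refine ⟨_, h3.congr' ?_⟩
  filter_upwards [eventually_ge_atTop p] with R hR
  rw [oscInt_eq hp hR hs]; rfl

/-! ### Integrals over large shells -/

/-- `∫_{p < |ξ| ≤ R} e^{iξx} f(ξ) dξ`. -/
noncomputable def shellInt {d : ℕ} (f : RVec d → ℂ) (p R : ℝ) (x : RVec d) : ℂ :=
  ∫ ξ in shell d p R, planeWave ξ x * f ξ

theorem measurable_planeWave {d : ℕ} (x : RVec d) : Measurable (fun ξ : RVec d => planeWave ξ x) := by
  have : Continuous (fun ξ : RVec d => planeWave ξ x) :=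
    continuous_planeWave.comp (continuous_id.prodMk continuous_const)
  exact this.measurable

theorem integrableOn_planeWave_mul {d : ℕ} {f : RVec d → ℂ} {s : Set (RVec d)} (hf : IntegrableOn f s)
    (x : RVec d) : IntegrableOn (fun ξ => planeWave ξ x * f ξ) s :=
  hf.bdd_mul (c := 1) (measurable_planeWave x).aestronglyMeasurable
    (Eventually.of_forall fun ξ => (norm_planeWave ξ x).le)

theorem norm_shellInt_le {d : ℕ} {f : RVec d → ℂ} {p : ℝ}
    (hf : IntegrableOn f {ξ | p < ‖ξ‖}) (R : ℝ) (x : RVec d) :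
    ‖shellInt f p R x‖ ≤ ∫ ξ in {ξ : RVec d | p < ‖ξ‖}, ‖f ξ‖ := by
  refine (norm_integral_le_integral_norm _).trans ?_
  simp_rw [norm_mul, norm_planeWave, one_mul]
  refine setIntegral_mono_set hf.norm (Eventually.of_forall fun ξ => norm_nonneg _)
    (LE.le.eventuallyLE fun ξ hξ => hξ.1)

theorem tendsto_shellInt {d : ℕ} {f : RVec d → ℂ} {p : ℝ}
    (hf : IntegrableOn f {ξ | p < ‖ξ‖}) (x : RVec d) :
    Tendsto (fun R => shellInt f p R x) atTop
      (𝓝 (∫ ξ in {ξ : RVec d | p < ‖ξ‖}, planeWave ξ x * f ξ)) := by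
  have hu : (⋃ R : ℝ, shell d p R) = {ξ : RVec d | p < ‖ξ‖} := by
    ext ξ; simp only [shell, Set.mem_iUnion, Set.mem_ofPred_eq, exists_and_left, and_iff_left_iff_imp]
    exact fun _ => ⟨_, le_rfl⟩
  rw [← hu]
  refine tendsto_setIntegral_of_monotone (fun R => measurableSet_shell d p R) ?_ ?_
  · exact fun R R' h ξ hξ => ⟨hξ.1, hξ.2.trans h⟩
  · rw [hu]; exact integrableOn_planeWave_mul hf x

/-- Comparison with `(1 + |ξ|)^(-m)`, since `1 + |ξ| ≤ 2|ξ|` outside the unit ball. -/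
theorem integrableOn_norm_pow_inv {d m : ℕ} (hm : d < m) :
    IntegrableOn (fun ξ : RVec d => (‖ξ‖ ^ m)⁻¹) {ξ | 1 < ‖ξ‖} := by
  have h1 : Integrable (fun ξ : RVec d => (1 + ‖ξ‖) ^ (-(m : ℝ))) :=
    integrable_one_add_norm (by simpa using hm)
  refine ((h1.const_mul (2 ^ m)).integrableOn).mono' (by
    exact Measurable.aestronglyMeasurable (by fun_prop)) ?_
  filter_upwards [ae_restrict_mem (measurableSet_lt measurable_const measurable_norm)] with ξ hξ
  have hξ0 : 0 < ‖ξ‖ := zero_lt_one.trans hξ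
  rw [Real.rpow_neg (by positivity), Real.rpow_natCast, Real.norm_of_nonneg (by positivity),
    ← div_eq_mul_inv, inv_eq_one_div, div_le_div_iff₀ (by positivity) (by positivity), one_mul, ← mul_pow]
  exact pow_le_pow_left₀ (by positivity) (by linarith [show (1:ℝ) < ‖ξ‖ from hξ]) _

/-- Shell integrals of functions homogeneous of degree `-d`. -/
theorem shellInt_hom {d : ℕ} [NeZero d] {f : RVec d → ℂ} (hm : Measurable f) {B : ℝ}
    (hB : ∀ ω, ‖ω‖ = 1 → ‖f ω‖ ≤ B) (hh : ∀ r : ℝ, 0 < r → ∀ ξ, f (r • ξ) = (((r ^ d)⁻¹ : ℝ) : ℂ) * f ξ)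
    {p R : ℝ} (hp : 0 < p) (hR : p ≤ R) (x : RVec d) :
    shellInt f p R x = ∫ ω : Sph d, f ω * oscInt p R (inner ℝ (ω : RVec d) x) ∂(sphMeas d) := by
  have hi : IntegrableOn f (shell d p R) := by
    refine Measure.integrableOn_of_bounded (M := (p ^ d)⁻¹ * B) (volume_shell_lt_top d p R).ne
      hm.aestronglyMeasurable ?_
    filter_upwards [ae_restrict_mem (measurableSet_shell d p R)] with ξ hξ
    have h0 : 0 < ‖ξ‖ := hp.trans hξ.1
    have h1 : ‖‖ξ‖⁻¹ • ξ‖ = 1 := by rw [norm_smul, norm_inv, norm_norm, inv_mul_cancel₀ h0.ne']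
    have h2 : f ξ = f (‖ξ‖ • ‖ξ‖⁻¹ • ξ) := by rw [smul_smul, mul_inv_cancel₀ h0.ne', one_smul]
    rw [h2, hh _ h0, norm_mul, Complex.norm_real, Real.norm_of_nonneg (by positivity)]
    have := hB _ h1
    have := (norm_nonneg _).trans this
    have := hξ.1
    gcongr
  have hm' : Measurable fun ξ => planeWave ξ x * f ξ := (measurable_planeWave x).mul hm
  rw [shellInt, setIntegral_shell_eq hp.le hR hm'.aestronglyMeasurable
    (integrableOn_planeWave_mul hi x)]
  refine integral_congr_ae (Eventually.of_forall fun ω => ?_)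
  simp only
  rw [oscInt, ← intervalIntegral.integral_const_mul]
  refine intervalIntegral.integral_congr fun r hr => ?_
  rw [Set.uIcc_of_le hR] at hr
  have hr0 : 0 < r := hp.trans_le hr.1
  rw [hh r hr0, planeWave, real_inner_smul_left]
  have hd : 0 < d := Nat.pos_of_ne_zero (NeZero.ne d)
  have h3 : ((r ^ (d-1) : ℝ) : ℂ) * (((r ^ d)⁻¹ : ℝ) : ℂ) = ((r⁻¹ : ℝ) : ℂ) := by
    rw [← Complex.ofReal_mul]
    congr 1
    obtain ⟨m, rfl⟩ : ∃ m, d = m + 1 := ⟨d - 1, by omega⟩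
    simp only [Nat.add_sub_cancel]
    field_simp
    ring
  rw [← h3]; ring

theorem aestronglyMeasurable_oscInt {d : ℕ} (p R : ℝ) (x : RVec d) :
    Measurable (fun ω : RVec d => oscInt p R (inner ℝ ω x)) := by
  have : StronglyMeasurable (fun ω : RVec d => oscInt p R (inner ℝ ω x)) := by
    simp only [oscInt, intervalIntegral]
    refine StronglyMeasurable.sub ?_ ?_ <;>
    · refine StronglyMeasurable.integral_prod_right' (f := fun q : RVec d × ℝ => 
        Complex.exp (Complex.I * ((q.2 * inner ℝ q.1 x : ℝ) : ℂ)) * ((q.2⁻¹ : ℝ) : ℂ)) ?_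
      exact Measurable.stronglyMeasurable (by fun_prop)
  exact this.measurable

/-- The integral of `|⟨u, ω⟩|^{-1/2}` over the sphere, for any unit vector `u`. -/
noncomputable def sphConst (d : ℕ) [NeZero d] : ℝ :=
  ∫ ω : Sph d, |inner ℝ (EuclideanSpace.single (0 : Fin d) (1:ℝ)) (ω : RVec d)| ^ (-(1/2) : ℝ) ∂(sphMeas d)

theorem sph_rpow_scale {d : ℕ} [NeZero d] {x : RVec d} (hx : x ≠ 0) :
    Integrable (fun ω : Sph d => |inner ℝ (ω : RVec d) x| ^ (-(1/2) : ℝ)) (sphMeas d) ∧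
    ∫ ω : Sph d, |inner ℝ (ω : RVec d) x| ^ (-(1/2) : ℝ) ∂(sphMeas d) =
      ‖x‖ ^ (-(1/2) : ℝ) * sphConst d := by
  have hb0 : 0 < ‖x‖ := norm_pos_iff.2 hx
  have hu : ‖‖x‖⁻¹ • x‖ = 1 := by
    rw [norm_smul, norm_inv, norm_norm, inv_mul_cancel₀ hb0.ne']
  have he : (fun ω : Sph d => |inner ℝ (ω : RVec d) x| ^ (-(1/2) : ℝ)) =
      fun ω : Sph d => ‖x‖ ^ (-(1/2) : ℝ) * |inner ℝ (‖x‖⁻¹ • x) (ω : RVec d)| ^ (-(1/2) : ℝ) := by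
    ext ω
    rw [← Real.mul_rpow (by positivity) (abs_nonneg _), real_inner_smul_left, abs_mul,
      abs_of_pos (inv_pos.2 hb0), real_inner_comm]
    congr 1
    field_simp
  rw [he, integral_const_mul, sphConst, integral_sph_rpow hu (v := EuclideanSpace.single (0 : Fin d) (1:ℝ)) (by simp)]
  exact ⟨(integrable_sph_rpow hu).const_mul _, rfl⟩

theorem hom_integrand_bound {d : ℕ} [NeZero d] {f : RVec d → ℂ} {B : ℝ}
    (hB : ∀ ω, ‖ω‖ = 1 → ‖f ω‖ ≤ B) {p R : ℝ} (hp : 1 ≤ p) (hR : p ≤ R) {x : RVec d} (hx : x ≠ 0) :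
    ∀ᵐ ω : Sph d ∂(sphMeas d), ‖f ω * oscInt p R (inner ℝ (ω : RVec d) x)‖ ≤
      B * (2 + 2 * |inner ℝ (ω : RVec d) x| ^ (-(1/2) : ℝ)) := by
  filter_upwards [sph_inner_ne_zero hx] with ω hω
  rw [real_inner_comm] at hω
  rw [norm_mul]
  have h1 := hB ω (by simp)
  have h2 := norm_oscInt_le hp hR hω
  have := (norm_nonneg _).trans h1
  gcongr

/-- Degree `-d` is the borderline of absolute convergence at infinity. The radial integral is
`oscInt` at `s = ω·x`, and the spherical average of its bound produces the singularity `|x|^(-1/2)`;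
no cancellation between directions is needed. -/
theorem norm_shellInt_hom_le {d : ℕ} [NeZero d] {f : RVec d → ℂ} (hm : Measurable f) {B : ℝ}
    (hB : ∀ ω, ‖ω‖ = 1 → ‖f ω‖ ≤ B) (hh : ∀ r : ℝ, 0 < r → ∀ ξ, f (r • ξ) = (((r ^ d)⁻¹ : ℝ) : ℂ) * f ξ)
    {p R : ℝ} (hp : 1 ≤ p) (hR : p ≤ R) {x : RVec d} (hx : x ≠ 0) :
    ‖shellInt f p R x‖ ≤
      B * (2 * (sphMeas d).real Set.univ + 2 * sphConst d * ‖x‖ ^ (-(1/2) : ℝ)) := by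
  obtain ⟨h1, h2⟩ := sph_rpow_scale hx
  rw [shellInt_hom hm hB hh (by linarith) hR]
  refine (norm_integral_le_of_norm_le ?_ (hom_integrand_bound hB hp hR hx)).trans ?_
  · exact ((integrable_const _).add (h1.const_mul 2)).const_mul B
  · rw [integral_const_mul, integral_add (integrable_const _) (h1.const_mul 2), integral_const_mul, h2,
      integral_const, smul_eq_mul]
    apply le_of_eq; ring

theorem tendsto_shellInt_hom {d : ℕ} [NeZero d] {f : RVec d → ℂ} (hm : Measurable f) {B : ℝ}
    (hB : ∀ ω, ‖ω‖ = 1 → ‖f ω‖ ≤ B) (hh : ∀ r : ℝ, 0 < r → ∀ ξ, f (r • ξ) = (((r ^ d)⁻¹ : ℝ) : ℂ) * f ξ)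
    {p : ℝ} (hp : 1 ≤ p) {x : RVec d} (hx : x ≠ 0) :
    ∃ l, Tendsto (fun R => shellInt f p R x) atTop (𝓝 l) := by
  obtain ⟨h1, h2⟩ := sph_rpow_scale hx
  -- The limit does not matter at `s = 0`: the directions orthogonal to `x` form a null set.
  choose! l hl using fun s (hs : s ≠ 0) => tendsto_oscInt (p := p) (s := s) (by linarith) hs
  refine ⟨∫ ω : Sph d, f ω * l (inner ℝ (ω : RVec d) x) ∂(sphMeas d), ?_⟩
  have h3 : Tendsto (fun R => ∫ ω : Sph d, f ω * oscInt p R (inner ℝ (ω : RVec d) x) ∂(sphMeas d))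
      atTop (𝓝 (∫ ω : Sph d, f ω * l (inner ℝ (ω : RVec d) x) ∂(sphMeas d))) := by
    refine tendsto_integral_filter_of_dominated_convergence
      (fun ω : Sph d => B * (2 + 2 * |inner ℝ (ω : RVec d) x| ^ (-(1/2) : ℝ))) ?_ ?_ ?_ ?_
    · refine Eventually.of_forall fun R => Measurable.aestronglyMeasurable ?_
      exact (hm.mul (aestronglyMeasurable_oscInt p R x)).comp measurable_subtype_coe
    · filter_upwards [eventually_ge_atTop p] with R hR
      exact hom_integrand_bound hB hp hR hx
    · exact ((integrable_const _).add (h1.const_mul 2)).const_mul B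
    · filter_upwards [sph_inner_ne_zero hx] with ω hω
      rw [real_inner_comm] at hω
      exact (hl _ hω).const_mul _
  refine h3.congr' ?_
  filter_upwards [eventually_ge_atTop p] with R hR
  rw [shellInt_hom hm hB hh (by linarith) hR]

/-! ### The sphere in three dimensions -/

theorem measureReal_disc {s : ℝ} (hs : 0 ≤ s) :
    (volume : Measure (Fin 2 → ℝ)).real {v | v 0 ^ 2 + v 1 ^ 2 ≤ s} = Real.pi * s := by
  have h1 := (PiLp.volume_preserving_toLp (Fin 2)).measure_preimage
    (s := Metric.closedBall (0 : EuclideanSpace ℝ (Fin 2)) (Real.sqrt s))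
    Metric.isClosed_closedBall.measurableSet.nullMeasurableSet
  have h2 : (WithLp.toLp 2 : (Fin 2 → ℝ) → EuclideanSpace ℝ (Fin 2)) ⁻¹'
      Metric.closedBall 0 (Real.sqrt s) = {v | v 0 ^ 2 + v 1 ^ 2 ≤ s} := by
    ext v
    simp only [Set.mem_preimage, mem_closedBall_zero_iff, EuclideanSpace.norm_eq, Set.mem_ofPred_eq]
    rw [Real.sqrt_le_sqrt_iff hs]
    simp
  rw [h2, EuclideanSpace.volume_closedBall_fin_two] at h1
  rw [measureReal_def, h1]
  simp [← ENNReal.ofReal_pow, Real.sq_sqrt hs, hs, mul_comm, Real.pi_pos.le]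

/-- Fubini along the first coordinate: the slice of the ball at height `t` is a disc of squared
radius `R² - t²`. -/
theorem setIntegral_closedBall_coord {f : ℝ → ℂ} (hf : Continuous f) {R : ℝ} (hR : 0 ≤ R) :
    ∫ ξ in Metric.closedBall (0 : RVec 3) R, f (ξ 0) =
      ∫ t in (-R)..R, f t * ((Real.pi * (R ^ 2 - t ^ 2) : ℝ) : ℂ) := by
  set e := MeasurableEquiv.piFinSuccAbove (fun _ : Fin 3 => ℝ) 0 with he
  have hmp : MeasurePreserving e volume volume := volume_preserving_piFinSuccAbove (fun _ : Fin 3 => ℝ) 0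
  have hmp2 := EuclideanSpace.volume_preserving_symm_measurableEquiv_toLp (Fin 3)
  set S : Set (ℝ × (Fin 2 → ℝ)) := {p | p.1 ^ 2 + (p.2 0 ^ 2 + p.2 1 ^ 2) ≤ R ^ 2} with hS
  have hSm : MeasurableSet S := measurableSet_le (by fun_prop) measurable_const
  have h1 : ∀ ξ : RVec 3, (e ((MeasurableEquiv.toLp 2 (Fin 3 → ℝ)).symm ξ)) = (ξ 0, fun j => ξ (Fin.succ j)) := by
    intro ξ; rfl
  have hpre : (fun ξ : RVec 3 => e ((MeasurableEquiv.toLp 2 (Fin 3 → ℝ)).symm ξ)) ⁻¹' S =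
      Metric.closedBall 0 R := by
    ext ξ
    simp only [Set.mem_preimage, h1, mem_closedBall_zero_iff, EuclideanSpace.norm_eq, hS, Set.mem_ofPred_eq,
      Real.sqrt_le_left hR, Fin.sum_univ_succ, Real.norm_eq_abs, sq_abs]
    simp
  have h2 := (hmp.comp hmp2).setIntegral_preimage_emb
    (e.measurableEmbedding.comp (MeasurableEquiv.measurableEmbedding _)) (fun p => f p.1) S
  have hpre' : (⇑e ∘ ⇑(MeasurableEquiv.toLp 2 (Fin 3 → ℝ)).symm) ⁻¹' S = Metric.closedBall 0 R := hpre
  rw [hpre'] at h2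
  have h3 : ∀ ξ : RVec 3, ((⇑e ∘ ⇑(MeasurableEquiv.toLp 2 (Fin 3 → ℝ)).symm) ξ).1 = ξ 0 := fun ξ => rfl
  simp_rw [h3] at h2
  rw [h2]
  have hSvol : volume S < ⊤ := by
    rw [← (hmp.comp hmp2).measure_preimage hSm.nullMeasurableSet, hpre']
    exact measure_closedBall_lt_top
  have hint : IntegrableOn (fun p : ℝ × (Fin 2 → ℝ) => f p.1) S := by
    obtain ⟨C, hC⟩ := (isCompact_Icc (a := -R) (b := R)).exists_bound_of_continuousOn hf.continuousOn
    refine Measure.integrableOn_of_bounded (M := C) hSvol.ne (by fun_prop) ?_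
    filter_upwards [ae_restrict_mem hSm] with p hp
    refine hC _ (abs_le.1 (abs_le_of_sq_le_sq ?_ hR))
    simp only [hS, Set.mem_ofPred_eq] at hp
    nlinarith [sq_nonneg (p.2 0), sq_nonneg (p.2 1)]
  rw [← integral_indicator hSm]
  rw [← integrable_indicator_iff hSm] at hint
  rw [Measure.volume_eq_prod] at hint ⊢
  rw [integral_prod _ hint, intervalIntegral.integral_of_le (by linarith),
    ← integral_Icc_eq_integral_Ioc, ← integral_indicator measurableSet_Icc]
  congr 1
  ext t
  by_cases ht : t ∈ Set.Icc (-R) R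
  · rw [Set.indicator_of_mem ht]
    have ht2 : 0 ≤ R ^ 2 - t ^ 2 := by nlinarith [ht.1, ht.2]
    rw [← measureReal_disc ht2]
    have : (fun v : Fin 2 → ℝ => S.indicator (fun p : ℝ × (Fin 2 → ℝ) => f p.1) (t, v)) =
        Set.indicator {v : Fin 2 → ℝ | v 0 ^ 2 + v 1 ^ 2 ≤ R ^ 2 - t ^ 2} (fun _ => f t) := by
      ext v
      have : (t, v) ∈ S ↔ v ∈ {v : Fin 2 → ℝ | v 0 ^ 2 + v 1 ^ 2 ≤ R ^ 2 - t ^ 2} := by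
        simp only [hS, Set.mem_ofPred_eq, le_sub_iff_add_le']
      by_cases h : (t, v) ∈ S
      · rw [Set.indicator_of_mem h, Set.indicator_of_mem (this.1 h)]
      · rw [Set.indicator_of_notMem h, Set.indicator_of_notMem (fun h' => h (this.2 h'))]
    rw [this, integral_indicator_const _ (measurableSet_le (by fun_prop) measurable_const)]
    simp [mul_comm]
  · rw [Set.indicator_of_notMem ht]
    have : ∀ v : Fin 2 → ℝ, (t, v) ∉ S := by
      intro v hv
      apply ht
      refine abs_le.1 (abs_le_of_sq_le_sq ?_ hR)
      simp only [hS, Set.mem_ofPred_eq] at hv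
      nlinarith [sq_nonneg (v 0), sq_nonneg (v 1)]
    simp [Set.indicator_of_notMem (this _)]

/-- Archimedes: the projection of the surface measure of `S²` to an axis is uniform. -/
theorem integral_sph_three_coord {f : ℝ → ℂ} (hf : Continuous f) :
    ∫ ω : Sph 3, f ((ω : RVec 3) 0) ∂(sphMeas 3) = 2 * Real.pi * ∫ t in (-1)..1, f t := by
  -- The integral over the ball of radius `R` is computed by polar coordinates, through `A`, and by
  -- slices, as `F`. Differentiating both at `R = 1` isolates the unit sphere.
  set A : ℝ → ℂ := fun r => ∫ ω : Sph 3, f (r * (ω : RVec 3) 0) ∂(sphMeas 3) with hA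
  have hAc : Continuous A := by
    have := continuous_parametric_integral_of_continuous (μ := sphMeas 3)
      (f := fun (r : ℝ) (ω : Sph 3) => f (r * (ω : RVec 3) 0)) (by fun_prop) isCompact_univ
    simpa using this
  have h1 : ∀ R : ℝ, 0 ≤ R → ∫ ξ in Metric.closedBall (0 : RVec 3) R, f (ξ 0) =
      ∫ r in 0..R, ((r ^ 2 : ℝ) : ℂ) * A r := by
    intro R hR
    have hc : Continuous fun ξ : RVec 3 => f (ξ 0) := by fun_prop
    have hi : IntegrableOn (fun ξ : RVec 3 => f (ξ 0)) (Metric.closedBall 0 R) :=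
      hc.continuousOn.integrableOn_compact (isCompact_closedBall _ _)
    rw [← setIntegral_congr_set (shell_zero_ae 3 R),
      setIntegral_shell le_rfl hc.aestronglyMeasurable, integral_prod_symm, intervalIntegral.integral_of_le hR]
    · refine integral_congr_ae (Eventually.of_forall fun r => ?_)
      simp only [hA]
      rw [← integral_const_mul]
      simp
    · exact (integrableOn_shell le_rfl hc.aestronglyMeasurable).1
        (hi.mono_set (shell_subset_closedBall 3 0 R))
  set F : ℝ → ℂ := fun R => (Real.pi : ℂ) * (((R : ℂ)) ^ 2 * (∫ t in (-R)..R, f t) -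
    ∫ t in (-R)..R, (t : ℂ) ^ 2 * f t) with hF
  have h2 : ∀ R : ℝ, 0 ≤ R → ∫ r in 0..R, ((r ^ 2 : ℝ) : ℂ) * A r = F R := by
    intro R hR
    rw [← h1 R hR, setIntegral_closedBall_coord hf hR]
    simp only [hF]
    rw [← intervalIntegral.integral_const_mul, ← intervalIntegral.integral_sub, ← intervalIntegral.integral_const_mul]
    · congr 1; ext t; push_cast; ring
    · exact Continuous.intervalIntegrable (by fun_prop) _ _
    · exact Continuous.intervalIntegrable (by fun_prop) _ _
  have hd : ∀ g : ℝ → ℂ, Continuous g → HasDerivAt (fun R : ℝ => ∫ t in (-R)..R, g t) (g 1 + g (-1)) 1 := by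
    intro g hg
    have e1 : HasDerivAt (fun R : ℝ => ∫ t in (0:ℝ)..R, g t) (g 1) 1 := hg.integral_hasStrictDerivAt 0 1 |>.hasDerivAt
    have e2 : HasDerivAt (fun R : ℝ => ∫ t in (0:ℝ)..R, g t) (g (-1)) (-1) :=
      hg.integral_hasStrictDerivAt 0 (-1) |>.hasDerivAt
    have e3 := HasDerivAt.scomp (1:ℝ) e2 (hasDerivAt_neg (1:ℝ))
    have e4 := e1.sub e3
    simp only [neg_smul, one_smul, sub_neg_eq_add] at e4
    refine e4.congr_of_eventuallyEq (Eventually.of_forall fun R => ?_)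
    simp only [Pi.sub_apply, Function.comp_apply]
    rw [intervalIntegral.integral_interval_sub_left (hg.intervalIntegrable _ _) (hg.intervalIntegrable _ _)]
  -- The endpoint terms `f(1) + f(-1)` of the two integrals cancel, because `R² - t²` vanishes at `t
  -- = ±R`.
  have h3 : HasDerivAt F (2 * Real.pi * ∫ t in (-1)..1, f t) 1 := by
    have e0 : HasDerivAt (fun R : ℝ => ((R : ℂ)) ^ 2) 2 1 := by
      have := (hasDerivAt_id (1:ℝ)).ofReal_comp.fun_pow 2
      simpa using this
    have e1 := ((e0.mul (hd f hf)).sub (hd (fun t => (t:ℂ)^2 * f t) (by fun_prop))).const_mul (Real.pi : ℂ)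
    exact e1.congr_deriv (by push_cast; ring)
  have h4 : HasDerivAt (fun R : ℝ => ∫ r in (0:ℝ)..R, ((r ^ 2 : ℝ) : ℂ) * A r) (((1 ^ 2 : ℝ) : ℂ) * A 1) 1 :=
    (Continuous.integral_hasStrictDerivAt (by fun_prop) 0 1).hasDerivAt
  have h5 := h4.congr_of_eventuallyEq (f₁ := F) (by
    filter_upwards [eventually_ge_nhds (show (0:ℝ) < 1 by norm_num)] with R hR
    exact (h2 R hR).symm)
  have h6 := h5.unique h3
  simpa [hA] using h6

theorem integral_sph_three {f : ℝ → ℂ} (hf : Continuous f) {u : RVec 3} (hu : ‖u‖ = 1) :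
    ∫ ω : Sph 3, f (inner ℝ u (ω : RVec 3)) ∂(sphMeas 3) = 2 * Real.pi * ∫ t in (-1)..1, f t := by
  rw [← integral_sph_three_coord hf]
  obtain ⟨L, hL⟩ := exists_isometry (u := EuclideanSpace.single (0 : Fin 3) (1:ℝ)) (v := u) (by simp [hu])
  have hm : Measurable fun ξ : RVec 3 => f (ξ 0) := by fun_prop
  rw [← integral_sph_comp_isometry hm L.symm]
  congr 1
  ext ω
  rw [← hL, inner_isometry]
  simp [EuclideanSpace.inner_single_left]

/-- `∫_{S²} e^{i r ω·x} dω = 4π sin(r|x|) / (r|x|)`. -/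
theorem integral_sph_three_exp {r : ℝ} (hr : 0 < r) {x : RVec 3} (hx : x ≠ 0) :
    ∫ ω : Sph 3, planeWave (r • (ω : RVec 3)) x ∂(sphMeas 3) =
      4 * Real.pi * ((r * ‖x‖ : ℝ) : ℂ)⁻¹ * ((Real.sin (r * ‖x‖) : ℝ) : ℂ) := by
  have hb0 : 0 < ‖x‖ := norm_pos_iff.2 hx
  have hu : ‖‖x‖⁻¹ • x‖ = 1 := by
    rw [norm_smul, norm_inv, norm_norm, inv_mul_cancel₀ hb0.ne']
  have hc : ((r * ‖x‖ : ℝ) : ℂ) ≠ 0 := Complex.ofReal_ne_zero.2 (by positivity)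
  have h := integral_sph_three (f := fun t : ℝ => Complex.exp (Complex.I * ((r * ‖x‖ : ℝ) : ℂ) * t))
    (by fun_prop) hu
  rw [integral_exp_mul_complex (mul_ne_zero Complex.I_ne_zero hc)] at h
  have e : (fun ω : Sph 3 => planeWave (r • (ω : RVec 3)) x) = fun ω : Sph 3 =>
      Complex.exp (Complex.I * ((r * ‖x‖ : ℝ) : ℂ) * ((inner ℝ (‖x‖⁻¹ • x) (ω : RVec 3) : ℝ) : ℂ)) := by
    ext ω
    rw [planeWave, real_inner_smul_left, real_inner_smul_left, real_inner_comm, mul_assoc, ← Complex.ofReal_mul]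
    congr 3
    field_simp
  rw [e, h, Complex.ofReal_sin, Complex.sin]
  push_cast at hc ⊢
  have h1 := left_ne_zero_of_mul hc
  have h2 := right_ne_zero_of_mul hc
  field_simp
  rw [Complex.I_sq]
  ring_nf

/-! ### The contribution of large momenta to the Green function -/

/-- The local singularity `1 + |x|^{-(d - 3/2)}`, which dominates the Green function near `0`. -/
noncomputable def sing (d : ℕ) (x : RVec d) : ℝ := 1 + ‖x‖ ^ (-((d : ℝ) - 3 / 2))

theorem one_le_sing (d : ℕ) (x : RVec d) : 1 ≤ sing d x := by
  unfold sing
  have : 0 ≤ ‖x‖ ^ (-((d : ℝ) - 3 / 2)) := by positivity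
  linarith

theorem rpow_neg_le_sing {d : ℕ} {x : RVec d} (hx : x ≠ 0) {a : ℝ} (ha : 0 ≤ a) (had : a ≤ d - 3 / 2) :
    ‖x‖ ^ (-a) ≤ sing d x := by
  have h0 : 0 < ‖x‖ := norm_pos_iff.2 hx
  unfold sing
  rcases le_total 1 ‖x‖ with h | h
  · have h1 : ‖x‖ ^ (-a) ≤ 1 := Real.rpow_le_one_of_one_le_of_nonpos h (by linarith)
    have : 0 ≤ ‖x‖ ^ (-((d : ℝ) - 3 / 2)) := by positivity
    linarith
  · have := Real.rpow_le_rpow_of_exponent_ge h0 h (by linarith : -((d : ℝ) - 3 / 2) ≤ -a)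
    linarith

/-- `|ξ|⁻²`. -/
noncomputable def invSq {d : ℕ} (ξ : RVec d) : ℂ := (((‖ξ‖ ^ 2)⁻¹ : ℝ) : ℂ)

/-- `⟨v, ξ⟩ |ξ|⁻⁴`. -/
noncomputable def innerInv {d : ℕ} (v ξ : RVec d) : ℂ := ((inner ℝ v ξ * (‖ξ‖ ^ 4)⁻¹ : ℝ) : ℂ)

theorem measurable_invSq {d : ℕ} : Measurable (invSq : RVec d → ℂ) := by
  unfold invSq; fun_prop

theorem measurable_innerInv {d : ℕ} (v : RVec d) : Measurable (innerInv v) := by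
  unfold innerInv; fun_prop

theorem norm_innerInv_le {d : ℕ} (v ξ : RVec d) : ‖innerInv v ξ‖ ≤ ‖v‖ * (‖ξ‖ ^ 3)⁻¹ := by
  rw [innerInv, Complex.norm_real, norm_mul, Real.norm_of_nonneg (by positivity : 0 ≤ (‖ξ‖ ^ 4)⁻¹)]
  rcases eq_or_ne ξ 0 with rfl | h
  · simp
  have h0 : 0 < ‖ξ‖ := norm_pos_iff.2 h
  calc _ ≤ ‖v‖ * ‖ξ‖ * (‖ξ‖ ^ 4)⁻¹ := by gcongr; exact norm_inner_le_norm _ _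
    _ = _ := by field_simp

theorem integrableOn_innerInv_two (v : RVec 2) {p : ℝ} (hp : 1 ≤ p) :
    IntegrableOn (innerInv v) {ξ | p < ‖ξ‖} := by
  refine (((integrableOn_norm_pow_inv (d := 2) (m := 3) (by norm_num)).mono_set
    (fun ξ hξ => hp.trans_lt hξ)).const_mul ‖v‖).mono' (measurable_innerInv v).aestronglyMeasurable
    (Eventually.of_forall fun ξ => norm_innerInv_le v ξ)

/-- For `d = 3` the Jacobian cancels `|ξ|⁻²` completely, so a single ray offers no decay. Averaging
the plane wave over directions first supplies the missing `1/r` through `sin(r|x|)/(r|x|)`. -/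
theorem shellInt_invSq_three {p R : ℝ} (hp : 0 < p) (hR : p ≤ R) {x : RVec 3} (hx : x ≠ 0) :
    shellInt invSq p R x = 4 * Real.pi * ((‖x‖⁻¹ : ℝ) : ℂ) * (((oscInt p R ‖x‖).im : ℝ) : ℂ) := by
  have h0 : 0 < ‖x‖ := norm_pos_iff.2 hx
  have hm : Measurable fun ξ : RVec 3 => planeWave ξ x * invSq ξ := (measurable_planeWave x).mul measurable_invSq
  have hi : IntegrableOn (fun ξ : RVec 3 => planeWave ξ x * invSq ξ) (shell 3 p R) := by
    refine integrableOn_planeWave_mul ?_ x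
    refine Measure.integrableOn_of_bounded (M := (p ^ 2)⁻¹) (volume_shell_lt_top 3 p R).ne
      measurable_invSq.aestronglyMeasurable ?_
    filter_upwards [ae_restrict_mem (measurableSet_shell 3 p R)] with ξ hξ
    rw [invSq, Complex.norm_real, Real.norm_of_nonneg (by positivity)]
    have := hξ.1
    gcongr
  have him : (oscInt p R ‖x‖).im = ∫ r in p..R, Real.sin (r * ‖x‖) * r⁻¹ := by
    rw [oscInt, intervalIntegral.integral_of_le hR, intervalIntegral.integral_of_le hR,
      ← Complex.imCLM_apply, ← ContinuousLinearMap.integral_comp_comm]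
    · refine integral_congr_ae (Eventually.of_forall fun r => ?_)
      simp only [Complex.imCLM_apply]
      rw [Complex.im_mul_ofReal, mul_comm Complex.I, Complex.exp_ofReal_mul_I_im]
    · exact (intervalIntegrable_iff_integrableOn_Ioc_of_le hR).1
        ((Continuous.continuousOn (by fun_prop)).mul (continuousOn_inv_ofReal hp hR)).intervalIntegrable
  rw [shellInt, setIntegral_shell hp.le hm.aestronglyMeasurable, integral_prod_symm _
    ((integrableOn_shell hp.le hm.aestronglyMeasurable).1 hi), him, ← intervalIntegral.integral_ofReal,
    ← intervalIntegral.integral_const_mul, intervalIntegral.integral_of_le hR]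
  refine setIntegral_congr_fun measurableSet_Ioc fun r hr => ?_
  have hr0 : 0 < r := hp.trans hr.1
  have hrc : (r : ℂ) ≠ 0 := Complex.ofReal_ne_zero.2 hr0.ne'
  have hxc : (‖x‖ : ℂ) ≠ 0 := Complex.ofReal_ne_zero.2 h0.ne'
  have e : ∀ ω : Sph 3, ((r ^ (3 - 1) : ℝ) : ℂ) * (planeWave (r • (ω : RVec 3)) x * invSq (r • (ω : RVec 3)))
      = planeWave (r • (ω : RVec 3)) x := by
    intro ω
    rw [invSq, norm_smul_sph hr0.le]
    push_cast
    field_simp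
  simp only [e]
  rw [integral_sph_three_exp hr0 hx]
  push_cast
  field_simp

/-- For `d = 2` the function has the borderline degree `-d`; for `d = 3` it decays more slowly and
the explicit spherical mean is used. -/
theorem outer_invSq {d : ℕ} (hd : d = 2 ∨ d = 3) {p : ℝ} (hp : 1 ≤ p) :
    (∃ C, 0 ≤ C ∧ ∀ R, p ≤ R → ∀ x : RVec d, x ≠ 0 → ‖shellInt invSq p R x‖ ≤ C * sing d x) ∧
    ∀ x : RVec d, x ≠ 0 → ∃ l, Tendsto (fun R => shellInt invSq p R x) atTop (𝓝 l) := by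
  have hp0 : 0 < p := by linarith
  rcases hd with rfl | rfl
  · have hB : ∀ ω : RVec 2, ‖ω‖ = 1 → ‖invSq ω‖ ≤ 1 := by intro ω h; simp [invSq, h]
    have hh : ∀ r : ℝ, 0 < r → ∀ ξ : RVec 2, invSq (r • ξ) = (((r ^ 2)⁻¹ : ℝ) : ℂ) * invSq ξ := by
      intro r hr ξ
      rw [invSq, invSq, norm_smul, Real.norm_of_nonneg hr.le, mul_pow, mul_inv]; push_cast; rfl
    have hK : 0 ≤ sphConst 2 := integral_nonneg fun ω => by positivity
    refine ⟨⟨2 * (sphMeas 2).real Set.univ + 2 * sphConst 2, by positivity, fun R hR x hx => ?_⟩, fun x hx =>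
      tendsto_shellInt_hom measurable_invSq hB hh hp hx⟩
    refine (norm_shellInt_hom_le measurable_invSq hB hh hp hR hx).trans ?_
    have h1 := rpow_neg_le_sing hx (a := 1/2) (by norm_num) (by norm_num)
    have h2 := one_le_sing 2 x
    have h3 : 0 ≤ (sphMeas 2).real Set.univ := measureReal_nonneg
    rw [one_mul, add_mul]
    have h4 : 2 * (sphMeas 2).real Set.univ ≤ 2 * (sphMeas 2).real Set.univ * sing 2 x :=
      le_mul_of_one_le_right (by positivity) h2
    gcongr
  · refine ⟨⟨16 * Real.pi, by positivity, fun R hR x hx => ?_⟩, fun x hx => ?_⟩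
    · have h0 : 0 < ‖x‖ := norm_pos_iff.2 hx
      rw [shellInt_invSq_three hp0 hR hx, norm_mul, norm_mul, norm_mul, Complex.norm_real, Complex.norm_real,
        Complex.norm_real, Real.norm_of_nonneg (inv_nonneg.2 h0.le), Real.norm_of_nonneg Real.pi_pos.le,
        Complex.norm_ofNat]
      -- Multiplied by the prefactor `1/|x|`, this bound yields the exponent `3/2` that determines
      -- `sing 3`.
      have h1 : ‖(oscInt p R ‖x‖).im‖ ≤ 2 + 2 * ‖x‖ ^ (-(1/2) : ℝ) := by
        refine (Complex.abs_im_le_norm _).trans ((norm_oscInt_le hp hR h0.ne').trans ?_)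
        rw [abs_of_pos h0]
      have h2 := rpow_neg_le_sing hx (a := 1) (by norm_num) (by norm_num)
      have h3 := rpow_neg_le_sing hx (a := 3/2) (by norm_num) (by norm_num)
      have h4 : ‖x‖ ^ (-(3/2) : ℝ) = ‖x‖⁻¹ * ‖x‖ ^ (-(1/2) : ℝ) := by
        rw [← Real.rpow_neg_one, ← Real.rpow_add h0]; norm_num
      rw [Real.rpow_neg_one] at h2
      calc _ ≤ 4 * Real.pi * ‖x‖⁻¹ * (2 + 2 * ‖x‖ ^ (-(1/2) : ℝ)) := by gcongr
        _ = 8 * Real.pi * (‖x‖⁻¹ + ‖x‖ ^ (-(3/2) : ℝ)) := by rw [h4]; ring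
        _ ≤ 8 * Real.pi * (sing 3 x + sing 3 x) := by gcongr
        _ = _ := by ring
    · obtain ⟨l, hl⟩ := tendsto_oscInt hp0 (norm_ne_zero_iff.2 hx)
      have h := (((Complex.continuous_ofReal.comp Complex.continuous_im).tendsto l).comp hl).const_mul
        (4 * Real.pi * ((‖x‖⁻¹ : ℝ) : ℂ))
      refine ⟨_, h.congr' ?_⟩
      filter_upwards [eventually_ge_atTop p] with R hR
      rw [shellInt_invSq_three hp0 hR hx]; rfl

/-- This term has degree `-3`: absolutely integrable at infinity for `d = 2`, borderline for `d =
3`. The bound is linear in `v`, which later gives uniformity in `k`. -/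
theorem outer_innerInv {d : ℕ} (hd : d = 2 ∨ d = 3) {p : ℝ} (hp : 1 ≤ p) :
    (∃ C, 0 ≤ C ∧ ∀ v : RVec d, ∀ R, p ≤ R → ∀ x : RVec d, x ≠ 0 →
      ‖shellInt (innerInv v) p R x‖ ≤ C * ‖v‖ * sing d x) ∧
    ∀ v x : RVec d, x ≠ 0 → ∃ l, Tendsto (fun R => shellInt (innerInv v) p R x) atTop (𝓝 l) := by
  rcases hd with rfl | rfl
  · refine ⟨⟨∫ ξ in {ξ : RVec 2 | p < ‖ξ‖}, (‖ξ‖ ^ 3)⁻¹, integral_nonneg fun ξ => by positivity,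
      fun v R hR x hx => ?_⟩, fun v x hx => ⟨_, tendsto_shellInt (integrableOn_innerInv_two v hp) x⟩⟩
    refine (norm_shellInt_le (integrableOn_innerInv_two v hp) R x).trans ?_
    have h1 : ∫ ξ in {ξ : RVec 2 | p < ‖ξ‖}, ‖innerInv v ξ‖ ≤
        ∫ ξ in {ξ : RVec 2 | p < ‖ξ‖}, ‖v‖ * (‖ξ‖ ^ 3)⁻¹ := by
      refine setIntegral_mono (integrableOn_innerInv_two v hp).norm ?_ (fun ξ => norm_innerInv_le v ξ)
      exact ((integrableOn_norm_pow_inv (d := 2) (m := 3) (by norm_num)).mono_set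
        (fun ξ hξ => hp.trans_lt hξ)).const_mul ‖v‖
    rw [integral_const_mul] at h1
    have h2 := one_le_sing 2 x
    have h3 : 0 ≤ ∫ ξ in {ξ : RVec 2 | p < ‖ξ‖}, (‖ξ‖ ^ 3)⁻¹ := integral_nonneg fun ξ => by positivity
    refine h1.trans ?_
    rw [mul_comm ‖v‖]
    exact le_mul_of_one_le_right (by positivity) h2
  · have hB : ∀ v ω : RVec 3, ‖ω‖ = 1 → ‖innerInv v ω‖ ≤ ‖v‖ := by
      intro v ω h
      have := norm_innerInv_le v ω
      simpa [h] using this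
    have hh : ∀ v : RVec 3, ∀ r : ℝ, 0 < r → ∀ ξ : RVec 3,
        innerInv v (r • ξ) = (((r ^ 3)⁻¹ : ℝ) : ℂ) * innerInv v ξ := by
      intro v r hr ξ
      rw [innerInv, innerInv, norm_smul, Real.norm_of_nonneg hr.le, mul_pow, mul_inv, real_inner_smul_right,
        ← Complex.ofReal_mul]
      congr 1
      field_simp
    have hK : 0 ≤ sphConst 3 := integral_nonneg fun ω => by positivity
    refine ⟨⟨2 * (sphMeas 3).real Set.univ + 2 * sphConst 3, by positivity, fun v R hR x hx => ?_⟩, fun v x hx =>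
      tendsto_shellInt_hom (measurable_innerInv v) (hB v) (hh v) hp hx⟩
    refine (norm_shellInt_hom_le (measurable_innerInv v) (hB v) (hh v) hp hR hx).trans ?_
    have h1 := rpow_neg_le_sing hx (a := 1/2) (by norm_num) (by norm_num)
    have h2 := one_le_sing 3 x
    have h3 : 0 ≤ (sphMeas 3).real Set.univ := measureReal_nonneg
    have h4 : 2 * (sphMeas 3).real Set.univ ≤ 2 * (sphMeas 3).real Set.univ * sing 3 x :=
      le_mul_of_one_le_right (by positivity) h2
    rw [mul_comm _ ‖v‖, mul_assoc ‖v‖, add_mul]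
    gcongr

/-! ### Expansion of the inverse symbol at large momenta. -/

/-- The remainder `(2kξ)² / (|ξ|⁴ (ξ² + 2kξ))` in the expansion of the inverse symbol. -/
noncomputable def symbRem {d : ℕ} (k : CVec d) (ξ : RVec d) : ℂ :=
  (2 * cdot k ξ) ^ 2 * (((‖ξ‖ ^ 4)⁻¹ : ℝ) : ℂ) * (symb k ξ)⁻¹

/-- Two steps of the geometric series for `1/(|ξ|² + 2kξ)`, with the exact remainder; the linear
term is split along `Re k` and `Im k`. -/
theorem inv_symb_expansion {d : ℕ} {k : CVec d} {ξ : RVec d} (hξ : ξ ≠ 0) (hs : symb k ξ ≠ 0) :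
    (symb k ξ)⁻¹ = invSq ξ - 2 * innerInv (reVec k) ξ - 2 * Complex.I * innerInv (imVec k) ξ + symbRem k ξ := by
  have h0 : (‖ξ‖ : ℂ) ≠ 0 := Complex.ofReal_ne_zero.2 (norm_ne_zero_iff.2 hξ)
  have hcd : 2 * cdot k ξ = symb k ξ - (‖ξ‖ : ℂ) ^ 2 := by rw [symb]; push_cast; ring
  have h1 : invSq ξ - 2 * innerInv (reVec k) ξ - 2 * Complex.I * innerInv (imVec k) ξ + symbRem k ξ =
      ((‖ξ‖ : ℂ) ^ 2)⁻¹ - (2 * cdot k ξ) * ((‖ξ‖ : ℂ) ^ 4)⁻¹ +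
      (2 * cdot k ξ) ^ 2 * ((‖ξ‖ : ℂ) ^ 4)⁻¹ * (symb k ξ)⁻¹ := by
    rw [invSq, innerInv, innerInv, symbRem, cdot_eq]; push_cast; ring
  rw [h1, hcd]
  field_simp
  ring

theorem norm_symbRem_le {d : ℕ} {k : CVec d} {ξ : RVec d} (hξ : ξ ≠ 0)
    (h : 4 * (‖reVec k‖ + ‖imVec k‖) ≤ ‖ξ‖) :
    ‖symbRem k ξ‖ ≤ 8 * (‖reVec k‖ + ‖imVec k‖) ^ 2 * (‖ξ‖ ^ 4)⁻¹ := by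
  have h0 : 0 < ‖ξ‖ := norm_pos_iff.2 hξ
  have h1 := symb_lower h
  have h2 := norm_inner_add_le k ξ
  rw [symbRem, norm_mul, norm_mul, norm_pow, norm_mul, Complex.norm_ofNat, Complex.norm_real,
    Real.norm_of_nonneg (by positivity), norm_inv]
  calc _ ≤ (2 * ((‖reVec k‖ + ‖imVec k‖) * ‖ξ‖)) ^ 2 * (‖ξ‖ ^ 4)⁻¹ * (‖ξ‖ ^ 2 / 2)⁻¹ := by gcongr
    _ = _ := by field_simp; ring

theorem measurable_symbRem {d : ℕ} (k : CVec d) : Measurable (symbRem k) := by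
  have h1 := (continuous_cdot k).measurable
  have h2 := (continuous_symb k).measurable
  unfold symbRem; fun_prop

/-- The remainder is `O(|ξ|⁻⁴)`, which is integrable at infinity exactly because `d < 4`. -/
theorem integrableOn_symbRem {d : ℕ} (hd : d < 4) {k : CVec d} {p : ℝ} (hp : 1 ≤ p)
    (h : 4 * (‖reVec k‖ + ‖imVec k‖) ≤ p) : IntegrableOn (symbRem k) {ξ | p < ‖ξ‖} := by
  refine (((integrableOn_norm_pow_inv hd).mono_set (s := {ξ : RVec d | p < ‖ξ‖})
    (fun ξ hξ => hp.trans_lt hξ)).const_mul (8 * (‖reVec k‖ + ‖imVec k‖) ^ 2)).mono'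
    (measurable_symbRem k).aestronglyMeasurable ?_
  filter_upwards [ae_restrict_mem (measurableSet_lt measurable_const measurable_norm)] with ξ hξ
  have hξ' : p < ‖ξ‖ := hξ
  exact norm_symbRem_le (norm_pos_iff.1 (by linarith)) (by linarith)

theorem integrableOn_shell_of_bdd {d : ℕ} {f : RVec d → ℂ} (hf : Measurable f) {p R M : ℝ}
    (h : ∀ ξ, p < ‖ξ‖ → ‖f ξ‖ ≤ M) : IntegrableOn f (shell d p R) := by
  refine Measure.integrableOn_of_bounded (M := M) (volume_shell_lt_top d p R).ne hf.aestronglyMeasurable ?_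
  filter_upwards [ae_restrict_mem (measurableSet_shell d p R)] with ξ hξ
  exact h ξ hξ.1

theorem shellInt_inv_symb {d : ℕ} (hd : d < 4) {k : CVec d} {p : ℝ} (hp : 1 ≤ p)
    (h : 4 * (‖reVec k‖ + ‖imVec k‖) ≤ p) (R : ℝ) (x : RVec d) :
    shellInt (fun ξ => (symb k ξ)⁻¹) p R x = shellInt invSq p R x - 2 * shellInt (innerInv (reVec k)) p R x -
      2 * Complex.I * shellInt (innerInv (imVec k)) p R x + shellInt (symbRem k) p R x := by
  have hp0 : 0 < p := by linarith
  have i0 : IntegrableOn (fun ξ => planeWave ξ x * invSq ξ) (shell d p R) := by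
    refine integrableOn_planeWave_mul (integrableOn_shell_of_bdd measurable_invSq (M := (p^2)⁻¹) fun ξ hξ => ?_) x
    rw [invSq, Complex.norm_real, Real.norm_of_nonneg (by positivity)]
    gcongr
  have i1 : ∀ v, IntegrableOn (fun ξ => planeWave ξ x * innerInv v ξ) (shell d p R) := by
    refine fun v => integrableOn_planeWave_mul
      (integrableOn_shell_of_bdd (measurable_innerInv v) (M := ‖v‖ * (p^3)⁻¹) fun ξ hξ => ?_) x
    refine (norm_innerInv_le v ξ).trans ?_
    gcongr
  have i2 : IntegrableOn (fun ξ => planeWave ξ x * symbRem k ξ) (shell d p R) :=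
    integrableOn_planeWave_mul ((integrableOn_symbRem hd hp h).mono_set fun ξ hξ => hξ.1) x
  have j1 := (i1 (reVec k)).const_mul 2
  have j2 := (i1 (imVec k)).const_mul (2 * Complex.I)
  have k1 : IntegrableOn (fun ξ => planeWave ξ x * invSq ξ - 2 * (planeWave ξ x * innerInv (reVec k) ξ))
    (shell d p R) := i0.sub j1
  have k2 : IntegrableOn (fun ξ => planeWave ξ x * invSq ξ - 2 * (planeWave ξ x * innerInv (reVec k) ξ) -
    2 * Complex.I * (planeWave ξ x * innerInv (imVec k) ξ)) (shell d p R) := k1.sub j2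
  simp only [shellInt]
  rw [← integral_const_mul, ← integral_const_mul, ← integral_sub i0 j1,
    ← integral_sub k1 j2, ← integral_add k2 i2]
  refine setIntegral_congr_fun (measurableSet_shell d p R) fun ξ hξ => ?_
  have h0 : 0 < ‖ξ‖ := hp0.trans hξ.1
  have hs : symb k ξ ≠ 0 := by
    have := symb_lower (k := k) (ξ := ξ) (h.trans hξ.1.le)
    exact norm_pos_iff.1 (lt_of_lt_of_le (by positivity) this)
  rw [inv_symb_expansion (norm_pos_iff.1 h0) hs]
  ring

theorem norm_expansion_le (A B C D : ℂ) :
    ‖A - 2 * B - 2 * Complex.I * C + D‖ ≤ ‖A‖ + 2 * ‖B‖ + 2 * ‖C‖ + ‖D‖ := by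
  have h1 := norm_add_le (A - 2 * B - 2 * Complex.I * C) D
  have h2 := norm_sub_le (A - 2 * B) (2 * Complex.I * C)
  have h3 := norm_sub_le A (2 * B)
  rw [norm_mul, norm_mul, Complex.norm_I, Complex.norm_ofNat, mul_one] at h2
  rw [norm_mul, Complex.norm_ofNat] at h3
  linarith

/-- The radius `p` is fixed first and the constant serves every `k` that is small relative to `p`.
This uniformity is what survives the limit `ε → 0` at `k + iεγ`. -/
theorem outer_bound {d : ℕ} (hd : d = 2 ∨ d = 3) {p : ℝ} (hp : 1 ≤ p) :
    ∃ C, 0 ≤ C ∧ ∀ k : CVec d, 4 * (‖reVec k‖ + ‖imVec k‖) ≤ p → ∀ R, p ≤ R → ∀ x : RVec d, x ≠ 0 →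
      ‖shellInt (fun ξ => (symb k ξ)⁻¹) p R x‖ ≤ C * sing d x := by
  obtain ⟨C0, hC0, h0⟩ := (outer_invSq hd hp).1
  obtain ⟨C1, hC1, h1⟩ := (outer_innerInv hd hp).1
  have hd4 : d < 4 := by omega
  obtain ⟨I, hI⟩ : ∃ I : ℝ, I = ∫ ξ in {ξ : RVec d | p < ‖ξ‖}, (‖ξ‖ ^ 4)⁻¹ := ⟨_, rfl⟩
  have hI0 : 0 ≤ I := hI ▸ integral_nonneg fun ξ => by positivity
  refine ⟨C0 + 4 * C1 * p + 8 * p ^ 2 * I, by positivity, fun k hk R hR x hx => ?_⟩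
  have ha := norm_nonneg (reVec k)
  have hb := norm_nonneg (imVec k)
  have hs := one_le_sing d x
  have b2 : ‖shellInt (symbRem k) p R x‖ ≤ 8 * p ^ 2 * I := by
    refine (norm_shellInt_le (integrableOn_symbRem hd4 hp hk) R x).trans ?_
    rw [hI, ← integral_const_mul]
    refine setIntegral_mono_on (integrableOn_symbRem hd4 hp hk).norm
      (((integrableOn_norm_pow_inv hd4).mono_set (fun ξ hξ => hp.trans_lt hξ)).const_mul _)
      (measurableSet_lt measurable_const measurable_norm) fun ξ hξ => ?_
    have hξ' : p < ‖ξ‖ := hξ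
    refine (norm_symbRem_le (norm_pos_iff.1 (by linarith)) (by linarith)).trans ?_
    gcongr
    linarith
  rw [shellInt_inv_symb hd4 hp hk]
  have e0 := h0 R hR x hx
  have e1 := h1 (reVec k) R hR x hx
  have e2 := h1 (imVec k) R hR x hx
  refine (norm_expansion_le _ _ _ _).trans ?_
  have e3 : C1 * ‖reVec k‖ * sing d x ≤ C1 * p * sing d x := by
    have : ‖reVec k‖ ≤ p := by linarith
    gcongr
  have e4 : C1 * ‖imVec k‖ * sing d x ≤ C1 * p * sing d x := by
    have : ‖imVec k‖ ≤ p := by linarith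
    gcongr
  have e5 : 8 * p ^ 2 * I ≤ 8 * p ^ 2 * I * sing d x := le_mul_of_one_le_right (by positivity) hs
  linarith

theorem outer_tendsto {d : ℕ} (hd : d = 2 ∨ d = 3) {p : ℝ} (hp : 1 ≤ p) {k : CVec d}
    (hk : 4 * (‖reVec k‖ + ‖imVec k‖) ≤ p) {x : RVec d} (hx : x ≠ 0) :
    ∃ l, Tendsto (fun R => shellInt (fun ξ => (symb k ξ)⁻¹) p R x) atTop (𝓝 l) := by
  have hd4 : d < 4 := by omega
  obtain ⟨l0, h0⟩ := (outer_invSq hd hp).2 x hx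
  obtain ⟨l1, h1⟩ := (outer_innerInv hd hp).2 (reVec k) x hx
  obtain ⟨l2, h2⟩ := (outer_innerInv hd hp).2 (imVec k) x hx
  have h3 := tendsto_shellInt (integrableOn_symbRem hd4 hp hk) x
  refine ⟨_, (((h0.sub (h1.const_mul 2)).sub (h2.const_mul (2 * Complex.I))).add h3).congr fun R => ?_⟩
  rw [shellInt_inv_symb hd4 hp hk]

/-! ### The momenta `k + iεγ` and the limit `ε → 0` of the outer part. -/

theorem reVec_shift {d : ℕ} (k γ : RVec d) (ε : ℝ) : reVec (shift k γ ε) = k := by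
  ext i; simp [reVec, shift]

theorem imVec_shift {d : ℕ} (k γ : RVec d) (ε : ℝ) : imVec (shift k γ ε) = ε • γ := by
  ext i; simp [imVec, shift]

theorem continuous_cdot_shift {d : ℕ} (k γ ξ : RVec d) : Continuous fun ε : ℝ => cdot (shift k γ ε) ξ := by
  simp_rw [cdot_eq, reVec_shift, imVec_shift, real_inner_smul_left]
  fun_prop

theorem continuous_symb_shift {d : ℕ} (k γ ξ : RVec d) : Continuous fun ε : ℝ => symb (shift k γ ε) ξ := by
  have := continuous_cdot_shift k γ ξ
  unfold symb; fun_prop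

theorem shift_norm_le {d : ℕ} {k γ : RVec d} {ε p : ℝ} (hγ : ‖γ‖ = 1) (h0 : 0 < ε) (h1 : ε ≤ 1)
    (hp : 4 * (‖k‖ + 1) ≤ p) : 4 * (‖reVec (shift k γ ε)‖ + ‖imVec (shift k γ ε)‖) ≤ p := by
  rw [reVec_shift, imVec_shift, norm_smul, hγ, Real.norm_of_nonneg h0.le]
  linarith

theorem Ioc_mem_nhdsGT_zero : Set.Ioc (0:ℝ) 1 ∈ 𝓝[>] (0:ℝ) := Ioc_mem_nhdsGT zero_lt_one

/-- In the expansion of the inverse symbol the explicit terms are affine in `ε`, so their limits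
along growing shells combine into an affine function of `ε`. The remainder has an integrable
majorant independent of `ε`. -/
theorem outer_boundary {d : ℕ} (hd : d = 2 ∨ d = 3) {p : ℝ} (hp : 1 ≤ p) {k γ : RVec d} (hγ : ‖γ‖ = 1)
    (hk : 4 * (‖k‖ + 1) ≤ p) {x : RVec d} (hx : x ≠ 0) :
    ∃ L : ℝ → ℂ, (∀ ε, 0 < ε → ε ≤ 1 →
      Tendsto (fun R => shellInt (fun ξ => (symb (shift k γ ε) ξ)⁻¹) p R x) atTop (𝓝 (L ε))) ∧
      ∃ l, Tendsto L (𝓝[>] 0) (𝓝 l) := by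
  have hd4 : d < 4 := by omega
  obtain ⟨l0, h0⟩ := (outer_invSq hd hp).2 x hx
  obtain ⟨l1, h1⟩ := (outer_innerInv hd hp).2 k x hx
  obtain ⟨l2, h2⟩ := (outer_innerInv hd hp).2 γ x hx
  refine ⟨fun ε => l0 - 2 * l1 - 2 * Complex.I * (ε * l2) +
    ∫ ξ in {ξ : RVec d | p < ‖ξ‖}, planeWave ξ x * symbRem (shift k γ ε) ξ, fun ε hε hε1 => ?_, ?_⟩
  · have hk' := shift_norm_le (k := k) hγ hε hε1 hk
    have h3 := tendsto_shellInt (integrableOn_symbRem hd4 hp hk') x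
    refine (((h0.sub (h1.const_mul 2)).sub ((h2.const_mul (ε : ℂ)).const_mul (2 * Complex.I))).add h3).congr
      fun R => ?_
    rw [shellInt_inv_symb hd4 hp hk', reVec_shift, imVec_shift]
    congr 3
    simp only [shellInt]
    rw [← integral_const_mul]
    congr 1
    ext ξ
    simp only [innerInv, real_inner_smul_left]
    push_cast; ring
  · have h3 : Tendsto (fun ε : ℝ => ∫ ξ in {ξ : RVec d | p < ‖ξ‖}, planeWave ξ x * symbRem (shift k γ ε) ξ)
        (𝓝[>] 0) (𝓝 (∫ ξ in {ξ : RVec d | p < ‖ξ‖}, planeWave ξ x * symbRem (shift k γ 0) ξ)) := by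
      refine tendsto_integral_filter_of_dominated_convergence
        (fun ξ => 8 * p ^ 2 * (‖ξ‖ ^ 4)⁻¹) ?_ ?_ ?_ ?_
      · exact Eventually.of_forall fun ε => ((measurable_planeWave x).mul (measurable_symbRem _)).aestronglyMeasurable
      · filter_upwards [Ioc_mem_nhdsGT_zero] with ε hε
        filter_upwards [ae_restrict_mem (measurableSet_lt measurable_const measurable_norm)] with ξ hξ
        have hξ' : p < ‖ξ‖ := hξ
        have hk' := shift_norm_le (k := k) hγ hε.1 hε.2 hk
        rw [norm_mul, norm_planeWave, one_mul]
        refine (norm_symbRem_le (norm_pos_iff.1 (by linarith)) (by linarith)).trans ?_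
        gcongr
        have := norm_nonneg (reVec (shift k γ ε)); have := norm_nonneg (imVec (shift k γ ε))
        linarith
      · exact ((integrableOn_norm_pow_inv hd4).mono_set (fun ξ hξ => hp.trans_lt hξ)).const_mul _
      · filter_upwards [ae_restrict_mem (measurableSet_lt measurable_const measurable_norm)] with ξ hξ
        have hξ' : p < ‖ξ‖ := hξ
        have hs : symb (shift k γ 0) ξ ≠ 0 := by
          have := symb_lower (k := shift k γ 0) (ξ := ξ) (by
            rw [reVec_shift, imVec_shift, zero_smul, norm_zero]; linarith)
          exact norm_pos_iff.1 (lt_of_lt_of_le (by have : 0 < ‖ξ‖ := by linarith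
                                                   positivity) this)
        have : Tendsto (fun ε : ℝ => planeWave ξ x * symbRem (shift k γ ε) ξ) (𝓝 0)
            (𝓝 (planeWave ξ x * symbRem (shift k γ 0) ξ)) := by
          refine Tendsto.const_mul _ ?_
          unfold symbRem
          refine Tendsto.mul (Tendsto.mul_const _ ?_) (Tendsto.inv₀ ((continuous_symb_shift k γ ξ).tendsto 0) hs)
          exact (((continuous_cdot_shift k γ ξ).tendsto 0).const_mul 2).pow 2
        exact this.mono_left nhdsWithin_le_nhds
    have h4 : Tendsto (fun ε : ℝ => l0 - 2 * l1 - 2 * Complex.I * (ε * l2)) (𝓝[>] 0)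
        (𝓝 (l0 - 2 * l1 - 2 * Complex.I * ((0:ℝ) * l2))) :=
      (Continuous.tendsto (by fun_prop) (0:ℝ)).mono_left nhdsWithin_le_nhds
    exact ⟨_, h4.add h3⟩

/-! ### The diagonal integral `∫_{|ξ| ≤ N} dξ / (ξ² + 2kξ)` -/

/-- `∫_{|ξ| ≤ N} dξ / (ξ² + 2kξ)`. -/
noncomputable def diagInt {d : ℕ} (k : CVec d) (N : ℝ) : ℂ :=
  ∫ ξ in Metric.closedBall (0 : RVec d) N, (symb k ξ)⁻¹

/-- The reflection in the hyperplane orthogonal to `Im k` preserves the ball, fixes `Re k` by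
orthogonality, and conjugates the symbol; hence the integral equals its conjugate. -/
theorem diagInt_im {d : ℕ} {k : CVec d} (h : inner ℝ (imVec k) (reVec k) = 0) (N : ℝ) :
    (diagInt k N).im = 0 := by
  set L := (ℝ ∙ imVec k)ᗮ.reflection with hL
  have hb : L (imVec k) = -imVec k := Submodule.reflection_orthogonalComplement_singleton_eq_neg _
  have ha : L (reVec k) = reVec k :=
    Submodule.reflection_mem_subspace_eq_self (Submodule.mem_orthogonal_singleton_iff_inner_right.2 h)
  have hs : ∀ ξ, symb k (L ξ) = (starRingEnd ℂ) (symb k ξ) := by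
    intro ξ
    have e1 : inner ℝ (reVec k) (L ξ) = inner ℝ (reVec k) ξ := by
      conv_lhs => rw [← ha]
      exact L.inner_map_map _ _
    have e2 : inner ℝ (imVec k) (L ξ) = -inner ℝ (imVec k) ξ := by
      have e3 : L (-imVec k) = imVec k := by rw [map_neg, hb, neg_neg]
      conv_lhs => rw [← e3]
      rw [L.inner_map_map, inner_neg_left]
    apply Complex.ext
    · rw [Complex.conj_re, symb_re, symb_re, e1, L.norm_map]
    · rw [Complex.conj_im, symb_im, symb_im, e2]; ring
  have h1 := (LinearIsometryEquiv.measurePreserving L).setIntegral_preimage_emb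
    L.toHomeomorph.measurableEmbedding (fun ξ => (symb k ξ)⁻¹) (Metric.closedBall 0 N)
  have h2 : L ⁻¹' Metric.closedBall 0 N = Metric.closedBall 0 N := by
    ext ξ; simp
  rw [h2] at h1
  simp_rw [hs, ← map_inv₀] at h1
  rw [integral_conj] at h1
  exact Complex.conj_eq_iff_im.1 h1

theorem symb_smul {d : ℕ} (k : CVec d) (r : ℝ) (ω : RVec d) (hω : ‖ω‖ = 1) :
    symb k (r • ω) = (r : ℂ) * ((r : ℂ) + 2 * cdot k ω) := by
  rw [symb, norm_smul, hω, cdot_eq, cdot_eq, real_inner_smul_right, real_inner_smul_right, mul_one,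
    Real.norm_eq_abs, sq_abs]
  push_cast; ring

theorem cdot_im {d : ℕ} (k : CVec d) (x : RVec d) : (cdot k x).im = inner ℝ (imVec k) x := by
  rw [cdot_eq]; simp

theorem hasDerivAt_log_add {w : ℂ} (hw : w.im ≠ 0) (r : ℝ) :
    HasDerivAt (fun r : ℝ => Complex.log ((r : ℂ) + w)) ((r : ℂ) + w)⁻¹ r := by
  have h1 : HasDerivAt (fun r : ℝ => (r : ℂ) + w) 1 r := by
    have := (hasDerivAt_id r).ofReal_comp.add_const w
    simpa using this
  have := h1.clog_real (by
    rw [Complex.mem_slitPlane_iff]; right; simpa using hw)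
  simpa using this

/-- On a ray the symbol is `r(r + 2kω)`, so one power of the Jacobian cancels and the remaining
radial integrand has an elementary primitive. Integrability over `ω` is recorded too, because it
yields integrability of `log(2kω)` for `d = 2`. -/
theorem diagInt_polar {d : ℕ} [NeZero d] (hd : 2 ≤ d) {k : CVec d}
    (h : inner ℝ (imVec k) (reVec k) = 0) (hb : imVec k ≠ 0) {N : ℝ} (hN : 0 ≤ N) :
    Integrable (fun ω : Sph d => ∫ r in 0..N, (r : ℂ) ^ (d - 2) * ((r : ℂ) + 2 * cdot k ω)⁻¹) (sphMeas d) ∧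
    diagInt k N = ∫ ω : Sph d, (∫ r in 0..N, (r : ℂ) ^ (d - 2) * ((r : ℂ) + 2 * cdot k ω)⁻¹) ∂(sphMeas d) := by
  have hi := (integrableOn_inv_symb hd h hb N).mono_set (shell_subset_closedBall d 0 N)
  have hm : AEStronglyMeasurable (fun ξ => (symb k ξ)⁻¹) volume :=
    (continuous_symb k).measurable.inv.aestronglyMeasurable
  have e : ∀ ω : Sph d, ∫ r in 0..N, ((r ^ (d - 1) : ℝ) : ℂ) * (symb k (r • (ω : RVec d)))⁻¹ =
      ∫ r in 0..N, (r : ℂ) ^ (d - 2) * ((r : ℂ) + 2 * cdot k ω)⁻¹ := by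
    intro ω
    refine intervalIntegral.integral_congr_ae (Eventually.of_forall fun r hr => ?_)
    rw [Set.uIoc_of_le hN] at hr
    have hr0 : (r : ℂ) ≠ 0 := Complex.ofReal_ne_zero.2 hr.1.ne'
    rw [symb_smul k r _ (by simp), mul_inv, show d - 1 = (d - 2) + 1 by omega]
    push_cast
    rw [pow_succ]
    field_simp
  constructor
  · have := ((integrableOn_shell le_rfl hm).1 hi).integral_prod_left
    simp_rw [← e, intervalIntegral.integral_of_le hN]
    exact this
  · rw [diagInt, ← setIntegral_congr_set (shell_zero_ae d N), setIntegral_shell_eq le_rfl hN hm hi]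
    simp_rw [e]

theorem norm_two_cdot_le {d : ℕ} (k : CVec d) (ω : Sph d) :
    ‖2 * cdot k ω‖ ≤ 2 * (‖reVec k‖ + ‖imVec k‖) := by
  have := norm_inner_add_le k ω
  have h1 : ‖(ω : RVec d)‖ = 1 := by simp
  rw [h1, mul_one] at this
  rw [norm_mul, Complex.norm_ofNat]
  linarith

theorem measurable_cdot_sph {d : ℕ} (k : CVec d) : Measurable (fun ω : Sph d => cdot k ω) :=
  (continuous_cdot k).measurable.comp measurable_subtype_coe

theorem norm_log_one_add_div_le {d : ℕ} {k : CVec d} {N : ℝ}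
    (hN : 4 * (‖reVec k‖ + ‖imVec k‖) + 1 ≤ N) (ω : Sph d) :
    ‖Complex.log (1 + 2 * cdot k ω / N)‖ ≤ 3 / 2 * (2 * (‖reVec k‖ + ‖imVec k‖) / N) := by
  have h0 : 0 < N := by
    have := norm_nonneg (reVec k); have := norm_nonneg (imVec k); linarith
  have h1 : ‖2 * cdot k ω / N‖ ≤ 2 * (‖reVec k‖ + ‖imVec k‖) / N := by
    rw [norm_div, Complex.norm_real, Real.norm_of_nonneg h0.le]
    have := norm_two_cdot_le k ω
    gcongr
  have h2 : ‖2 * cdot k ω / N‖ ≤ 1 / 2 := h1.trans (by rw [div_le_iff₀ h0]; linarith)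
  refine (Complex.norm_log_one_add_half_le_self h2).trans ?_
  gcongr

/-- These are the error terms of the cut-off: the logarithm is `O(1/N)` uniformly in the direction.
-/
theorem tendsto_log_one_add {d : ℕ} [NeZero d] (k : CVec d) (g : Sph d → ℂ) {M : ℝ}
    (hM : ∀ ω, ‖g ω‖ ≤ M) :
    Tendsto (fun N : ℝ => ∫ ω : Sph d, g ω * Complex.log (1 + 2 * cdot k ω / N) ∂(sphMeas d)) atTop (𝓝 0) := by
  set K := 2 * (‖reVec k‖ + ‖imVec k‖) with hK
  have h1 : Tendsto (fun N : ℝ => M * (3 / 2 * (K / N)) * (sphMeas d).real Set.univ) atTop (𝓝 0) := by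
    have : Tendsto (fun N : ℝ => K / N) atTop (𝓝 0) := tendsto_const_nhds.div_atTop tendsto_id
    simpa using ((this.const_mul (3/2)).const_mul M).mul_const ((sphMeas d).real Set.univ)
  refine squeeze_zero_norm' ?_ h1
  filter_upwards [eventually_ge_atTop (4 * (‖reVec k‖ + ‖imVec k‖) + 1)] with N hN
  refine norm_integral_le_of_norm_le_const (Eventually.of_forall fun ω => ?_)
  rw [norm_mul]
  have := norm_log_one_add_div_le hN ω
  have := hM ω
  have := (norm_nonneg _).trans this
  gcongr

theorem log_add_eq {N : ℝ} (hN : 0 < N) {w : ℂ} (hw : w.im ≠ 0) :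
    Complex.log (N + w) = Real.log N + Complex.log (1 + w / N) := by
  have hNc : (N : ℂ) ≠ 0 := Complex.ofReal_ne_zero.2 hN.ne'
  have h1 : (N : ℂ) + w = (N : ℂ) * (1 + w / N) := by field_simp
  rw [h1, Complex.log_ofReal_mul hN]
  intro h0
  rw [h0, mul_zero] at h1
  have := congrArg Complex.im h1
  simp at this
  exact hw this

/-! ### Three dimensions -/

/-- `w log w` stays bounded near `0`, so in three dimensions the angular integrand is bounded
although the logarithm is not. -/
theorem norm_mul_log_le {w : ℂ} {M : ℝ} (hM : ‖w‖ ≤ M) : ‖w * Complex.log w‖ ≤ 1 + M ^ 2 + M * Real.pi := by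
  have hM0 := (norm_nonneg w).trans hM
  have h1 : ‖Complex.log w‖ ≤ |Real.log ‖w‖| + Real.pi := by
    have := Complex.norm_le_abs_re_add_abs_im (Complex.log w)
    rw [Complex.log_re, Complex.log_im] at this
    exact this.trans (add_le_add le_rfl (Complex.abs_arg_le_pi w))
  have h2 : ‖w‖ * |Real.log ‖w‖| ≤ 1 + ‖w‖ ^ 2 := by
    rcases eq_or_ne w 0 with rfl | hw
    · simp
    have hw0 : 0 < ‖w‖ := norm_pos_iff.2 hw
    rcases le_total ‖w‖ 1 with h | h
    · have := Real.abs_log_mul_self_lt ‖w‖ hw0 h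
      rw [abs_mul, abs_of_pos hw0, mul_comm] at this
      nlinarith
    · rw [abs_of_nonneg (Real.log_nonneg h)]
      have := Real.log_le_sub_one_of_pos hw0
      nlinarith
  rw [norm_mul]
  calc _ ≤ ‖w‖ * (|Real.log ‖w‖| + Real.pi) := by gcongr
    _ = ‖w‖ * |Real.log ‖w‖| + ‖w‖ * Real.pi := by ring
    _ ≤ 1 + ‖w‖ ^ 2 + ‖w‖ * Real.pi := by gcongr
    _ ≤ _ := by gcongr

theorem log_sub_log_neg {w : ℂ} (hw : w.im ≠ 0) :
    Complex.log w - Complex.log (-w) = Complex.I * ((Real.pi * SignType.sign w.im : ℝ) : ℂ) := by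
  have : Complex.log w - Complex.log (-w) = Complex.I * ((w.arg - (-w).arg : ℝ) : ℂ) := by
    rw [Complex.log, Complex.log, norm_neg]; push_cast; ring
  rw [this]
  congr 2
  rcases lt_or_gt_of_ne hw with h | h
  · rw [Complex.arg_neg_eq_arg_add_pi_of_im_neg h, sign_neg h]; simp
  · rw [Complex.arg_neg_eq_arg_sub_pi_of_im_pos h, sign_pos h]; simp

theorem cdot_neg_right {d : ℕ} (k : CVec d) (x : RVec d) : cdot k (-x) = -cdot k x := by
  simp [cdot]

theorem integral_sph_neg {d : ℕ} [NeZero d] {f : RVec d → ℂ} (hf : Measurable f) :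
    ∫ ω : Sph d, f (-ω) ∂(sphMeas d) = ∫ ω : Sph d, f ω ∂(sphMeas d) :=
  integral_sph_comp_isometry hf (LinearIsometryEquiv.neg ℝ)

theorem integral_sph_cdot {d : ℕ} [NeZero d] (k : CVec d) :
    ∫ ω : Sph d, 2 * cdot k ω ∂(sphMeas d) = 0 := by
  have h := integral_sph_neg (f := fun ξ => 2 * cdot k ξ) ((continuous_cdot k).measurable.const_mul 2)
  simp only [cdot_neg_right, mul_neg, integral_neg] at h
  have : (2:ℂ) * ∫ ω : Sph d, 2 * cdot k ω ∂(sphMeas d) = 0 := by linear_combination -h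
  simpa using this

theorem measurable_cdot_mul_log {d : ℕ} (k : CVec d) :
    Measurable fun ξ : RVec d => 2 * cdot k ξ * Complex.log (2 * cdot k ξ) := by
  have := (continuous_cdot k).measurable
  fun_prop

theorem integrable_cdot_mul_log {d : ℕ} [NeZero d] (k : CVec d) :
    Integrable (fun ω : Sph d => 2 * cdot k ω * Complex.log (2 * cdot k ω)) (sphMeas d) :=
  Integrable.of_bound ((measurable_cdot_mul_log k).comp measurable_subtype_coe).aestronglyMeasurable _
    (Eventually.of_forall fun ω => norm_mul_log_le (norm_two_cdot_le k ω))

/-- With `w = 2kω`, averaging over `ω` and `-ω` replaces `log w` by half of `log w - log(-w) = iπ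
sign(Im w)`. The real part of `w` times this is `-π|Im w|/2`, and the sphere integral of `|Im w|` is
`4π|Im k|`. -/
theorem integral_cdot_mul_log_re {k : CVec 3} (hb : imVec k ≠ 0) :
    (∫ ω : Sph 3, 2 * cdot k ω * Complex.log (2 * cdot k ω) ∂(sphMeas 3)).re =
      -(2 * Real.pi ^ 2 * ‖imVec k‖) := by
  set T := ∫ ω : Sph 3, 2 * cdot k ω * Complex.log (2 * cdot k ω) ∂(sphMeas 3) with hT
  have h1 : T = ∫ ω : Sph 3, -(2 * cdot k ω) * Complex.log (-(2 * cdot k ω)) ∂(sphMeas 3) := by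
    rw [hT, ← integral_sph_neg (measurable_cdot_mul_log k)]
    simp only [cdot_neg_right, mul_neg]
  have hi := integrable_cdot_mul_log k
  have hi2 : Integrable (fun ω : Sph 3 => -(2 * cdot k ω) * Complex.log (-(2 * cdot k ω))) (sphMeas 3) := by
    refine Integrable.of_bound ?_ _ (Eventually.of_forall fun ω => norm_mul_log_le
      (M := 2 * (‖reVec k‖ + ‖imVec k‖)) (by rw [norm_neg]; exact norm_two_cdot_le k ω))
    have := measurable_cdot_sph k
    exact Measurable.aestronglyMeasurable (by fun_prop)
  have hae : (fun ω : Sph 3 => 2 * cdot k ω * Complex.log (2 * cdot k ω) +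
      -(2 * cdot k ω) * Complex.log (-(2 * cdot k ω))) =ᵐ[sphMeas 3] fun ω : Sph 3 => (2 * cdot k ω) *
      (Complex.I * ((Real.pi * SignType.sign (inner ℝ (imVec k) (ω : RVec 3)) : ℝ) : ℂ)) := by
    filter_upwards [sph_inner_ne_zero hb] with ω hω
    have him : (2 * cdot k (ω : RVec 3)).im = 2 * inner ℝ (imVec k) (ω : RVec 3) := by
      rw [← cdot_im]; simp
    have hne : (2 * cdot k (ω : RVec 3)).im ≠ 0 := by rw [him]; exact mul_ne_zero two_ne_zero hω
    have hsg : SignType.sign (inner ℝ (imVec k) (ω : RVec 3)) = SignType.sign (2 * cdot k (ω : RVec 3)).im := by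
      rw [him, sign_mul, sign_pos two_pos, one_mul]
    rw [hsg, ← log_sub_log_neg hne]
    ring
  have h2 : (2:ℂ) * T = ∫ ω : Sph 3, (2 * cdot k ω) *
      (Complex.I * ((Real.pi * SignType.sign (inner ℝ (imVec k) (ω : RVec 3)) : ℝ) : ℂ)) ∂(sphMeas 3) := by
    rw [two_mul]
    nth_rewrite 2 [h1]
    rw [hT, ← integral_add hi hi2]
    exact integral_congr_ae hae
  have h3 : ∀ ω : Sph 3, ((2 * cdot k ω) *
      (Complex.I * ((Real.pi * SignType.sign (inner ℝ (imVec k) (ω : RVec 3)) : ℝ) : ℂ))).re =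
      -(2 * Real.pi) * |inner ℝ (imVec k) (ω : RVec 3)| := by
    intro ω
    rw [← mul_assoc, Complex.re_mul_ofReal, Complex.mul_I_re]
    have him : (2 * cdot k (ω : RVec 3)).im = 2 * inner ℝ (imVec k) (ω : RVec 3) := by
      rw [← cdot_im]; simp
    rw [him, ← sign_mul_self]
    ring
  have hi3 : Integrable (fun ω : Sph 3 => (2 * cdot k ω) *
      (Complex.I * ((Real.pi * SignType.sign (inner ℝ (imVec k) (ω : RVec 3)) : ℝ) : ℂ))) (sphMeas 3) :=
    (hi.add hi2).congr hae
  have h4 : 2 * T.re = ∫ ω : Sph 3, -(2 * Real.pi) * |inner ℝ (imVec k) (ω : RVec 3)| ∂(sphMeas 3) := by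
    have := congrArg Complex.re h2
    rw [← Complex.reCLM_apply, ← Complex.reCLM_apply, ← ContinuousLinearMap.integral_comp_comm _ hi3] at this
    simp only [Complex.reCLM_apply, h3] at this
    simpa using this
  -- By Archimedes' theorem the sphere integral of `|u·ω|` for a unit vector `u` is `2π ∫_{-1}^1 |t|
  -- dt = 2π`.
  have h5 : ∫ ω : Sph 3, |inner ℝ (imVec k) (ω : RVec 3)| ∂(sphMeas 3) = ‖imVec k‖ * (2 * Real.pi) := by
    have hb0 : 0 < ‖imVec k‖ := norm_pos_iff.2 hb
    have hu : ‖‖imVec k‖⁻¹ • imVec k‖ = 1 := by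
      rw [norm_smul, norm_inv, norm_norm, inv_mul_cancel₀ hb0.ne']
    have h := integral_sph_three (f := fun t : ℝ => ((|t| : ℝ) : ℂ)) (by fun_prop) hu
    have h7 : ∫ t in (-1:ℝ)..1, |t| = 1 := by
      rw [← intervalIntegral.integral_add_adjacent_intervals (b := 0)
        (continuous_abs.intervalIntegrable _ _) (continuous_abs.intervalIntegrable _ _)]
      have e1 : ∫ t in (-1:ℝ)..0, |t| = ∫ t in (-1:ℝ)..0, -t := by
        refine intervalIntegral.integral_congr fun t ht => ?_
        rw [Set.uIcc_of_le (by norm_num)] at ht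
        exact abs_of_nonpos ht.2
      have e2 : ∫ t in (0:ℝ)..1, |t| = ∫ t in (0:ℝ)..1, t := by
        refine intervalIntegral.integral_congr fun t ht => ?_
        rw [Set.uIcc_of_le (by norm_num)] at ht
        exact abs_of_nonneg ht.1
      rw [e1, e2, intervalIntegral.integral_neg, integral_id, integral_id]
      norm_num
    rw [intervalIntegral.integral_ofReal, h7, integral_complex_ofReal] at h
    have h8 : ∫ ω : Sph 3, |inner ℝ (‖imVec k‖⁻¹ • imVec k) (ω : RVec 3)| ∂(sphMeas 3) = 2 * Real.pi := by
      have : ((∫ ω : Sph 3, |inner ℝ (‖imVec k‖⁻¹ • imVec k) (ω : RVec 3)| ∂(sphMeas 3) : ℝ) : ℂ) =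
        ((2 * Real.pi : ℝ) : ℂ) := by rw [h]; push_cast; ring
      exact Complex.ofReal_injective this
    rw [← h8, ← integral_const_mul]
    congr 1; ext ω
    rw [real_inner_smul_left, abs_mul, abs_of_pos (inv_pos.2 hb0)]
    field_simp
  rw [integral_const_mul, h5] at h4
  linarith

theorem measureReal_sph_three : (sphMeas 3).real Set.univ = 4 * Real.pi := by
  have h := integral_sph_three (f := fun _ => (1:ℂ)) continuous_const
    (u := EuclideanSpace.single (0 : Fin 3) (1:ℝ)) (by simp)
  rw [integral_const, intervalIntegral.integral_const] at h
  have : (((sphMeas 3).real Set.univ : ℝ) : ℂ) = ((4 * Real.pi : ℝ) : ℂ) := by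
    simp only [Complex.real_smul, mul_one] at h
    rw [h]; push_cast; ring
  exact Complex.ofReal_injective this

/-- The primitive is `r - w log(r + w)`; as `Im w ≠ 0`, the path `r + w` never meets the cut of the
logarithm. -/
theorem integral_div_add {w : ℂ} (hw : w.im ≠ 0) (N : ℝ) :
    ∫ r in 0..N, (r : ℂ) * ((r : ℂ) + w)⁻¹ = N - w * (Complex.log (N + w) - Complex.log w) := by
  have hne : ∀ r : ℝ, (r : ℂ) + w ≠ 0 := by
    intro r h0
    have := congrArg Complex.im h0
    simp at this
    exact hw this
  have h := intervalIntegral.integral_eq_sub_of_hasDerivAt (a := 0) (b := N)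
    (f := fun r : ℝ => (r : ℂ) - w * Complex.log ((r : ℂ) + w))
    (f' := fun r : ℝ => (r : ℂ) * ((r : ℂ) + w)⁻¹) (fun r _ => by
      have := ((hasDerivAt_id r).ofReal_comp.sub ((hasDerivAt_log_add hw r).const_mul w))
      refine this.congr_deriv ?_
      have := hne r
      field_simp
      simp) ?_
  · rw [h]; simp; ring
  · exact (Continuous.mul (by fun_prop) (Continuous.inv₀ (by fun_prop) hne)).intervalIntegrable _ _

/-- With `w = 2kω` the radial integral is `N - w log N + w log w - w log(1 + w/N)`. Over the sphere
the first term gives `4πN`, the second vanishes by oddness, the third is the constant computed above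
and the last tends to `0`. -/
theorem diagInt_three {k : CVec 3} (h : inner ℝ (imVec k) (reVec k) = 0) (hb : imVec k ≠ 0) :
    Tendsto (fun N : ℝ => (diagInt k N).re - 4 * Real.pi * N) atTop (𝓝 (-(2 * Real.pi ^ 2 * ‖imVec k‖))) := by
  have hM : 0 ≤ ‖reVec k‖ + ‖imVec k‖ := by positivity
  have key : ∀ N, 4 * (‖reVec k‖ + ‖imVec k‖) + 1 ≤ N → diagInt k N - (4 * Real.pi * N : ℝ) =
      (∫ ω : Sph 3, 2 * cdot k ω * Complex.log (2 * cdot k ω) ∂(sphMeas 3)) -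
      ∫ ω : Sph 3, 2 * cdot k ω * Complex.log (1 + 2 * cdot k ω / N) ∂(sphMeas 3) := by
    intro N hN
    have hN0 : 0 < N := by linarith
    have hi1 := integrable_cdot_mul_log k
    have hi2 : Integrable (fun ω : Sph 3 => 2 * cdot k ω * Complex.log (1 + 2 * cdot k ω / N)) (sphMeas 3) := by
      refine Integrable.of_bound ?_ (2 * (‖reVec k‖ + ‖imVec k‖) * (3 / 2 * (2 * (‖reVec k‖ + ‖imVec k‖) / N)))
        (Eventually.of_forall fun ω => ?_)
      · have := measurable_cdot_sph k
        exact Measurable.aestronglyMeasurable (by fun_prop)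
      · rw [norm_mul]
        have h1 := norm_two_cdot_le k ω
        have h2 := norm_log_one_add_div_le hN ω
        gcongr
    have hi3 : Integrable (fun ω : Sph 3 => (2 * cdot k ω) * (Real.log N : ℂ)) (sphMeas 3) := by
      refine Integrable.mul_const (Integrable.of_bound ?_ _ (Eventually.of_forall fun ω => norm_two_cdot_le k ω)) _
      exact ((measurable_cdot_sph k).const_mul 2).aestronglyMeasurable
    have hi4 : Integrable (fun ω : Sph 3 => (N : ℂ)) (sphMeas 3) := integrable_const _
    have e1 : ∫ ω : Sph 3, (2 * cdot k ω) * (Real.log N : ℂ) ∂(sphMeas 3) = 0 := by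
      rw [integral_mul_const, integral_sph_cdot, zero_mul]
    have e2 : ∫ ω : Sph 3, (N : ℂ) ∂(sphMeas 3) = (4 * Real.pi * N : ℝ) := by
      rw [integral_const, measureReal_sph_three, Complex.real_smul]; push_cast; ring
    have e3 : diagInt k N = ∫ ω : Sph 3, ((N : ℂ) - (2 * cdot k ω) * (Real.log N : ℂ)) +
        (2 * cdot k ω * Complex.log (2 * cdot k ω) - 2 * cdot k ω * Complex.log (1 + 2 * cdot k ω / N))
          ∂(sphMeas 3) := by
      rw [(diagInt_polar (by norm_num) h hb hN0.le).2]
      refine integral_congr_ae ?_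
      filter_upwards [sph_inner_ne_zero hb] with ω hω
      have hne : (2 * cdot k (ω : RVec 3)).im ≠ 0 := by
        rw [← cdot_im] at hω; simpa using hω
      have := integral_div_add hne N
      rw [show 3 - 2 = 1 from rfl]
      simp only [pow_one]
      rw [this, log_add_eq hN0 hne]
      ring
    have i1 : Integrable (fun ω : Sph 3 => (N : ℂ) - (2 * cdot k ω) * (Real.log N : ℂ)) (sphMeas 3) := hi4.sub hi3
    have i2 : Integrable (fun ω : Sph 3 => 2 * cdot k ω * Complex.log (2 * cdot k ω) -
      2 * cdot k ω * Complex.log (1 + 2 * cdot k ω / N)) (sphMeas 3) := hi1.sub hi2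
    rw [e3, integral_add i1 i2, integral_sub hi4 hi3, integral_sub hi1 hi2, e1, e2]
    ring
  have h1 := tendsto_log_one_add k (fun ω : Sph 3 => 2 * cdot k ω) (norm_two_cdot_le k)
  have h2 := (Complex.continuous_re.tendsto _).comp
    (h1.const_sub (∫ ω : Sph 3, 2 * cdot k ω * Complex.log (2 * cdot k ω) ∂(sphMeas 3)))
  rw [sub_zero, integral_cdot_mul_log_re hb] at h2
  refine h2.congr' ?_
  filter_upwards [eventually_ge_atTop (4 * (‖reVec k‖ + ‖imVec k‖) + 1)] with N hN
  rw [Function.comp_apply, ← key N hN, Complex.sub_re, Complex.ofReal_re]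

/-! ### Two dimensions -/

/-- Integration over the unit circle by the polar angle. -/
theorem integral_sph_two {f : RVec 2 → ℂ} (hf : Measurable f) :
    ∫ ω : Sph 2, f ω ∂(sphMeas 2) = ∫ θ in (-Real.pi)..Real.pi, f (!₂[Real.cos θ, Real.sin θ]) := by
  have h1 := setIntegral_shell_angular hf
  set e := (MeasurableEquiv.toLp 2 (Fin 2 → ℝ)).symm.trans MeasurableEquiv.finTwoArrow with he
  have hmp : MeasurePreserving e volume volume :=
    (volume_preserving_finTwoArrow ℝ).comp (EuclideanSpace.volume_preserving_symm_measurableEquiv_toLp (Fin 2))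
  set g : RVec 2 → ℂ := (shell 2 0 1).indicator (fun ξ => f (‖ξ‖⁻¹ • ξ)) with hg
  have h2 : ∫ ξ in shell 2 0 1, f (‖ξ‖⁻¹ • ξ) = ∫ p : ℝ × ℝ, g (e.symm p) := by
    rw [← integral_indicator (measurableSet_shell 2 0 1), ← hmp.integral_comp e.measurableEmbedding]
    simp [hg]
  have hes : ∀ p : ℝ × ℝ, e.symm p = !₂[p.1, p.2] := fun p => rfl
  have h3 : ∀ p ∈ polarCoord.target, p.1 • g (e.symm (polarCoord.symm p)) =
      (Set.Ioc (0:ℝ) 1).indicator (fun r => (r : ℂ)) p.1 * f (!₂[Real.cos p.2, Real.sin p.2]) := by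
    intro p hp
    have hp0 : 0 < p.1 := hp.1
    have h4 : e.symm (polarCoord.symm p) = p.1 • !₂[Real.cos p.2, Real.sin p.2] := by
      rw [hes]; ext i; fin_cases i <;> simp [polarCoord]
    have h5 : ‖(!₂[Real.cos p.2, Real.sin p.2] : RVec 2)‖ = 1 := by
      rw [EuclideanSpace.norm_eq]; simp
    have h6 : ‖p.1 • (!₂[Real.cos p.2, Real.sin p.2] : RVec 2)‖ = p.1 := by
      rw [norm_smul, h5, mul_one, Real.norm_of_nonneg hp0.le]
    rw [h4, hg]
    by_cases h : p.1 ≤ 1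
    · rw [Set.indicator_of_mem (show p.1 ∈ Set.Ioc (0:ℝ) 1 from ⟨hp0, h⟩), Set.indicator_of_mem (show _ ∈ shell 2 0 1 from ⟨by rwa [h6], by rwa [h6]⟩), h6,
        smul_smul, inv_mul_cancel₀ hp0.ne', one_smul, Complex.real_smul]
    · have h8 : p.1 • (!₂[Real.cos p.2, Real.sin p.2] : RVec 2) ∉ shell 2 0 1 := fun h' => h (by
        have := h'.2; rwa [h6] at this)
      have h9 : p.1 ∉ Set.Ioc (0:ℝ) 1 := fun h' => h h'.2
      rw [Set.indicator_of_notMem h8, Set.indicator_of_notMem h9, zero_mul, smul_zero]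
  -- The same integral of a direction-only function over the unit disc is evaluated by planar polar
  -- coordinates; both sides carry the factor `1/2 = ∫₀¹ r dr`.
  rw [h2, ← integral_comp_polarCoord_symm, setIntegral_congr_fun polarCoord.open_target.measurableSet h3] at h1
  have h7 : polarCoord.target = Set.Ioi (0:ℝ) ×ˢ Set.Ioo (-Real.pi) Real.pi := rfl
  rw [h7, Measure.volume_eq_prod, setIntegral_prod_mul ((Set.Ioc (0:ℝ) 1).indicator (fun r => (r : ℂ)))
    (fun θ => f (!₂[Real.cos θ, Real.sin θ])), setIntegral_indicator measurableSet_Ioc,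
    Set.inter_eq_right.2 (fun r hr => hr.1), ← intervalIntegral.integral_of_le zero_le_one,
    ← integral_Ioc_eq_integral_Ioo, ← intervalIntegral.integral_of_le (by linarith [Real.pi_pos]),
    intervalIntegral.integral_ofReal, integral_id] at h1
  norm_num at h1
  exact h1.symm

/-- By Jensen's formula the circle mean of `log|e^{it} + B|` is `log⁺|B|`, which is zero for `|B| ≤
1`. The doubled angle runs over two periods. -/
theorem integral_log_norm_double_angle {B : ℂ} (hB : ‖B‖ ≤ 1) :
    ∫ θ in (-Real.pi)..Real.pi, Real.log ‖Complex.exp ((2 * θ : ℝ) * Complex.I) + B‖ = 0 := by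
  set F : ℝ → ℝ := fun t => Real.log ‖Complex.exp (t * Complex.I) + B‖ with hF
  have hper : Function.Periodic F (2 * Real.pi) := by
    intro t
    simp only [hF]
    congr 3
    push_cast
    rw [add_mul, Complex.exp_add, Complex.exp_two_pi_mul_I, mul_one]
  have hcm : ∀ t, Real.log ‖circleMap 0 1 t + B‖ = F t := by
    intro t; simp [hF, circleMap]
  have hint : IntervalIntegrable F volume 0 (0 + 2 * Real.pi) := by
    have h := circleIntegrable_log_norm_sub_const (a := -B) (c := 0) 1
    simp only [CircleIntegrable, sub_neg_eq_add, hcm] at h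
    simpa using h
  have hint2 : ∀ a b, IntervalIntegrable F volume a b := fun a b =>
    hper.intervalIntegrable (by positivity) hint a b
  have h0 : ∫ t in (0:ℝ)..(0 + 2 * Real.pi), F t = 0 := by
    have h := circleAverage_log_norm_add_const_eq_posLog (a := B)
    rw [Real.circleAverage, Real.posLog_eq_zero_iff _ |>.2 (by rwa [abs_norm])] at h
    simp only [hcm, smul_eq_mul] at h
    have h2 : (2 * Real.pi)⁻¹ ≠ 0 := by positivity
    simpa using (mul_eq_zero.1 h).resolve_left h2
  have h1 : ∫ t in (-(2 * Real.pi))..(-(2 * Real.pi) + (2:ℤ) • (2 * Real.pi)), F t = 0 := by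
    rw [hper.intervalIntegral_add_zsmul_eq 2 _ hint2, hper.intervalIntegral_add_eq _ 0, h0, smul_zero]
  have h2 : ∫ θ in (-Real.pi)..Real.pi, F (2 * θ) = 0 := by
    rw [intervalIntegral.integral_comp_mul_left F two_ne_zero]
    have : -(2 * Real.pi) + (2:ℤ) • (2 * Real.pi) = 2 * Real.pi := by simp; ring
    rw [this] at h1
    rw [mul_neg, h1, smul_zero]
  simpa [hF] using h2

/-- Multiplying by a unimodular exponential makes the term with coefficient `1` into `e^{±2iθ}` and
the other one constant. -/
theorem integral_log_norm_trig {P Q : ℂ} (hP : P = 1 ∧ ‖Q‖ ≤ 1 ∨ Q = 1 ∧ ‖P‖ ≤ 1) :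
    ∫ θ in (-Real.pi)..Real.pi, Real.log ‖P * Complex.exp (θ * Complex.I) + Q * Complex.exp (-(θ * Complex.I))‖
      = 0 := by
  have hn : ∀ t : ℝ, ‖Complex.exp (t * Complex.I)‖ = 1 := Complex.norm_exp_ofReal_mul_I
  rcases hP with ⟨rfl, hQ⟩ | ⟨rfl, hP⟩
  · rw [← integral_log_norm_double_angle hQ]
    congr 1; ext θ
    congr 1
    rw [← one_mul ‖Complex.exp ((2 * θ : ℝ) * Complex.I) + Q‖, ← hn (-θ), ← norm_mul, mul_add, ← Complex.exp_add]
    congr 2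
    · rw [one_mul]; congr 1; push_cast; ring
    · rw [mul_comm]; congr 2; push_cast; ring
  · have h := integral_log_norm_double_angle hP
    rw [← neg_neg Real.pi, ← intervalIntegral.integral_comp_neg, neg_neg] at h
    rw [← h]
    congr 1; ext θ
    congr 1
    rw [← one_mul ‖Complex.exp ((2 * -θ : ℝ) * Complex.I) + P‖, ← hn θ, ← norm_mul, mul_add, ← Complex.exp_add,
      add_comm]
    congr 2
    · rw [one_mul]; congr 1; push_cast; ring
    · rw [mul_comm]

theorem two_cdot_circle (k : CVec 2) (θ : ℝ) :
    2 * cdot k (!₂[Real.cos θ, Real.sin θ]) = (k 0 - Complex.I * k 1) * Complex.exp (θ * Complex.I) +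
      (k 0 + Complex.I * k 1) * Complex.exp (-(θ * Complex.I)) := by
  simp only [cdot, Fin.sum_univ_two]
  rw [← neg_mul, Complex.exp_mul_I, Complex.exp_mul_I, Complex.cos_neg, Complex.sin_neg]
  simp
  linear_combination (2 * k 1 * Complex.sin θ) * Complex.I_sq

/-- Since `Re k` and `Im k` are orthogonal in the plane, their determinant is `±|Re k||Im k|`. The
squared moduli of the two coefficients are therefore `(|Re k| ± |Im k|)²`, in one order or the
other. -/
theorem norm_cdot_coeffs {k : CVec 2} (h : inner ℝ (imVec k) (reVec k) = 0) :
    (‖k 0 - Complex.I * k 1‖ = ‖reVec k‖ + ‖imVec k‖ ∧ ‖k 0 + Complex.I * k 1‖ ≤ ‖reVec k‖ + ‖imVec k‖) ∨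
    (‖k 0 + Complex.I * k 1‖ = ‖reVec k‖ + ‖imVec k‖ ∧ ‖k 0 - Complex.I * k 1‖ ≤ ‖reVec k‖ + ‖imVec k‖) := by
  have ha := norm_nonneg (reVec k)
  have hb := norm_nonneg (imVec k)
  have ha2 : ‖reVec k‖ ^ 2 = (k 0).re ^ 2 + (k 1).re ^ 2 := by
    rw [EuclideanSpace.real_norm_sq_eq, Fin.sum_univ_two]; rfl
  have hb2 : ‖imVec k‖ ^ 2 = (k 0).im ^ 2 + (k 1).im ^ 2 := by
    rw [EuclideanSpace.real_norm_sq_eq, Fin.sum_univ_two]; rfl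
  have hab : (k 0).re * (k 0).im + (k 1).re * (k 1).im = 0 := by
    simpa [PiLp.inner_apply, reVec, imVec] using h
  have hP : ‖k 0 - Complex.I * k 1‖ ^ 2 = ‖reVec k‖ ^ 2 + ‖imVec k‖ ^ 2 +
      2 * ((k 0).re * (k 1).im - (k 1).re * (k 0).im) := by
    rw [ha2, hb2, Complex.sq_norm, Complex.normSq_apply]; simp; ring
  have hQ : ‖k 0 + Complex.I * k 1‖ ^ 2 = ‖reVec k‖ ^ 2 + ‖imVec k‖ ^ 2 -
      2 * ((k 0).re * (k 1).im - (k 1).re * (k 0).im) := by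
    rw [ha2, hb2, Complex.sq_norm, Complex.normSq_apply]; simp; ring
  have hX : ((k 0).re * (k 1).im - (k 1).re * (k 0).im) ^ 2 = (‖reVec k‖ * ‖imVec k‖) ^ 2 := by
    rw [mul_pow, ha2, hb2]
    linear_combination -((k 0).re * (k 0).im + (k 1).re * (k 1).im) * hab
  rcases sq_eq_sq_iff_eq_or_eq_neg.1 hX with hx | hx
  · left
    constructor
    · exact (sq_eq_sq₀ (norm_nonneg _) (by positivity)).1 (by rw [hP, hx]; ring)
    · refine le_of_sq_le_sq ?_ (by positivity)
      rw [hQ, hx]; nlinarith [mul_nonneg ha hb]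
  · right
    constructor
    · exact (sq_eq_sq₀ (norm_nonneg _) (by positivity)).1 (by rw [hQ, hx]; ring)
    · refine le_of_sq_le_sq ?_ (by positivity)
      rw [hP, hx]; nlinarith [mul_nonneg ha hb]

theorem measureReal_sph_two : (sphMeas 2).real Set.univ = 2 * Real.pi := by
  have h := integral_sph_two (f := fun _ => (1:ℂ)) measurable_const
  rw [integral_const, intervalIntegral.integral_const] at h
  have : (((sphMeas 2).real Set.univ : ℝ) : ℂ) = ((2 * Real.pi : ℝ) : ℂ) := by
    simp only [Complex.real_smul, mul_one] at h
    rw [h]; push_cast; ring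
  exact Complex.ofReal_injective this

/-- Dividing by the larger coefficient of `2kω` as a trigonometric polynomial leaves a function
whose logarithmic mean vanishes. The modulus of that coefficient is `|Re k| + |Im k|`, and its
logarithm is multiplied by the length `2π`. -/
theorem integral_log_norm_cdot {k : CVec 2} (h : inner ℝ (imVec k) (reVec k) = 0) (hb : imVec k ≠ 0)
    (hi : Integrable (fun ω : Sph 2 => Real.log ‖2 * cdot k ω‖) (sphMeas 2)) :
    ∫ ω : Sph 2, Real.log ‖2 * cdot k ω‖ ∂(sphMeas 2) =
      2 * Real.pi * Real.log (‖reVec k‖ + ‖imVec k‖) := by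
  have hb0 : 0 < ‖imVec k‖ := norm_pos_iff.2 hb
  have hs0 : 0 < ‖reVec k‖ + ‖imVec k‖ := by positivity
  obtain ⟨c, hc, hc2⟩ : ∃ c : ℂ, ‖c‖ = ‖reVec k‖ + ‖imVec k‖ ∧
      (c⁻¹ * (k 0 - Complex.I * k 1) = 1 ∧ ‖c⁻¹ * (k 0 + Complex.I * k 1)‖ ≤ 1 ∨
       c⁻¹ * (k 0 + Complex.I * k 1) = 1 ∧ ‖c⁻¹ * (k 0 - Complex.I * k 1)‖ ≤ 1) := by
    rcases norm_cdot_coeffs h with ⟨h1, h2⟩ | ⟨h1, h2⟩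
    · refine ⟨_, h1, Or.inl ⟨inv_mul_cancel₀ (norm_pos_iff.1 (h1 ▸ hs0)), ?_⟩⟩
      rw [norm_mul, norm_inv, h1]
      exact inv_mul_le_one_of_le₀ h2 hs0.le
    · refine ⟨_, h1, Or.inr ⟨inv_mul_cancel₀ (norm_pos_iff.1 (h1 ▸ hs0)), ?_⟩⟩
      rw [norm_mul, norm_inv, h1]
      exact inv_mul_le_one_of_le₀ h2 hs0.le
  have hc0 : c ≠ 0 := norm_pos_iff.1 (hc ▸ hs0)
  have h1 : ∀ᵐ ω : Sph 2 ∂(sphMeas 2), Real.log ‖2 * cdot k ω‖ =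
      Real.log (‖reVec k‖ + ‖imVec k‖) + Real.log ‖c⁻¹ * (2 * cdot k ω)‖ := by
    filter_upwards [sph_inner_ne_zero hb] with ω hω
    have hne : 2 * cdot k (ω : RVec 2) ≠ 0 := by
      intro h0
      have := congrArg Complex.im h0
      rw [← cdot_im] at hω
      simp at this
      exact hω this
    rw [← hc, ← Real.log_mul (norm_ne_zero_iff.2 hc0) (norm_ne_zero_iff.2 (mul_ne_zero (inv_ne_zero hc0) hne)),
      ← norm_mul, mul_inv_cancel_left₀ hc0]
  have h2 : ∫ ω : Sph 2, Real.log ‖c⁻¹ * (2 * cdot k ω)‖ ∂(sphMeas 2) = 0 := by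
    have hm : Measurable fun ξ : RVec 2 => ((Real.log ‖c⁻¹ * (2 * cdot k ξ)‖ : ℝ) : ℂ) := by
      have := (continuous_cdot k).measurable
      fun_prop
    have h3 := integral_sph_two hm
    rw [integral_complex_ofReal, intervalIntegral.integral_ofReal] at h3
    rw [Complex.ofReal_injective h3, ← integral_log_norm_trig hc2]
    congr 1; ext θ
    rw [two_cdot_circle]
    congr 2; ring
  have hi2 : Integrable (fun ω : Sph 2 => Real.log ‖c⁻¹ * (2 * cdot k ω)‖) (sphMeas 2) := by
    refine (hi.sub (integrable_const (Real.log (‖reVec k‖ + ‖imVec k‖)))).congr ?_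
    filter_upwards [h1] with ω hω
    rw [Pi.sub_apply, hω, add_sub_cancel_left]
  rw [integral_congr_ae h1, integral_add (integrable_const _) hi2, h2, integral_const, measureReal_sph_two]
  simp

theorem integral_inv_add {w : ℂ} (hw : w.im ≠ 0) (N : ℝ) :
    ∫ r in 0..N, ((r : ℂ) + w)⁻¹ = Complex.log (N + w) - Complex.log w := by
  have hne : ∀ r : ℝ, (r : ℂ) + w ≠ 0 := by
    intro r h0
    have := congrArg Complex.im h0
    simp at this
    exact hw this
  have h := intervalIntegral.integral_eq_sub_of_hasDerivAt (a := 0) (b := N)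
    (f := fun r : ℝ => Complex.log ((r : ℂ) + w)) (fun r _ => hasDerivAt_log_add hw r)
    ((Continuous.inv₀ (by fun_prop) hne).intervalIntegrable _ _)
  rw [h]; simp

/-- With `w = 2kω` the radial integral is `log N + log(1 + w/N) - log w`. Over the circle the first
term gives `2π log N`, the second tends to `0`, and the real part of the third is the logarithmic
mean above. -/
theorem diagInt_two {k : CVec 2} (h : inner ℝ (imVec k) (reVec k) = 0) (hb : imVec k ≠ 0) :
    Tendsto (fun N : ℝ => (diagInt k N).re - 2 * Real.pi * Real.log N) atTop
      (𝓝 (-(2 * Real.pi * Real.log (‖reVec k‖ + ‖imVec k‖)))) := by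
  have hM : 0 ≤ ‖reVec k‖ + ‖imVec k‖ := by positivity
  have hae : ∀ N : ℝ, 0 < N → (fun ω : Sph 2 => ∫ r in 0..N, (r : ℂ) ^ (2 - 2) * ((r : ℂ) + 2 * cdot k ω)⁻¹)
      =ᵐ[sphMeas 2] fun ω => (Real.log N + 1 * Complex.log (1 + 2 * cdot k ω / N)) - Complex.log (2 * cdot k ω) := by
    intro N hN0
    filter_upwards [sph_inner_ne_zero hb] with ω hω
    have hne : (2 * cdot k (ω : RVec 2)).im ≠ 0 := by
      rw [← cdot_im] at hω; simpa using hω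
    have := integral_inv_add hne N
    simp only [Nat.sub_self, pow_zero, one_mul]
    rw [this, log_add_eq hN0 hne]
  have hi2 : ∀ N : ℝ, 4 * (‖reVec k‖ + ‖imVec k‖) + 1 ≤ N →
      Integrable (fun ω : Sph 2 => 1 * Complex.log (1 + 2 * cdot k ω / N)) (sphMeas 2) := by
    intro N hN
    refine Integrable.of_bound ?_ ((3 / 2 * (2 * (‖reVec k‖ + ‖imVec k‖) / N)))
      (Eventually.of_forall fun ω => ?_)
    · have := measurable_cdot_sph k
      exact Measurable.aestronglyMeasurable (by fun_prop)
    · rw [one_mul]; exact norm_log_one_add_div_le hN ω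
  -- The unbounded logarithm is integrable because, for one fixed large `N`, it differs by bounded
  -- terms from the radial integral, whose integrability comes with `diagInt_polar`.
  have hi1 : Integrable (fun ω : Sph 2 => Complex.log (2 * cdot k ω)) (sphMeas 2) := by
    set N := 4 * (‖reVec k‖ + ‖imVec k‖) + 1 with hN
    have hN0 : 0 < N := by linarith
    have h1 := ((diagInt_polar (by norm_num) h hb hN0.le).1.congr (hae N hN0))
    have h2 := ((integrable_const (Real.log N : ℂ)).add (hi2 N le_rfl)).sub h1
    refine h2.congr (Eventually.of_forall fun ω => ?_)
    simp
  have hre : (∫ ω : Sph 2, Complex.log (2 * cdot k ω) ∂(sphMeas 2)).re =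
      2 * Real.pi * Real.log (‖reVec k‖ + ‖imVec k‖) := by
    have hi3 : Integrable (fun ω : Sph 2 => Real.log ‖2 * cdot k ω‖) (sphMeas 2) := by
      refine hi1.re.congr (Eventually.of_forall fun ω => ?_)
      simp only [RCLike.re_to_complex, Complex.log_re]
    rw [← integral_log_norm_cdot h hb hi3, ← Complex.reCLM_apply, ← ContinuousLinearMap.integral_comp_comm _ hi1]
    simp only [Complex.reCLM_apply, Complex.log_re]
  have key : ∀ N, 4 * (‖reVec k‖ + ‖imVec k‖) + 1 ≤ N → diagInt k N - (2 * Real.pi * Real.log N : ℝ) =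
      (∫ ω : Sph 2, 1 * Complex.log (1 + 2 * cdot k ω / N) ∂(sphMeas 2)) -
      ∫ ω : Sph 2, Complex.log (2 * cdot k ω) ∂(sphMeas 2) := by
    intro N hN
    have hN0 : 0 < N := by linarith
    have e2 : ∫ ω : Sph 2, (Real.log N : ℂ) ∂(sphMeas 2) = (2 * Real.pi * Real.log N : ℝ) := by
      rw [integral_const, measureReal_sph_two, Complex.real_smul]; push_cast; ring
    have i1 : Integrable (fun ω : Sph 2 => (Real.log N : ℂ) + 1 * Complex.log (1 + 2 * cdot k ω / N)) (sphMeas 2) :=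
      (integrable_const _).add (hi2 N hN)
    rw [(diagInt_polar (by norm_num) h hb hN0.le).2, integral_congr_ae (hae N hN0), integral_sub i1 hi1,
      integral_add (integrable_const _) (hi2 N hN), e2]
    ring
  have h1 := tendsto_log_one_add k (fun ω : Sph 2 => 1) (M := 1) (by simp)
  have h2 := (Complex.continuous_re.tendsto _).comp
    (h1.sub_const (∫ ω : Sph 2, Complex.log (2 * cdot k ω) ∂(sphMeas 2)))
  rw [zero_sub, Complex.neg_re, hre] at h2
  refine h2.congr' ?_
  filter_upwards [eventually_ge_atTop (4 * (‖reVec k‖ + ‖imVec k‖) + 1)] with N hN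
  rw [Function.comp_apply, ← key N hN, Complex.sub_re, Complex.ofReal_re]

/-! ### The renormalised diagonal term in both dimensions. -/

/-- The divergent part `N / (2π²)` or `ln N / (2π)` of the diagonal terms. -/
noncomputable def divTerm (d : ℕ) (N : ℝ) : ℝ :=
  if d = 3 then N / (2 * Real.pi ^ 2) else Real.log N / (2 * Real.pi)

theorem tendsto_diag {d : ℕ} [NeZero d] (hd : d = 2 ∨ d = 3) {k : CVec d}
    (h : inner ℝ (imVec k) (reVec k) = 0) (hb : imVec k ≠ 0) :
    Tendsto (fun N : ℝ => fourierConst d * diagInt k N - (divTerm d N : ℂ)) atTop (𝓝 (-(diagTerm k : ℂ))) := by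
  have hreal : ∀ N, diagInt k N = ((diagInt k N).re : ℂ) := fun N =>
    Complex.ext rfl (by simpa using diagInt_im h N)
  have hpi := Real.pi_pos
  have key : Tendsto (fun N : ℝ => ((2 * Real.pi) ^ d)⁻¹ * (diagInt k N).re - divTerm d N) atTop
      (𝓝 (-(diagTerm k))) := by
    rcases hd with rfl | rfl
    · have h1 := (diagInt_two h hb).const_mul (((2 * Real.pi) ^ 2)⁻¹)
      refine (h1.congr fun N => ?_).trans_eq ?_
      · simp only [divTerm]; norm_num; field_simp
      · congr 1; simp only [diagTerm]; norm_num; field_simp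
    · have h1 := (diagInt_three h hb).const_mul (((2 * Real.pi) ^ 3)⁻¹)
      refine (h1.congr fun N => ?_).trans_eq ?_
      · simp only [divTerm, if_true]; field_simp; ring
      · simp only [diagTerm, if_true]; congr 1; field_simp; ring
  have h2 := (Complex.continuous_ofReal.tendsto _).comp key
  refine (h2.congr fun N => ?_).trans_eq (by push_cast; rfl)
  simp only [Function.comp_apply]
  rw [hreal N, fourierConst]
  push_cast
  simp

/-! ### Boundary values near the critical sphere -/

/-- A primitive of `w ↦ 1 / (w + i y)`, for fixed `y ≠ 0`. -/
noncomputable def logArg (w y : ℝ) : ℂ :=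
  ((Real.log (w ^ 2 + y ^ 2) / 2 : ℝ) : ℂ) - Complex.I * ((Real.arctan (w / y) : ℝ) : ℂ)

theorem hasDerivAt_logArg {w : ℝ → ℝ} {w' r y : ℝ} (hw : HasDerivAt w w' r) (hy : y ≠ 0) :
    HasDerivAt (fun r => logArg (w r) y) ((w' : ℂ) * ((w r : ℂ) + Complex.I * (y : ℂ))⁻¹) r := by
  have hp : w r ^ 2 + y ^ 2 ≠ 0 := by positivity
  have h1 : HasDerivAt (fun r => Real.log (w r ^ 2 + y ^ 2) / 2) ((2 * w r * w') / (w r ^ 2 + y ^ 2) / 2) r := by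
    have := (((hw.fun_pow 2).add_const (y ^ 2)).log hp).div_const 2
    simpa using this
  have h2 := (hw.div_const y).arctan
  have h3 := h1.ofReal_comp.sub (h2.ofReal_comp.const_mul Complex.I)
  refine h3.congr_deriv ?_
  have hne : (w r : ℂ) + Complex.I * (y : ℂ) ≠ 0 := by
    intro h0
    have := congrArg Complex.im h0
    simp at this
    exact hy this
  have hpc : (w r : ℂ) ^ 2 + (y : ℂ) ^ 2 ≠ 0 := by exact_mod_cast hp
  have hyc : (y : ℂ) ≠ 0 := by exact_mod_cast hy
  have h5 : ((w r : ℂ) + Complex.I * (y : ℂ))⁻¹ = (w r - Complex.I * y) / (w r ^ 2 + y ^ 2) := by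
    rw [inv_eq_iff_eq_inv, inv_div, eq_div_iff]
    · linear_combination (-(y:ℂ)^2) * Complex.I_sq
    · intro h0
      have := congrArg Complex.im h0
      simp at this
      exact hy this
  have hy1 : 1 + (w r / y) ^ 2 ≠ 0 := by positivity
  have h6 : 1 / (1 + (w r / y) ^ 2) * (w' / y) = y * w' / (w r ^ 2 + y ^ 2) := by
    field_simp; ring
  rw [h5, h6]
  push_cast
  field_simp

/-- The bound does not involve `y` beyond `|y| ≤ 2`, and its only singularity is `log|w|`: this is
the uniform majorant for `ε → 0`. -/
theorem norm_logArg_le {w y W : ℝ} (hw : w ≠ 0) (hW : |w| ≤ W) (hy : |y| ≤ 2) :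
    ‖logArg w y‖ ≤ |Real.log (|w|)| + |Real.log (W ^ 2 + 4)| + Real.pi := by
  have h1 : |Real.log (w ^ 2 + y ^ 2) / 2| ≤ |Real.log (|w|)| + |Real.log (W ^ 2 + 4)| := by
    have hw2 : 0 < w ^ 2 := by positivity
    have e1 : Real.log (w ^ 2) = 2 * Real.log |w| := by rw [← sq_abs, Real.log_pow]; norm_num
    have a1 : Real.log (w ^ 2) ≤ Real.log (w ^ 2 + y ^ 2) :=
      Real.log_le_log hw2 (by nlinarith [sq_nonneg y])
    have a2 : Real.log (w ^ 2 + y ^ 2) ≤ Real.log (W ^ 2 + 4) := by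
      refine Real.log_le_log (by positivity) ?_
      have := sq_le_sq' (by linarith [abs_nonneg w]) hW
      have := sq_le_sq' (by linarith [abs_nonneg y]) hy
      rw [sq_abs] at *
      linarith
    rw [e1] at a1
    have := neg_abs_le (Real.log |w|)
    have := le_abs_self (Real.log (W ^ 2 + 4))
    have := abs_nonneg (Real.log |w|)
    have := abs_nonneg (Real.log (W ^ 2 + 4))
    rw [abs_le]
    constructor <;> linarith
  have h2 : |Real.arctan (w / y)| ≤ Real.pi := by
    have := Real.neg_pi_div_two_lt_arctan (w / y)
    have := Real.arctan_lt_pi_div_two (w / y)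
    have := Real.pi_pos
    rw [abs_le]; constructor <;> linarith
  refine (norm_sub_le _ _).trans ?_
  rw [norm_mul, Complex.norm_I, one_mul, Complex.norm_real, Complex.norm_real, Real.norm_eq_abs,
    Real.norm_eq_abs]
  linarith

/-- For `w ≠ 0` the arctangent tends to `±π/2` according to the sign of `w/t`. -/
theorem tendsto_logArg {w t : ℝ} (hw : w ≠ 0) (ht : t ≠ 0) :
    ∃ l, Tendsto (fun ε : ℝ => logArg w (ε * t)) (𝓝[>] 0) (𝓝 l) := by
  have h1 : Tendsto (fun ε : ℝ => Real.log (w ^ 2 + (ε * t) ^ 2) / 2) (𝓝[>] 0)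
      (𝓝 (Real.log (w ^ 2 + (0 * t) ^ 2) / 2)) := by
    refine Tendsto.mono_left (Tendsto.div_const (Tendsto.log ?_ (by positivity)) 2) nhdsWithin_le_nhds
    exact Continuous.tendsto (by fun_prop) 0
  have h2 : ∃ m, Tendsto (fun ε : ℝ => Real.arctan (w / (ε * t))) (𝓝[>] 0) (𝓝 m) := by
    have e : ∀ ε : ℝ, w / (ε * t) = (w / t) * ε⁻¹ := fun ε => by
      rw [mul_comm ε, ← div_div, div_eq_mul_inv _ ε]
    simp_rw [e]
    rcases lt_or_gt_of_ne (div_ne_zero hw ht) with h | h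
    · exact ⟨_, (Real.tendsto_arctan_atBot.mono_right nhdsWithin_le_nhds).comp
        (tendsto_inv_nhdsGT_zero.const_mul_atTop_of_neg h)⟩
    · exact ⟨_, (Real.tendsto_arctan_atTop.mono_right nhdsWithin_le_nhds).comp
        (tendsto_inv_nhdsGT_zero.const_mul_atTop h)⟩
  obtain ⟨m, hm⟩ := h2
  exact ⟨_, ((Complex.continuous_ofReal.tendsto _).comp h1).sub
    (((Complex.continuous_ofReal.tendsto _).comp hm).const_mul _)⟩

/-! ### Radial integrals across the critical radius. -/

/-- The real part of the shifted symbol, divided by `r`. -/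
noncomputable def radW (κ r : ℝ) : ℝ := (r ^ 2 - κ ^ 2) / r

theorem hasDerivAt_radW (κ : ℝ) {r : ℝ} (hr : 0 < r) :
    HasDerivAt (radW κ) ((r ^ 2 + κ ^ 2) / r ^ 2) r := by
  have := ((hasDerivAt_pow 2 r).sub_const (κ ^ 2)).div (hasDerivAt_id r) hr.ne'
  refine this.congr_deriv ?_
  simp; field_simp; ring

theorem radW_ne_zero {κ r : ℝ} (hκ : 0 < κ) (hr : 0 < r) (h : r ≠ κ) : radW κ r ≠ 0 := by
  refine div_ne_zero ?_ hr.ne'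
  intro h0
  have : (r - κ) * (r + κ) = 0 := by linear_combination h0
  rcases mul_eq_zero.1 this with h1 | h1
  · exact h (by linarith)
  · linarith

theorem abs_radW_le {κ r : ℝ} (hκ : 0 < κ) (h1 : κ / 2 ≤ r) (h2 : r ≤ 2 * κ) : |radW κ r| ≤ 6 * κ := by
  have hr : 0 < r := by linarith
  rw [radW, abs_div, abs_of_pos hr, div_le_iff₀ hr, abs_le]
  constructor <;> nlinarith

/-- The dominating function of the radial integrals. -/
noncomputable def radDom (κ r : ℝ) : ℝ :=
  |Real.log (|radW κ r|)| + |Real.log ((6 * κ) ^ 2 + 4)| + Real.pi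

theorem radDom_nonneg (κ r : ℝ) : 0 ≤ radDom κ r := by
  have := Real.pi_pos; unfold radDom; positivity

/-- `radW` has a simple zero at `κ` and no other on this interval: `log|radW|` is `log|r - κ|` plus
a continuous function. -/
theorem intervalIntegrable_radDom {κ : ℝ} (hκ : 0 < κ) :
    IntervalIntegrable (radDom κ) volume (κ / 2) (2 * κ) := by
  have h1 : IntervalIntegrable (fun r => Real.log (r - κ)) volume (κ / 2) (2 * κ) := by
    have := (intervalIntegral.intervalIntegrable_log' (a := κ / 2 - κ) (b := 2 * κ - κ)).comp_sub_right κ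
    simpa using this
  have h2 : IntervalIntegrable (fun r => Real.log ((r + κ) / r)) volume (κ / 2) (2 * κ) := by
    refine ContinuousOn.intervalIntegrable fun r hr => ContinuousAt.continuousWithinAt ?_
    rw [Set.uIcc_of_le (by linarith)] at hr
    have hr0 : 0 < r := by linarith [hr.1]
    exact ContinuousAt.log (ContinuousAt.div (by fun_prop) (by fun_prop) hr0.ne') (by positivity)
  have h3 : IntervalIntegrable (fun r => Real.log |radW κ r|) volume (κ / 2) (2 * κ) := by
    refine (h1.add h2).congr_ae ?_
    rw [Set.uIoc_of_le (by linarith)]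
    filter_upwards [ae_restrict_mem measurableSet_Ioc, (Measure.ae_ne volume κ).filter_mono (ae_mono Measure.restrict_le_self)] with r hr hne
    have hr0 : 0 < r := by linarith [hr.1]
    rw [← Real.log_mul (sub_ne_zero.2 hne) (by positivity), Real.log_abs, radW]
    congr 1; field_simp; ring
  exact (h3.abs.add intervalIntegrable_const).add intervalIntegrable_const

/-- The factor `(r² + κ²)/r²` is the derivative of `radW`, so the singular factor is the derivative
of `logArg (radW κ r) y`. Moving the derivative to `f` trades a pole that forms as `y → 0` for a
logarithm. -/
theorem radial_ibp {κ y : ℝ} (hκ : 0 < κ) (hy : y ≠ 0) {f f' : ℝ → ℂ} (hf : ∀ r, HasDerivAt f (f' r) r)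
    (hf' : Continuous f') :
    ∫ r in (κ / 2)..(2 * κ), f r * ((((r ^ 2 + κ ^ 2) / r ^ 2 : ℝ) : ℂ) * ((radW κ r : ℂ) + Complex.I * (y : ℂ))⁻¹) =
      f (2 * κ) * logArg (radW κ (2 * κ)) y - f (κ / 2) * logArg (radW κ (κ / 2)) y -
        ∫ r in (κ / 2)..(2 * κ), f' r * logArg (radW κ r) y := by
  have hle : κ / 2 ≤ 2 * κ := by linarith
  have hpos : ∀ r ∈ Set.uIcc (κ / 2) (2 * κ), 0 < r := by
    intro r hr
    rw [Set.uIcc_of_le hle] at hr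
    linarith [hr.1]
  refine intervalIntegral.integral_mul_deriv_eq_deriv_mul (fun r _ => hf r)
    (fun r hr => hasDerivAt_logArg (hasDerivAt_radW κ (hpos r hr)) hy) (hf'.intervalIntegrable _ _) ?_
  refine ContinuousOn.intervalIntegrable fun r hr => ContinuousAt.continuousWithinAt ?_
  have hr0 := hpos r hr
  have hne : (radW κ r : ℂ) + Complex.I * (y : ℂ) ≠ 0 := by
    intro h0
    have := congrArg Complex.im h0
    simp at this
    exact hy this
  refine ContinuousAt.mul ?_ (ContinuousAt.inv₀ (ContinuousAt.add ?_ continuousAt_const) hne)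
  · exact Complex.continuous_ofReal.continuousAt.comp
      (ContinuousAt.div (by fun_prop) (by fun_prop) (by positivity))
  · exact Complex.continuous_ofReal.continuousAt.comp (hasDerivAt_radW κ hr0).continuousAt

theorem measurable_logArg_radW (κ y : ℝ) : Measurable fun r => logArg (radW κ r) y := by
  unfold logArg radW
  have h1 : Measurable fun r : ℝ => Real.log (((r ^ 2 - κ ^ 2) / r) ^ 2 + y ^ 2) / 2 := by fun_prop
  have h2 : Measurable fun r : ℝ => Real.arctan ((r ^ 2 - κ ^ 2) / r / y) :=
    Real.measurable_arctan.comp (by fun_prop)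
  fun_prop

theorem norm_logArg_radW_le {κ r y : ℝ} (hκ : 0 < κ) (h1 : κ / 2 ≤ r) (h2 : r ≤ 2 * κ) (h : r ≠ κ) (hy : |y| ≤ 2) :
    ‖logArg (radW κ r) y‖ ≤ radDom κ r :=
  norm_logArg_le (radW_ne_zero hκ (by linarith) h) (abs_radW_le hκ h1 h2) hy

/-- Bound of the radial integral, uniform in the regularisation. -/
theorem exists_radial_bound {κ : ℝ} (hκ : 0 < κ) : ∃ C, 0 ≤ C ∧ ∀ (f f' : ℝ → ℂ) (M y : ℝ),
    (∀ r, HasDerivAt f (f' r) r) → Continuous f' → (∀ r, κ / 2 ≤ r → r ≤ 2 * κ → ‖f r‖ ≤ M) →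
    (∀ r, κ / 2 ≤ r → r ≤ 2 * κ → ‖f' r‖ ≤ M) → y ≠ 0 → |y| ≤ 2 →
    ‖∫ r in (κ / 2)..(2 * κ), f r * ((((r ^ 2 + κ ^ 2) / r ^ 2 : ℝ) : ℂ) *
      ((radW κ r : ℂ) + Complex.I * (y : ℂ))⁻¹)‖ ≤ C * M := by
  have hle : κ / 2 ≤ 2 * κ := by linarith
  have hI0 : 0 ≤ ∫ r in (κ / 2)..(2 * κ), radDom κ r :=
    intervalIntegral.integral_nonneg hle fun r _ => radDom_nonneg κ r
  have := radDom_nonneg κ (2 * κ)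
  have := radDom_nonneg κ (κ / 2)
  refine ⟨radDom κ (2 * κ) + radDom κ (κ / 2) + ∫ r in (κ / 2)..(2 * κ), radDom κ r, by positivity, ?_⟩
  intro f f' M y hf hf' hM hM' hy hy2
  have hM0 : 0 ≤ M := (norm_nonneg _).trans (hM (2 * κ) hle le_rfl)
  rw [radial_ibp hκ hy hf hf']
  have b1 : ‖f (2 * κ) * logArg (radW κ (2 * κ)) y‖ ≤ M * radDom κ (2 * κ) := by
    rw [norm_mul]
    exact mul_le_mul (hM _ hle le_rfl) (norm_logArg_radW_le hκ hle le_rfl (by linarith) hy2) (norm_nonneg _) hM0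
  have b2 : ‖f (κ / 2) * logArg (radW κ (κ / 2)) y‖ ≤ M * radDom κ (κ / 2) := by
    rw [norm_mul]
    exact mul_le_mul (hM _ le_rfl hle) (norm_logArg_radW_le hκ le_rfl hle (by linarith) hy2) (norm_nonneg _) hM0
  have b3 : ‖∫ r in (κ / 2)..(2 * κ), f' r * logArg (radW κ r) y‖ ≤ M * ∫ r in (κ / 2)..(2 * κ), radDom κ r := by
    rw [← intervalIntegral.integral_const_mul]
    refine intervalIntegral.norm_integral_le_of_norm_le hle ?_ ((intervalIntegrable_radDom hκ).const_mul M)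
    filter_upwards [Measure.ae_ne volume κ] with r hne hr
    rw [norm_mul]
    exact mul_le_mul (hM' r hr.1.le hr.2) (norm_logArg_radW_le hκ hr.1.le hr.2 hne hy2) (norm_nonneg _) hM0
  refine (norm_sub_le _ _).trans ((add_le_add ((norm_sub_le _ _).trans (add_le_add b1 b2)) b3).trans ?_)
  linarith

theorem tendsto_radial {κ t : ℝ} (hκ : 0 < κ) (ht : t ≠ 0) (ht2 : |t| ≤ 2) {f f' : ℝ → ℂ}
    (hf : ∀ r, HasDerivAt f (f' r) r) (hf' : Continuous f') :
    ∃ l, Tendsto (fun ε : ℝ => ∫ r in (κ / 2)..(2 * κ), f r * ((((r ^ 2 + κ ^ 2) / r ^ 2 : ℝ) : ℂ) *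
      ((radW κ r : ℂ) + Complex.I * ((ε * t : ℝ) : ℂ))⁻¹)) (𝓝[>] 0) (𝓝 l) := by
  have hle : κ / 2 ≤ 2 * κ := by linarith
  obtain ⟨l1, h1⟩ := tendsto_logArg (radW_ne_zero hκ (r := 2 * κ) (by linarith) (by linarith)) ht
  obtain ⟨l2, h2⟩ := tendsto_logArg (radW_ne_zero hκ (r := κ / 2) (by linarith) (by linarith)) ht
  have hL : ∀ r : ℝ, ∃ l, κ / 2 < r → r ≠ κ → Tendsto (fun ε : ℝ => logArg (radW κ r) (ε * t)) (𝓝[>] 0) (𝓝 l) := by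
    intro r
    by_cases hr : κ / 2 < r ∧ r ≠ κ
    · obtain ⟨l, hl⟩ := tendsto_logArg (radW_ne_zero hκ (by linarith) hr.2) ht
      exact ⟨l, fun _ _ => hl⟩
    · exact ⟨0, fun h3 h4 => absurd ⟨h3, h4⟩ hr⟩
  choose L hL using hL
  obtain ⟨M, hM⟩ := (isCompact_Icc (a := κ / 2) (b := 2 * κ)).exists_bound_of_continuousOn hf'.continuousOn
  have h3 : Tendsto (fun ε : ℝ => ∫ r in (κ / 2)..(2 * κ), f' r * logArg (radW κ r) (ε * t)) (𝓝[>] 0)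
      (𝓝 (∫ r in (κ / 2)..(2 * κ), f' r * L r)) := by
    refine intervalIntegral.tendsto_integral_filter_of_dominated_convergence (fun r => M * radDom κ r) ?_ ?_
      ((intervalIntegrable_radDom hκ).const_mul M) ?_
    · exact Eventually.of_forall fun ε => (hf'.measurable.mul (measurable_logArg_radW κ _)).aestronglyMeasurable
    · filter_upwards [Ioc_mem_nhdsGT_zero] with ε hε
      filter_upwards [Measure.ae_ne volume κ] with r hne hr
      rw [Set.uIoc_of_le hle] at hr
      have hM0 := hM r ⟨hr.1.le, hr.2⟩
      rw [norm_mul]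
      refine mul_le_mul hM0 (norm_logArg_radW_le hκ hr.1.le hr.2 hne ?_) (norm_nonneg _) ((norm_nonneg _).trans hM0)
      rw [abs_mul, abs_of_pos hε.1]
      exact (mul_le_of_le_one_left (abs_nonneg _) hε.2).trans ht2
    · filter_upwards [Measure.ae_ne volume κ] with r hne hr
      rw [Set.uIoc_of_le hle] at hr
      exact (hL r hr.1 hne).const_mul _
  refine ⟨_, (((h1.const_mul (f (2 * κ))).sub (h2.const_mul (f (κ / 2)))).sub h3).congr' ?_⟩
  filter_upwards [self_mem_nhdsWithin] with ε hε
  exact (radial_ibp hκ (mul_ne_zero (ne_of_gt hε) ht) hf hf').symm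

/-- The radial amplitude multiplying the derivative of the logarithm. -/
noncomputable def radAmp (d : ℕ) (κ s r : ℝ) : ℂ :=
  ((r ^ d / (r ^ 2 + κ ^ 2) : ℝ) : ℂ) * Complex.exp (Complex.I * ((r * s : ℝ) : ℂ))

/-- The derivative of `radAmp`. -/
noncomputable def radAmpDeriv (d : ℕ) (κ s r : ℝ) : ℂ :=
  (((d * r ^ (d - 1) * (r ^ 2 + κ ^ 2) - r ^ d * (2 * r)) / (r ^ 2 + κ ^ 2) ^ 2 : ℝ) : ℂ) *
      Complex.exp (Complex.I * ((r * s : ℝ) : ℂ)) +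
    ((r ^ d / (r ^ 2 + κ ^ 2) : ℝ) : ℂ) * (Complex.exp (Complex.I * ((r * s : ℝ) : ℂ)) * (Complex.I * (s : ℂ)))

theorem hasDerivAt_radAmp (d : ℕ) {κ : ℝ} (hκ : 0 < κ) (s r : ℝ) :
    HasDerivAt (radAmp d κ s) (radAmpDeriv d κ s r) r := by
  have h1 : HasDerivAt (fun r : ℝ => r ^ d / (r ^ 2 + κ ^ 2))
      ((d * r ^ (d - 1) * (r ^ 2 + κ ^ 2) - r ^ d * (2 * r)) / (r ^ 2 + κ ^ 2) ^ 2) r := by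
    have := (hasDerivAt_pow d r).fun_div ((hasDerivAt_pow 2 r).add_const (κ ^ 2)) (by positivity)
    simpa using this
  have h2 : HasDerivAt (fun r : ℝ => Complex.exp (Complex.I * ((r * s : ℝ) : ℂ)))
      (Complex.exp (Complex.I * ((r * s : ℝ) : ℂ)) * (Complex.I * (s : ℂ))) r := by
    have h3 : HasDerivAt (fun r : ℝ => Complex.I * ((r * s : ℝ) : ℂ)) (Complex.I * (s : ℂ)) r := by
      have := ((hasDerivAt_id r).mul_const s).ofReal_comp.const_mul Complex.I
      simpa using this
    exact h3.cexp
  exact h1.ofReal_comp.mul h2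

theorem continuous_radAmpDeriv (d : ℕ) {κ : ℝ} (hκ : 0 < κ) (s : ℝ) : Continuous (radAmpDeriv d κ s) := by
  unfold radAmpDeriv
  have h1 : Continuous fun r : ℝ => (d * r ^ (d - 1) * (r ^ 2 + κ ^ 2) - r ^ d * (2 * r)) / (r ^ 2 + κ ^ 2) ^ 2 :=
    Continuous.div (by fun_prop) (by fun_prop) fun r => by positivity
  have h2 : Continuous fun r : ℝ => r ^ d / (r ^ 2 + κ ^ 2) :=
    Continuous.div (by fun_prop) (by fun_prop) fun r => by positivity
  fun_prop

/-- Differentiating the exponential costs a factor `|s|`. With `|s| ≤ |x|` this is the origin of the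
linear growth in `x` of the bounds near the critical sphere. -/
theorem exists_radAmp_bound (d : ℕ) {κ : ℝ} (hκ : 0 < κ) : ∃ M, 0 ≤ M ∧ ∀ s r : ℝ, κ / 2 ≤ r → r ≤ 2 * κ →
    ‖radAmp d κ s r‖ ≤ M * (1 + |s|) ∧ ‖radAmpDeriv d κ s r‖ ≤ M * (1 + |s|) := by
  have h1 : Continuous fun r : ℝ => (d * r ^ (d - 1) * (r ^ 2 + κ ^ 2) - r ^ d * (2 * r)) / (r ^ 2 + κ ^ 2) ^ 2 :=
    Continuous.div (by fun_prop) (by fun_prop) fun r => by positivity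
  have h2 : Continuous fun r : ℝ => r ^ d / (r ^ 2 + κ ^ 2) :=
    Continuous.div (by fun_prop) (by fun_prop) fun r => by positivity
  obtain ⟨M1, hM1⟩ := (isCompact_Icc (a := κ / 2) (b := 2 * κ)).exists_bound_of_continuousOn h1.continuousOn
  obtain ⟨M2, hM2⟩ := (isCompact_Icc (a := κ / 2) (b := 2 * κ)).exists_bound_of_continuousOn h2.continuousOn
  refine ⟨|M1| + |M2|, by positivity, fun s r hr1 hr2 => ?_⟩
  have b1 := (hM1 r ⟨hr1, hr2⟩).trans (le_abs_self _)
  have b2 := (hM2 r ⟨hr1, hr2⟩).trans (le_abs_self _)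
  have a1 := abs_nonneg M1
  have a2 := abs_nonneg M2
  have as := abs_nonneg s
  have he : ‖Complex.exp (Complex.I * ((r * s : ℝ) : ℂ))‖ = 1 := by
    rw [mul_comm]; exact Complex.norm_exp_ofReal_mul_I _
  constructor
  · rw [radAmp, norm_mul, he, mul_one, Complex.norm_real]
    nlinarith [mul_nonneg a1 as, mul_nonneg a2 as]
  · refine (norm_add_le _ _).trans ?_
    rw [norm_mul, norm_mul, norm_mul, norm_mul, he, mul_one, one_mul, Complex.norm_I, one_mul, Complex.norm_real,
      Complex.norm_real, Complex.norm_real, Real.norm_eq_abs s]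
    have := mul_le_mul_of_nonneg_right b2 as
    nlinarith [mul_nonneg a1 as, mul_nonneg a2 as]

/-! ### Neighbourhood of the critical sphere and its complement. -/

/-- The inverse of the shifted symbol at the complex momentum `k + i ε γ`, `κ = |k|`. -/
noncomputable def shiftedInv {d : ℕ} (κ ε : ℝ) (γ ζ : RVec d) : ℂ :=
  (((‖ζ‖ ^ 2 - κ ^ 2 : ℝ) : ℂ) + Complex.I * ((2 * inner ℝ (ε • γ) ζ : ℝ) : ℂ))⁻¹

theorem measurable_shiftedInv {d : ℕ} (κ ε : ℝ) (γ : RVec d) : Measurable (shiftedInv κ ε γ) := by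
  unfold shiftedInv; fun_prop

/-- The weight `r^(d-2)` left by the Jacobian is written as `r^d/(r² + κ²)` times the derivative of
`radW`, which is the shape `radial_ibp` needs. -/
theorem polar_shiftedInv {d : ℕ} (hd : 2 ≤ d) {κ ε r : ℝ} (hr : 0 < r) (γ x : RVec d) (ω : Sph d) :
    ((r ^ (d - 1) : ℝ) : ℂ) * (planeWave (r • (ω : RVec d)) x * shiftedInv κ ε γ (r • (ω : RVec d))) =
      radAmp d κ (inner ℝ (ω : RVec d) x) r * ((((r ^ 2 + κ ^ 2) / r ^ 2 : ℝ) : ℂ) *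
        ((radW κ r : ℂ) + Complex.I * ((ε * (2 * inner ℝ γ (ω : RVec d)) : ℝ) : ℂ))⁻¹) := by
  have h1 : (((‖r • (ω : RVec d)‖ ^ 2 - κ ^ 2 : ℝ) : ℂ) +
      Complex.I * ((2 * inner ℝ (ε • γ) (r • (ω : RVec d)) : ℝ) : ℂ)) =
      (r : ℂ) * ((radW κ r : ℂ) + Complex.I * ((ε * (2 * inner ℝ γ (ω : RVec d)) : ℝ) : ℂ)) := by
    rw [norm_smul_sph hr.le, radW, real_inner_smul_left, real_inner_smul_right]
    have : (r : ℂ) ≠ 0 := by exact_mod_cast hr.ne'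
    push_cast
    field_simp
  rw [shiftedInv, h1, mul_inv, radAmp, planeWave, real_inner_smul_left]
  have h2 : r ^ (d - 1) * r⁻¹ = r ^ d / (r ^ 2 + κ ^ 2) * ((r ^ 2 + κ ^ 2) / r ^ 2) := by
    obtain ⟨e, rfl⟩ : ∃ e, d = e + 2 := ⟨d - 2, by omega⟩
    have : r ^ 2 + κ ^ 2 ≠ 0 := by positivity
    rw [show e + 2 - 1 = e + 1 by omega]
    field_simp
    ring
  have h3 : ((r ^ (d - 1) : ℝ) : ℂ) * (r : ℂ)⁻¹ =
      ((r ^ d / (r ^ 2 + κ ^ 2) : ℝ) : ℂ) * (((r ^ 2 + κ ^ 2) / r ^ 2 : ℝ) : ℂ) := by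
    exact_mod_cast h2
  linear_combination (Complex.exp (Complex.I * ((r * inner ℝ (ω : RVec d) x : ℝ) : ℂ)) *
    ((radW κ r : ℂ) + Complex.I * ((ε * (2 * inner ℝ γ (ω : RVec d)) : ℝ) : ℂ))⁻¹) * h3

theorem integrableOn_planeWave_shiftedInv {d : ℕ} [NeZero d] (hd : 2 ≤ d) {κ ε : ℝ} (hκ : 0 < κ) (hε : ε ≠ 0)
    {γ : RVec d} (hγ : γ ≠ 0) (x : RVec d) :
    IntegrableOn (fun ζ => planeWave ζ x * shiftedInv κ ε γ ζ) (shell d (κ / 2) (2 * κ)) := by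
  have h1 : IntegrableOn (shiftedInv κ ε γ) (shell d (κ / 2) (2 * κ)) :=
    (integrableOn_inv_shifted hd hκ.le (smul_ne_zero hε hγ) (2 * κ)).mono_set
      fun ζ hζ => ⟨by have := hζ.1; linarith, hζ.2⟩
  exact h1.bdd_mul (measurable_planeWave x).aestronglyMeasurable
    (Eventually.of_forall fun ζ => (norm_planeWave ζ x).le)

/-- For almost every direction `γ·ω ≠ 0`, so the radial lemmas apply with `y = 2εγ·ω`. Their bound
is uniform in `ω` and `ε`, and dominated convergence over the sphere gives the limit. -/
theorem shell_boundary {d : ℕ} [NeZero d] (hd : 2 ≤ d) {κ : ℝ} (hκ : 0 < κ) {γ : RVec d} (hγ : ‖γ‖ = 1) :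
    (∃ C, 0 ≤ C ∧ ∀ (ε : ℝ) (x : RVec d), 0 < ε → ε ≤ 1 →
      ‖∫ ζ in shell d (κ / 2) (2 * κ), planeWave ζ x * shiftedInv κ ε γ ζ‖ ≤ C * (1 + ‖x‖)) ∧
    ∀ x : RVec d, ∃ l, Tendsto (fun ε => ∫ ζ in shell d (κ / 2) (2 * κ), planeWave ζ x * shiftedInv κ ε γ ζ)
      (𝓝[>] 0) (𝓝 l) := by
  have hle : κ / 2 ≤ 2 * κ := by linarith
  have hγ0 : γ ≠ 0 := norm_pos_iff.1 (hγ ▸ one_pos)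
  set J : ℝ → RVec d → Sph d → ℂ := fun ε x ω => ∫ r in (κ / 2)..(2 * κ), radAmp d κ (inner ℝ (ω : RVec d) x) r *
    ((((r ^ 2 + κ ^ 2) / r ^ 2 : ℝ) : ℂ) *
      ((radW κ r : ℂ) + Complex.I * ((ε * (2 * inner ℝ γ (ω : RVec d)) : ℝ) : ℂ))⁻¹) with hJ
  have hm : ∀ (ε : ℝ) (x : RVec d), Measurable fun ζ : RVec d => planeWave ζ x * shiftedInv κ ε γ ζ := fun ε x =>
    (measurable_planeWave x).mul (measurable_shiftedInv κ ε γ)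
  have hcongr : ∀ (ε : ℝ) (x : RVec d) (ω : Sph d),
      ∫ r in (κ / 2)..(2 * κ), ((r ^ (d - 1) : ℝ) : ℂ) *
        (planeWave (r • (ω : RVec d)) x * shiftedInv κ ε γ (r • (ω : RVec d))) = J ε x ω := by
    intro ε x ω
    refine intervalIntegral.integral_congr fun r hr => ?_
    rw [Set.uIcc_of_le hle] at hr
    exact polar_shiftedInv hd (by linarith [hr.1]) γ x ω
  have hrep : ∀ (ε : ℝ) (x : RVec d), 0 < ε → ∫ ζ in shell d (κ / 2) (2 * κ), planeWave ζ x * shiftedInv κ ε γ ζ =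
      ∫ ω, J ε x ω ∂(sphMeas d) := by
    intro ε x hε
    rw [setIntegral_shell_eq (by positivity) hle (hm ε x).aestronglyMeasurable
      (integrableOn_planeWave_shiftedInv hd hκ hε.ne' hγ0 x)]
    simp_rw [hcongr]
  have hJm : ∀ (ε : ℝ) (x : RVec d), 0 < ε → AEStronglyMeasurable (J ε x) (sphMeas d) := by
    intro ε x hε
    have := ((integrableOn_shell (by positivity) (hm ε x).aestronglyMeasurable).1
      (integrableOn_planeWave_shiftedInv hd hκ hε.ne' hγ0 x)).integral_prod_left.aestronglyMeasurable
    refine this.congr (Eventually.of_forall fun ω => ?_)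
    have := hcongr ε x ω
    rw [intervalIntegral.integral_of_le hle] at this
    exact this
  obtain ⟨M, hM0, hM⟩ := exists_radAmp_bound d hκ
  obtain ⟨C, hC0, hC⟩ := exists_radial_bound hκ
  have hs : ∀ (ω : Sph d) (x : RVec d), |inner ℝ (ω : RVec d) x| ≤ ‖x‖ := by
    intro ω x
    have h1 : ‖(ω : RVec d)‖ = 1 := by simp
    simpa [h1] using abs_real_inner_le_norm (ω : RVec d) x
  have ht : ∀ ω : Sph d, |2 * inner ℝ γ (ω : RVec d)| ≤ 2 := by
    intro ω
    have h1 : ‖(ω : RVec d)‖ = 1 := by simp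
    have := abs_real_inner_le_norm γ (ω : RVec d)
    rw [hγ, h1] at this
    rw [abs_mul, abs_two]; linarith
  have hb : ∀ (ε : ℝ) (x : RVec d), 0 < ε → ε ≤ 1 → ∀ᵐ ω ∂(sphMeas d), ‖J ε x ω‖ ≤ C * (M * (1 + ‖x‖)) := by
    intro ε x hε hε1
    filter_upwards [sph_inner_ne_zero hγ0] with ω hω
    refine (hC _ _ (M * (1 + |inner ℝ (ω : RVec d) x|)) _ (hasDerivAt_radAmp d hκ _) (continuous_radAmpDeriv d hκ _)
      (fun r h1 h2 => (hM _ r h1 h2).1) (fun r h1 h2 => (hM _ r h1 h2).2)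
      (mul_ne_zero hε.ne' (mul_ne_zero two_ne_zero hω)) ?_).trans ?_
    · rw [abs_mul, abs_of_pos hε]
      exact (mul_le_of_le_one_left (abs_nonneg _) hε1).trans (ht ω)
    · gcongr
      exact hs ω x
  constructor
  · refine ⟨C * M * (sphMeas d).real Set.univ, by positivity, fun ε x hε hε1 => ?_⟩
    rw [hrep ε x hε]
    refine (norm_integral_le_of_norm_le_const (hb ε x hε hε1)).trans (le_of_eq ?_)
    ring
  · intro x
    have hL : ∀ ω : Sph d, ∃ l, inner ℝ γ (ω : RVec d) ≠ 0 → Tendsto (fun ε => J ε x ω) (𝓝[>] 0) (𝓝 l) := by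
      intro ω
      by_cases hω : inner ℝ γ (ω : RVec d) = 0
      · exact ⟨0, fun h => absurd hω h⟩
      · obtain ⟨l, hl⟩ := tendsto_radial hκ (mul_ne_zero two_ne_zero hω) (ht ω)
          (hasDerivAt_radAmp d hκ (inner ℝ (ω : RVec d) x)) (continuous_radAmpDeriv d hκ _)
        exact ⟨l, fun _ => hl⟩
    choose L hL using hL
    refine ⟨∫ ω, L ω ∂(sphMeas d), ?_⟩
    have : Tendsto (fun ε => ∫ ω, J ε x ω ∂(sphMeas d)) (𝓝[>] 0) (𝓝 (∫ ω, L ω ∂(sphMeas d))) := by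
      refine tendsto_integral_filter_of_dominated_convergence (fun _ => C * (M * (1 + ‖x‖))) ?_ ?_
        (integrable_const _) ?_
      · filter_upwards [self_mem_nhdsWithin] with ε hε using hJm ε x hε
      · filter_upwards [Ioc_mem_nhdsGT_zero] with ε hε using hb ε x hε.1 hε.2
      · filter_upwards [sph_inner_ne_zero hγ0] with ω hω using hL ω hω
    refine this.congr' ?_
    filter_upwards [self_mem_nhdsWithin] with ε hε
    exact (hrep ε x hε).symm

theorem shiftedInv_eq {d : ℕ} {k γ : RVec d} (hk : inner ℝ k γ = 0) (ε : ℝ) (ξ : RVec d) :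
    shiftedInv ‖k‖ ε γ (ξ + k) = (symb (shift k γ ε) ξ)⁻¹ := by
  have h : inner ℝ (imVec (shift k γ ε)) (reVec (shift k γ ε)) = 0 := by
    rw [imVec_shift, reVec_shift, real_inner_smul_left, real_inner_comm, hk, mul_zero]
  have := symb_sub_re h (ξ + k)
  rw [reVec_shift, imVec_shift, add_sub_cancel_right] at this
  rw [this, shiftedInv]

/-- Away from the critical sphere the symbol is bounded below, uniformly in the shift. -/
theorem norm_shiftedInv_le {d : ℕ} {κ c : ℝ} (hc : 0 < c) {ζ : RVec d} (h : c ≤ |‖ζ‖ ^ 2 - κ ^ 2|) (ε : ℝ) (γ : RVec d) :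
    ‖shiftedInv κ ε γ ζ‖ ≤ c⁻¹ := by
  rw [shiftedInv, norm_inv]
  refine inv_anti₀ hc (h.trans ?_)
  have := Complex.abs_re_le_norm (((‖ζ‖ ^ 2 - κ ^ 2 : ℝ) : ℂ) + Complex.I * ((2 * inner ℝ (ε • γ) ζ : ℝ) : ℂ))
  simpa [-Complex.ofReal_sub, -Complex.ofReal_mul] using this

theorem tendsto_shiftedInv {d : ℕ} {κ : ℝ} {ζ : RVec d} (h : ‖ζ‖ ^ 2 - κ ^ 2 ≠ 0) (γ : RVec d) :
    Tendsto (fun ε => shiftedInv κ ε γ ζ) (𝓝[>] 0) (𝓝 (((‖ζ‖ ^ 2 - κ ^ 2 : ℝ) : ℂ)⁻¹)) := by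
  refine Tendsto.mono_left ?_ nhdsWithin_le_nhds
  unfold shiftedInv
  refine Tendsto.inv₀ ?_ (by exact_mod_cast h)
  have : Continuous fun ε : ℝ => ((‖ζ‖ ^ 2 - κ ^ 2 : ℝ) : ℂ) + Complex.I * ((2 * inner ℝ (ε • γ) ζ : ℝ) : ℂ) := by
    fun_prop
  simpa using this.tendsto 0

/-- The worst case is the inner edge `|ζ| = κ/2`, where the difference is `κ² - κ²/4`. -/
theorem abs_sq_sub_ge {d : ℕ} {κ : ℝ} (hκ : 0 < κ) {ζ : RVec d} (h : ζ ∉ shell d (κ / 2) (2 * κ)) :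
    3 / 4 * κ ^ 2 ≤ |‖ζ‖ ^ 2 - κ ^ 2| := by
  have h0 := norm_nonneg ζ
  by_cases h1 : κ / 2 < ‖ζ‖
  · have h2 : 2 * κ < ‖ζ‖ := lt_of_not_ge fun h2 => h ⟨h1, h2⟩
    exact le_trans (by nlinarith) (le_abs_self _)
  · exact le_trans (by nlinarith) (neg_le_abs _)

/-- The ball splits into a translated shell `S` around the critical sphere `|ξ + k| = |k|`, treated
by `shell_boundary`, and a rest `T` on which the symbol is bounded below uniformly in `ε`. The
condition on `p` puts `S`, where `|ξ| ≤ 3|k|`, inside the ball. -/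
theorem inner_boundary {d : ℕ} [NeZero d] (hd : 2 ≤ d) {k γ : RVec d} (hk0 : k ≠ 0) (hγ : ‖γ‖ = 1)
    (hkγ : inner ℝ k γ = 0) {p : ℝ} (hp : 4 * (‖k‖ + 1) ≤ p) :
    (∃ C, 0 ≤ C ∧ ∀ (ε : ℝ) (x : RVec d), 0 < ε → ε ≤ 1 →
      ‖∫ ξ in Metric.closedBall (0 : RVec d) p, planeWave ξ x * (symb (shift k γ ε) ξ)⁻¹‖ ≤ C * (1 + ‖x‖)) ∧
    ∀ x : RVec d, ∃ l, Tendsto (fun ε => ∫ ξ in Metric.closedBall (0 : RVec d) p,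
      planeWave ξ x * (symb (shift k γ ε) ξ)⁻¹) (𝓝[>] 0) (𝓝 l) := by
  have hκ : 0 < ‖k‖ := norm_pos_iff.2 hk0
  have hγ0 : γ ≠ 0 := norm_pos_iff.1 (hγ ▸ one_pos)
  set S : Set (RVec d) := (fun ξ => ξ + k) ⁻¹' shell d (‖k‖ / 2) (2 * ‖k‖) with hS
  have hSm : MeasurableSet S := (measurableSet_shell d _ _).preimage (measurable_add_const k)
  have hSB : S ⊆ Metric.closedBall 0 p := by
    intro ξ hξ
    rw [mem_closedBall_zero_iff]
    have h1 : ‖ξ + k‖ ≤ 2 * ‖k‖ := hξ.2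
    have h2 : ‖ξ‖ ≤ ‖ξ + k‖ + ‖k‖ := by simpa using norm_sub_le (ξ + k) k
    linarith
  set T : Set (RVec d) := Metric.closedBall 0 p \ S with hT
  have hTm : MeasurableSet T := Metric.isClosed_closedBall.measurableSet.diff hSm
  have hTv : volume T < ⊤ := (measure_mono Set.sdiff_subset).trans_lt measure_closedBall_lt_top
  have hmeas : ∀ (ε : ℝ) (x : RVec d), Measurable fun ξ : RVec d => planeWave ξ x * (symb (shift k γ ε) ξ)⁻¹ :=
    fun ε x => (measurable_planeWave x).mul (continuous_symb _).measurable.inv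
  set c : ℝ := 3 / 4 * ‖k‖ ^ 2 with hc
  have hc0 : 0 < c := by positivity
  have hTb : ∀ (ε : ℝ) (x ξ : RVec d), ξ ∈ T → ‖planeWave ξ x * (symb (shift k γ ε) ξ)⁻¹‖ ≤ c⁻¹ := by
    intro ε x ξ hξ
    rw [norm_mul, norm_planeWave, one_mul, ← shiftedInv_eq hkγ]
    exact norm_shiftedInv_le hc0 (abs_sq_sub_ge hκ hξ.2) ε γ
  have hIS : ∀ (ε : ℝ) (x : RVec d), ∫ ξ in S, planeWave ξ x * (symb (shift k γ ε) ξ)⁻¹ =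
      planeWave (-k) x * ∫ ζ in shell d (‖k‖ / 2) (2 * ‖k‖), planeWave ζ x * shiftedInv ‖k‖ ε γ ζ := by
    intro ε x
    rw [← integral_const_mul]
    rw [← (measurePreserving_add_right (volume : Measure (RVec d)) k).setIntegral_preimage_emb
      (measurableEmbedding_addRight k) _ (shell d (‖k‖ / 2) (2 * ‖k‖))]
    refine setIntegral_congr_fun hSm fun ξ _ => ?_
    rw [shiftedInv_eq hkγ, ← mul_assoc, ← planeWave_add_left]
    simp
  have hISi : ∀ (ε : ℝ) (x : RVec d), 0 < ε → IntegrableOn (fun ξ => planeWave ξ x * (symb (shift k γ ε) ξ)⁻¹) S := by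
    intro ε x hε
    have h1 := ((measurePreserving_add_right (volume : Measure (RVec d)) k).integrableOn_comp_preimage
      (measurableEmbedding_addRight k)).2 (integrableOn_planeWave_shiftedInv hd hκ hε.ne' hγ0 x)
    have h2 : IntegrableOn (fun ξ => planeWave (-k) x * (planeWave (ξ + k) x * shiftedInv ‖k‖ ε γ (ξ + k))) S :=
      h1.const_mul (planeWave (-k) x)
    refine h2.congr_fun (fun ξ _ => ?_) hSm
    dsimp only
    rw [shiftedInv_eq hkγ, ← mul_assoc, ← planeWave_add_left]
    simp
  have hITi : ∀ (ε : ℝ) (x : RVec d), IntegrableOn (fun ξ => planeWave ξ x * (symb (shift k γ ε) ξ)⁻¹) T := by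
    intro ε x
    refine Measure.integrableOn_of_bounded (M := c⁻¹) hTv.ne (hmeas ε x).aestronglyMeasurable ?_
    filter_upwards [ae_restrict_mem hTm] with ξ hξ using hTb ε x ξ hξ
  have hsplit : ∀ (ε : ℝ) (x : RVec d), 0 < ε → ∫ ξ in Metric.closedBall (0 : RVec d) p,
      planeWave ξ x * (symb (shift k γ ε) ξ)⁻¹ =
      planeWave (-k) x * (∫ ζ in shell d (‖k‖ / 2) (2 * ‖k‖), planeWave ζ x * shiftedInv ‖k‖ ε γ ζ) +
      ∫ ξ in T, planeWave ξ x * (symb (shift k γ ε) ξ)⁻¹ := by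
    intro ε x hε
    rw [← hIS, ← setIntegral_union Set.disjoint_sdiff_right hTm (hISi ε x hε) (hITi ε x),
      Set.union_sdiff_cancel hSB]
  obtain ⟨⟨C, hC0, hC⟩, hlim⟩ := shell_boundary hd hκ hγ
  constructor
  · refine ⟨C + c⁻¹ * volume.real T, by positivity, fun ε x hε hε1 => ?_⟩
    rw [hsplit ε x hε]
    have b1 : ‖∫ ξ in T, planeWave ξ x * (symb (shift k γ ε) ξ)⁻¹‖ ≤ c⁻¹ * volume.real T :=
      norm_setIntegral_le_of_norm_le_const hTv (hTb ε x)
    have b2 : c⁻¹ * volume.real T ≤ c⁻¹ * volume.real T * (1 + ‖x‖) :=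
      le_mul_of_one_le_right (by positivity) (by linarith [norm_nonneg x])
    refine (norm_add_le _ _).trans ?_
    rw [norm_mul, norm_planeWave, one_mul]
    linarith [hC ε x hε hε1]
  · intro x
    obtain ⟨l, hl⟩ := hlim x
    have h3 : Tendsto (fun ε => ∫ ξ in T, planeWave ξ x * (symb (shift k γ ε) ξ)⁻¹) (𝓝[>] 0)
        (𝓝 (∫ ξ in T, planeWave ξ x * ((‖ξ + k‖ ^ 2 - ‖k‖ ^ 2 : ℝ) : ℂ)⁻¹)) := by
      refine tendsto_integral_filter_of_dominated_convergence (fun _ => c⁻¹)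
        (Eventually.of_forall fun ε => (hmeas ε x).aestronglyMeasurable) ?_
        (integrableOn_const hTv.ne) ?_
      · refine Eventually.of_forall fun ε => ?_
        filter_upwards [ae_restrict_mem hTm] with ξ hξ using hTb ε x ξ hξ
      · filter_upwards [ae_restrict_mem hTm] with ξ hξ
        simp_rw [← shiftedInv_eq hkγ]
        refine (tendsto_shiftedInv ?_ γ).const_mul _
        have := abs_sq_sub_ge hκ hξ.2
        exact abs_pos.1 (hc0.trans_le this)
    refine ⟨_, ((hl.const_mul (planeWave (-k) x)).add h3).congr' ?_⟩
    filter_upwards [self_mem_nhdsWithin] with ε hε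
    exact (hsplit ε x hε).symm

/-! ### Existence and bounds of the Green functions -/

theorem greenTrunc_split {d : ℕ} [NeZero d] (hd : 2 ≤ d) {k : CVec d}
    (h : inner ℝ (imVec k) (reVec k) = 0) (hb : imVec k ≠ 0) {p R : ℝ} (hpR : p ≤ R) (x : RVec d) :
    greenTrunc k R x = -fourierConst d * ((∫ ξ in Metric.closedBall (0 : RVec d) p, planeWave ξ x * (symb k ξ)⁻¹) +
      shellInt (fun ξ => (symb k ξ)⁻¹) p R x) := by
  have hi := integrableOn_planeWave_mul (integrableOn_inv_symb hd h hb R) x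
  have hU : Metric.closedBall (0 : RVec d) R = Metric.closedBall 0 p ∪ shell d p R := by
    ext ξ
    simp only [Set.mem_union, mem_closedBall_zero_iff, shell, Set.mem_ofPred_eq]
    constructor
    · intro h1
      rcases le_or_gt ‖ξ‖ p with h2 | h2
      · exact Or.inl h2
      · exact Or.inr ⟨h2, h1⟩
    · rintro (h1 | h1)
      · exact h1.trans hpR
      · exact h1.2
  have hdisj : Disjoint (Metric.closedBall (0 : RVec d) p) (shell d p R) := by
    rw [Set.disjoint_left]
    intro ξ h1 h2
    rw [mem_closedBall_zero_iff] at h1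
    exact absurd h2.1 (not_lt.2 h1)
  simp only [greenTrunc, shellInt, div_eq_mul_inv]
  rw [hU] at hi ⊢
  rw [setIntegral_union hdisj (measurableSet_shell d p R) (hi.mono_set Set.subset_union_left)
    (hi.mono_set Set.subset_union_right)]

/-- The radius beyond which the symbol is dominated by `|ξ|²`. -/
noncomputable def outerRadius {d : ℕ} (k : CVec d) : ℝ := 4 * (‖reVec k‖ + ‖imVec k‖) + 1

theorem one_le_outerRadius {d : ℕ} (k : CVec d) : 1 ≤ outerRadius k := by
  have := norm_nonneg (reVec k); have := norm_nonneg (imVec k)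
  unfold outerRadius; linarith

theorem le_outerRadius {d : ℕ} (k : CVec d) : 4 * (‖reVec k‖ + ‖imVec k‖) ≤ outerRadius k := by
  unfold outerRadius; linarith

/-- Once `R` exceeds `outerRadius k`, only the outer shell depends on `R`. The existence of a limit
also identifies it with the `limUnder` that defines `green`. -/
theorem tendsto_greenTrunc {d : ℕ} [NeZero d] (hd : d = 2 ∨ d = 3) {k : CVec d}
    (h : inner ℝ (imVec k) (reVec k) = 0) (hb : imVec k ≠ 0) {x : RVec d} (hx : x ≠ 0) :
    Tendsto (fun R => greenTrunc k R x) atTop (𝓝 (green k x)) := by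
  obtain ⟨l, hl⟩ := outer_tendsto hd (one_le_outerRadius k) (le_outerRadius k) hx
  refine tendsto_nhds_limUnder ⟨_, ((hl.const_add (∫ ξ in Metric.closedBall (0 : RVec d) (outerRadius k),
    planeWave ξ x * (symb k ξ)⁻¹)).const_mul (-fourierConst d)).congr' ?_⟩
  filter_upwards [eventually_ge_atTop (outerRadius k)] with R hR
  exact (greenTrunc_split (by omega) h hb hR x).symm

theorem exists_greenTrunc_bound {d : ℕ} [NeZero d] (hd : d = 2 ∨ d = 3) {k : CVec d}
    (h : inner ℝ (imVec k) (reVec k) = 0) (hb : imVec k ≠ 0) :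
    ∃ C, 0 ≤ C ∧ ∀ R, outerRadius k ≤ R → ∀ x : RVec d, x ≠ 0 → ‖greenTrunc k R x‖ ≤ C * sing d x := by
  obtain ⟨C, hC0, hC⟩ := outer_bound hd (one_le_outerRadius k)
  obtain ⟨I, hI⟩ : ∃ I : ℝ, I = ∫ ξ in Metric.closedBall (0 : RVec d) (outerRadius k), ‖(symb k ξ)⁻¹‖ := ⟨_, rfl⟩
  have hI0 : 0 ≤ I := hI ▸ integral_nonneg fun ξ => norm_nonneg _
  refine ⟨‖-fourierConst d‖ * (I + C), by positivity, fun R hR x hx => ?_⟩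
  rw [greenTrunc_split (by omega) h hb hR x, norm_mul, mul_assoc]
  refine mul_le_mul_of_nonneg_left ?_ (norm_nonneg _)
  have b1 : ‖∫ ξ in Metric.closedBall (0 : RVec d) (outerRadius k), planeWave ξ x * (symb k ξ)⁻¹‖ ≤ I := by
    refine (norm_integral_le_integral_norm _).trans ?_
    simp_rw [norm_mul, norm_planeWave, one_mul]
    exact hI.ge
  have b2 : I ≤ I * sing d x := le_mul_of_one_le_right hI0 (one_le_sing d x)
  refine (norm_add_le _ _).trans ?_
  rw [add_mul]
  exact add_le_add (b1.trans b2) (hC k (le_outerRadius k) R hR x hx)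

/-! ### Majorants of the Green functions, uniform in the regularisation. -/

/-- A locally integrable weight of moderate growth dominating the Green functions. -/
noncomputable def weight (d : ℕ) (x : RVec d) : ℝ := (1 + ‖x‖) * sing d x

theorem sing_le_weight (d : ℕ) (x : RVec d) : sing d x ≤ weight d x :=
  le_mul_of_one_le_left (zero_le_one.trans (one_le_sing d x)) (by linarith [norm_nonneg x])

theorem one_add_norm_le_weight (d : ℕ) (x : RVec d) : 1 + ‖x‖ ≤ weight d x :=
  le_mul_of_one_le_right (by positivity) (one_le_sing d x)

theorem weight_nonneg (d : ℕ) (x : RVec d) : 0 ≤ weight d x :=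
  (zero_le_one.trans (one_le_sing d x)).trans (sing_le_weight d x)

theorem exists_greenTrunc_weight {d : ℕ} [NeZero d] (hd : d = 2 ∨ d = 3) {k : CVec d}
    (h : inner ℝ (imVec k) (reVec k) = 0) (hb : imVec k ≠ 0) :
    ∃ C, 0 ≤ C ∧ ∀ R, outerRadius k ≤ R → ∀ x : RVec d, x ≠ 0 → ‖greenTrunc k R x‖ ≤ C * weight d x := by
  obtain ⟨C, hC0, hC⟩ := exists_greenTrunc_bound hd h hb
  exact ⟨C, hC0, fun R hR x hx => (hC R hR x hx).trans (mul_le_mul_of_nonneg_left (sing_le_weight d x) hC0)⟩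

theorem exists_green_weight {d : ℕ} [NeZero d] (hd : d = 2 ∨ d = 3) {k : CVec d}
    (h : inner ℝ (imVec k) (reVec k) = 0) (hb : imVec k ≠ 0) :
    ∃ C, 0 ≤ C ∧ ∀ x : RVec d, x ≠ 0 → ‖green k x‖ ≤ C * weight d x := by
  obtain ⟨C, hC0, hC⟩ := exists_greenTrunc_weight hd h hb
  refine ⟨C, hC0, fun x hx => le_of_tendsto (tendsto_greenTrunc hd h hb hx).norm ?_⟩
  filter_upwards [eventually_ge_atTop (outerRadius k)] with R hR using hC R hR x hx

theorem shift_orth {d : ℕ} {k γ : RVec d} (hkγ : inner ℝ k γ = 0) (ε : ℝ) :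
    inner ℝ (imVec (shift k γ ε)) (reVec (shift k γ ε)) = 0 := by
  rw [imVec_shift, reVec_shift, real_inner_smul_left, real_inner_comm, hkγ, mul_zero]

theorem imVec_shift_ne {d : ℕ} {k γ : RVec d} (hγ : ‖γ‖ = 1) {ε : ℝ} (hε : 0 < ε) :
    imVec (shift k γ ε) ≠ 0 := by
  rw [imVec_shift]
  exact smul_ne_zero hε.ne' (norm_pos_iff.1 (hγ ▸ one_pos))

/-- The splitting radius `4(|k| + 1)` serves all `0 < ε ≤ 1`, so the inner and the outer part can
each be passed to the limit at a fixed radius. -/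
theorem tendsto_green_shift {d : ℕ} [NeZero d] (hd : d = 2 ∨ d = 3) {k γ : RVec d} (hk : k ≠ 0) (hγ : ‖γ‖ = 1)
    (hkγ : inner ℝ k γ = 0) {x : RVec d} (hx : x ≠ 0) :
    Tendsto (fun ε : ℝ => green (shift k γ ε) x) (𝓝[>] 0) (𝓝 (greenBdry k γ x)) := by
  have hp1 : 1 ≤ 4 * (‖k‖ + 1) := by linarith [norm_nonneg k]
  obtain ⟨L, hL, l, hl⟩ := outer_boundary hd hp1 hγ le_rfl hx
  obtain ⟨m, hm⟩ := (inner_boundary (by omega) hk hγ hkγ le_rfl).2 x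
  refine tendsto_nhds_limUnder ⟨_, ((hm.add hl).const_mul (-fourierConst d)).congr' ?_⟩
  filter_upwards [Ioc_mem_nhdsGT_zero] with ε hε
  refine tendsto_nhds_unique ?_ (tendsto_greenTrunc hd (shift_orth hkγ ε) (imVec_shift_ne hγ hε.1) hx)
  refine (((hL ε hε.1 hε.2).const_add (∫ ξ in Metric.closedBall (0 : RVec d) (4 * (‖k‖ + 1)),
    planeWave ξ x * (symb (shift k γ ε) ξ)⁻¹)).const_mul (-fourierConst d)).congr' ?_
  filter_upwards [eventually_ge_atTop (4 * (‖k‖ + 1))] with R hR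
  exact (greenTrunc_split (by omega) (shift_orth hkγ ε) (imVec_shift_ne hγ hε.1) hR x).symm

theorem exists_green_shift_weight {d : ℕ} [NeZero d] (hd : d = 2 ∨ d = 3) {k γ : RVec d} (hk : k ≠ 0) (hγ : ‖γ‖ = 1)
    (hkγ : inner ℝ k γ = 0) : ∃ C, 0 ≤ C ∧ ∀ (ε : ℝ) (x : RVec d), 0 < ε → ε ≤ 1 → x ≠ 0 →
      ‖green (shift k γ ε) x‖ ≤ C * weight d x := by
  have hp1 : 1 ≤ 4 * (‖k‖ + 1) := by linarith [norm_nonneg k]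
  obtain ⟨C1, hC1, h1⟩ := outer_bound hd hp1
  obtain ⟨C2, hC2, h2⟩ := (inner_boundary (by omega) hk hγ hkγ le_rfl).1
  refine ⟨‖-fourierConst d‖ * (C2 + C1), by positivity, fun ε x hε hε1 hx => ?_⟩
  refine le_of_tendsto (tendsto_greenTrunc hd (shift_orth hkγ ε) (imVec_shift_ne hγ hε) hx).norm ?_
  filter_upwards [eventually_ge_atTop (4 * (‖k‖ + 1))] with R hR
  rw [greenTrunc_split (by omega) (shift_orth hkγ ε) (imVec_shift_ne hγ hε) hR x, norm_mul, mul_assoc]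
  refine mul_le_mul_of_nonneg_left ?_ (norm_nonneg _)
  refine (norm_add_le _ _).trans ?_
  rw [add_mul]
  refine add_le_add ((h2 ε x hε hε1).trans ?_) ((h1 _ (shift_norm_le hγ hε hε1 le_rfl) R hR x hx).trans ?_)
  · exact mul_le_mul_of_nonneg_left (one_add_norm_le_weight d x) hC2
  · exact mul_le_mul_of_nonneg_left (sing_le_weight d x) hC1

theorem exists_greenBdry_weight {d : ℕ} [NeZero d] (hd : d = 2 ∨ d = 3) {k γ : RVec d} (hk : k ≠ 0) (hγ : ‖γ‖ = 1)
    (hkγ : inner ℝ k γ = 0) : ∃ C, 0 ≤ C ∧ ∀ x : RVec d, x ≠ 0 → ‖greenBdry k γ x‖ ≤ C * weight d x := by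
  obtain ⟨C, hC0, hC⟩ := exists_green_shift_weight hd hk hγ hkγ
  refine ⟨C, hC0, fun x hx => le_of_tendsto (tendsto_green_shift hd hk hγ hkγ hx).norm ?_⟩
  filter_upwards [Ioc_mem_nhdsGT_zero] with ε hε using hC ε x hε.1 hε.2 hx

theorem measurable_weight (d : ℕ) : Measurable (weight d) := by
  unfold weight sing; fun_prop

/-- The singular part of `weight` is integrable. -/
theorem integrable_norm_rpow_unit (d : ℕ) [NeZero d] :
    Integrable fun y : RVec d => (Set.Iic (1:ℝ)).indicator (fun r => r ^ (-((d : ℝ) - 3 / 2))) ‖y‖ := by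
  have hd0 : d ≠ 0 := NeZero.ne d
  have : Nontrivial (RVec d) := by
    have : Nonempty (Fin d) := ⟨⟨0, Nat.pos_of_ne_zero hd0⟩⟩
    exact inferInstance
  rw [integrable_fun_norm_addHaar]
  -- The exponent is that of the radial density: `r^(d-1) · r^(-(d - 3/2)) = r^(1/2)`.
  have h1 : IntegrableOn (fun r : ℝ => r ^ (1/2 : ℝ)) (Set.Ioc 0 1) := by
    have := intervalIntegral.intervalIntegrable_rpow' (a := 0) (b := 1) (r := 1/2) (by norm_num)
    rwa [intervalIntegrable_iff_integrableOn_Ioc_of_le zero_le_one] at this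
  have h2 := (integrable_indicator_iff measurableSet_Ioc).2 h1
  refine h2.integrableOn.congr ?_
  filter_upwards [ae_restrict_mem measurableSet_Ioi] with r hr
  have hr0 : 0 < r := hr
  by_cases h3 : r ≤ 1
  · rw [Set.indicator_of_mem (show r ∈ Set.Ioc 0 1 from ⟨hr0, h3⟩), Set.indicator_of_mem (show r ∈ Set.Iic 1 from h3),
      smul_eq_mul, ← Real.rpow_natCast, ← Real.rpow_add hr0]
    congr 1
    rw [finrank_euclideanSpace_fin, Nat.cast_sub (Nat.one_le_iff_ne_zero.2 hd0)]
    push_cast; ring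
  · rw [Set.indicator_of_notMem (fun h4 => h3 h4.2), Set.indicator_of_notMem (show r ∉ Set.Iic (1:ℝ) from h3), smul_zero]

theorem weight_le {d : ℕ} (hd : 2 ≤ d) (y : RVec d) : weight d y ≤ 2 * (1 + ‖y‖) +
    2 * (Set.Iic (1:ℝ)).indicator (fun r => r ^ (-((d : ℝ) - 3 / 2))) ‖y‖ := by
  have h0 := norm_nonneg y
  have hs : 0 ≤ (d : ℝ) - 3 / 2 := by
    have : (2:ℝ) ≤ d := by exact_mod_cast hd
    linarith
  unfold weight sing
  have h2 : 0 ≤ ‖y‖ ^ (-((d : ℝ) - 3 / 2)) := by positivity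
  by_cases h1 : ‖y‖ ≤ 1
  · rw [Set.indicator_of_mem (show ‖y‖ ∈ Set.Iic 1 from h1)]
    nlinarith
  · rw [Set.indicator_of_notMem (show ‖y‖ ∉ Set.Iic (1:ℝ) from h1)]
    have : ‖y‖ ^ (-((d : ℝ) - 3 / 2)) ≤ 1 :=
      Real.rpow_le_one_of_one_le_of_nonpos (by linarith) (by linarith)
    nlinarith

/-- The singular part of the weight is integrable and meets a bounded function; the linearly growing
part is absorbed by Schwartz decay. -/
theorem integrable_weight_mul {d : ℕ} [NeZero d] (hd : 2 ≤ d) (z : RVec d) (φ : 𝓢(RVec d, ℂ)) :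
    Integrable fun x => weight d (x - z) * ‖φ x‖ := by
  obtain ⟨M, hM⟩ : ∃ M, ∀ x, ‖φ x‖ ≤ M := by
    obtain ⟨M, hM⟩ := φ.decay 0 0
    exact ⟨M, fun x => by simpa using hM.2 x⟩
  have hM0 : 0 ≤ M := (norm_nonneg _).trans (hM 0)
  have h1 : Integrable fun x => ‖x‖ * ‖φ x‖ := by
    simpa using SchwartzMap.integrable_pow_mul volume φ 1
  have h2 : Integrable fun x => 2 * ((1 + ‖z‖) * ‖φ x‖ + ‖x‖ * ‖φ x‖) :=
    ((φ.integrable.norm.const_mul _).add h1).const_mul 2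
  have h3 : Integrable fun x : RVec d => 2 * M * (Set.Iic (1:ℝ)).indicator (fun r => r ^ (-((d : ℝ) - 3 / 2))) ‖x - z‖ :=
    ((integrable_norm_rpow_unit d).comp_sub_right z).const_mul _
  refine (h2.add h3).mono' ?_ (Eventually.of_forall fun x => ?_)
  · have := (measurable_weight d).comp (measurable_sub_const z)
    exact (this.mul φ.continuous.norm.measurable).aestronglyMeasurable
  · have hi0 : 0 ≤ (Set.Iic (1:ℝ)).indicator (fun r => r ^ (-((d : ℝ) - 3 / 2))) ‖x - z‖ := by
      by_cases h1 : ‖x - z‖ ≤ 1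
      · rw [Set.indicator_of_mem (show ‖x - z‖ ∈ Set.Iic 1 from h1)]; positivity
      · rw [Set.indicator_of_notMem (show ‖x - z‖ ∉ Set.Iic (1:ℝ) from h1)]
    have hw := weight_le hd (x - z)
    have hn := norm_sub_le x z
    have hp := norm_nonneg (φ x)
    rw [Real.norm_of_nonneg (mul_nonneg (weight_nonneg d _) hp)]
    simp only [Pi.add_apply]
    have a1 := mul_le_mul_of_nonneg_right hw hp
    have a2 := mul_le_mul_of_nonneg_left (hM x) hi0
    have a3 := mul_le_mul_of_nonneg_right hn hp
    nlinarith

/-! ### Green functions as tempered distributions -/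

open scoped FourierTransform in
-- The sign and the factor `2π` of the kernel `e^{-2πi⟨x,η⟩}` are absorbed by evaluating at `η =
-- -ξ/(2π)`.
theorem integral_planeWave_eq_fourier {d : ℕ} (φ : 𝓢(RVec d, ℂ)) (ξ : RVec d) :
    ∫ x, planeWave ξ x * φ x = (𝓕 φ : 𝓢(RVec d, ℂ)) ((-(2 * Real.pi)⁻¹) • ξ) := by
  rw [SchwartzMap.fourier_coe, Real.fourier_eq']
  congr 1; ext x
  rw [smul_eq_mul, planeWave, real_inner_smul_right, real_inner_comm ξ, mul_comm _ Complex.I]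
  congr 4
  have := Real.pi_pos
  field_simp

theorem integrable_integral_planeWave {d : ℕ} (φ : 𝓢(RVec d, ℂ)) :
    Integrable fun ξ : RVec d => ∫ x, planeWave ξ x * φ x := by
  simp_rw [integral_planeWave_eq_fourier]
  refine Integrable.comp_smul (SchwartzMap.integrable _) ?_
  have := Real.pi_pos
  exact neg_ne_zero.2 (by positivity)

theorem exists_integral_planeWave_bound {d : ℕ} (φ : 𝓢(RVec d, ℂ)) :
    ∃ M, ∀ ξ : RVec d, ‖∫ x, planeWave ξ x * φ x‖ ≤ M := by
  refine ⟨∫ x, ‖φ x‖, fun ξ => (norm_integral_le_integral_norm _).trans (le_of_eq ?_)⟩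
  simp_rw [norm_mul, norm_planeWave, one_mul]

open scoped FourierTransform ContDiff in
/-- Every smooth compactly supported function is of the form `ξ ↦ ∫ e^{iξx} φ(x) dx`. -/
theorem exists_integral_planeWave_eq {d : ℕ} {χ : RVec d → ℝ} (hχ : ContDiff ℝ ∞ χ) (hc : HasCompactSupport χ) :
    ∃ φ : 𝓢(RVec d, ℂ), ∀ ξ : RVec d, ∫ x, planeWave ξ x * φ x = (χ ξ : ℂ) := by
  have hpi := Real.pi_pos
  have h1 : ContDiff ℝ ∞ fun η : RVec d => ((χ ((-(2 * Real.pi)) • η) : ℝ) : ℂ) :=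
    Complex.ofRealCLM.contDiff.comp (hχ.comp (contDiff_const_smul _))
  have h2 : HasCompactSupport fun η : RVec d => ((χ ((-(2 * Real.pi)) • η) : ℝ) : ℂ) := by
    have h3 : HasCompactSupport fun η : RVec d => χ ((-(2 * Real.pi)) • η) :=
      hc.comp_smul (neg_ne_zero.2 (by positivity))
    exact h3.comp_left (g := fun t : ℝ => (t : ℂ)) Complex.ofReal_zero
  refine ⟨𝓕⁻ (h2.toSchwartzMap h1), fun ξ => ?_⟩
  rw [integral_planeWave_eq_fourier, FourierTransform.fourier_fourierInv_eq]
  change ((χ ((-(2 * Real.pi)) • (-(2 * Real.pi)⁻¹) • ξ) : ℝ) : ℂ) = _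
  rw [smul_smul, neg_mul_neg, mul_inv_cancel₀ (by positivity), one_smul]

theorem integrable_planeWave_div_symb {d : ℕ} [NeZero d] (hd : 2 ≤ d) {k : CVec d}
    (h : inner ℝ (imVec k) (reVec k) = 0) (hb : imVec k ≠ 0) (z : RVec d) (φ : 𝓢(RVec d, ℂ)) :
    Integrable fun ξ => planeWave (-ξ) z * (∫ x, planeWave ξ x * φ x) / symb k ξ := by
  obtain ⟨M, hM⟩ := exists_integral_planeWave_bound φ
  refine integrable_div_symb hd h hb (C := M) ?_ fun ξ => ?_
  · exact (integrable_integral_planeWave φ).bdd_mul (c := 1)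
      ((measurable_planeWave z).comp measurable_neg).aestronglyMeasurable
      (Eventually.of_forall fun ξ => (norm_planeWave _ _).le)
  · rw [norm_mul, norm_planeWave, one_mul]; exact hM ξ

theorem integrable_prod_planeWave {d : ℕ} [NeZero d] (hd : 2 ≤ d) {k : CVec d}
    (h : inner ℝ (imVec k) (reVec k) = 0) (hb : imVec k ≠ 0) (R : ℝ) (z : RVec d) (φ : 𝓢(RVec d, ℂ)) :
    Integrable (Function.uncurry fun x ξ : RVec d => planeWave ξ (x - z) / symb k ξ * φ x)
      (volume.prod (volume.restrict (Metric.closedBall 0 R))) := by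
  have h1 := (φ.integrable (μ := volume)).mul_prod (integrableOn_inv_symb hd h hb R)
  have h2 : Continuous fun v : RVec d × RVec d => planeWave v.2 (v.1 - z) :=
    continuous_planeWave.comp (continuous_snd.prodMk (continuous_fst.sub continuous_const))
  refine (h1.bdd_mul (c := 1) h2.aestronglyMeasurable (Eventually.of_forall fun v => (norm_planeWave _ _).le)).congr
    (Eventually.of_forall fun v => ?_)
  simp only [Function.uncurry, div_eq_mul_inv]
  ring

theorem aestronglyMeasurable_greenTrunc_mul {d : ℕ} [NeZero d] (hd : 2 ≤ d) {k : CVec d}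
    (h : inner ℝ (imVec k) (reVec k) = 0) (hb : imVec k ≠ 0) (R : ℝ) (z : RVec d) (φ : 𝓢(RVec d, ℂ)) :
    AEStronglyMeasurable (fun x => greenTrunc k R (x - z) * φ x) volume := by
  have h1 := (integrable_prod_planeWave hd h hb R z φ).integral_prod_left.aestronglyMeasurable
  refine (h1.const_mul (-fourierConst d)).congr (Eventually.of_forall fun x => ?_)
  simp only [Function.uncurry, greenTrunc]
  rw [integral_mul_const, mul_assoc]

theorem integral_greenTrunc_mul {d : ℕ} [NeZero d] (hd : 2 ≤ d) {k : CVec d}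
    (h : inner ℝ (imVec k) (reVec k) = 0) (hb : imVec k ≠ 0) (R : ℝ) (z : RVec d) (φ : 𝓢(RVec d, ℂ)) :
    ∫ x, greenTrunc k R (x - z) * φ x = -fourierConst d *
      ∫ ξ in Metric.closedBall (0 : RVec d) R, planeWave (-ξ) z * (∫ x, planeWave ξ x * φ x) / symb k ξ := by
  have h1 := integral_integral_swap (integrable_prod_planeWave hd h hb R z φ)
  simp_rw [integral_mul_const] at h1
  simp only [greenTrunc, mul_assoc]
  rw [integral_const_mul, h1]
  congr 2; ext ξ
  rw [← integral_const_mul, ← integral_div]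
  congr 1; ext x
  rw [sub_eq_add_neg, planeWave_add_right, planeWave_neg_left]
  ring

theorem ae_sub_ne_zero {d : ℕ} [NeZero d] (z : RVec d) : ∀ᵐ x : RVec d, x - z ≠ 0 := by
  filter_upwards [Measure.ae_ne volume z] with x hx using sub_ne_zero.2 hx

theorem integrable_mul_of_weight {d : ℕ} [NeZero d] (hd : 2 ≤ d) {F : RVec d → ℂ} {C : ℝ}
    (hF : ∀ x, x ≠ 0 → ‖F x‖ ≤ C * weight d x) (z : RVec d) {φ : 𝓢(RVec d, ℂ)}
    (hm : AEStronglyMeasurable (fun x => F (x - z) * φ x) volume) : Integrable fun x => F (x - z) * φ x := by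
  refine ((integrable_weight_mul hd z φ).const_mul C).mono' hm ?_
  filter_upwards [ae_sub_ne_zero z] with x hx
  rw [norm_mul, ← mul_assoc]
  exact mul_le_mul_of_nonneg_right (hF _ hx) (norm_nonneg _)

theorem integrable_green_mul {d : ℕ} [NeZero d] (hd : d = 2 ∨ d = 3) {k : CVec d}
    (h : inner ℝ (imVec k) (reVec k) = 0) (hb : imVec k ≠ 0) (z : RVec d) (φ : 𝓢(RVec d, ℂ)) :
    Integrable fun x => green k (x - z) * φ x := by
  obtain ⟨C, -, hC⟩ := exists_green_weight hd h hb
  refine integrable_mul_of_weight (by omega) hC z ?_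
  refine aestronglyMeasurable_of_tendsto_ae atTop (f := fun (R : ℝ) x => greenTrunc k R (x - z) * φ x)
    (fun R => aestronglyMeasurable_greenTrunc_mul (by omega) h hb R z φ) ?_
  filter_upwards [ae_sub_ne_zero z] with x hx
  exact (tendsto_greenTrunc hd h hb hx).mul_const _

/-- At a finite cut-off this is Fubini. As `R → ∞` the left side converges under the weight bound,
and the right side because the transform of `φ` is integrable and bounded, hence integrable against
the inverse symbol. -/
theorem integral_green_mul {d : ℕ} [NeZero d] (hd : d = 2 ∨ d = 3) {k : CVec d}
    (h : inner ℝ (imVec k) (reVec k) = 0) (hb : imVec k ≠ 0) (z : RVec d) (φ : 𝓢(RVec d, ℂ)) :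
    ∫ x, green k (x - z) * φ x = -fourierConst d *
      ∫ ξ, planeWave (-ξ) z * (∫ x, planeWave ξ x * φ x) / symb k ξ := by
  have hd2 : 2 ≤ d := by omega
  obtain ⟨C, -, hC⟩ := exists_greenTrunc_weight hd h hb
  have h1 : Tendsto (fun R => ∫ x, greenTrunc k R (x - z) * φ x) atTop (𝓝 (∫ x, green k (x - z) * φ x)) := by
    refine tendsto_integral_filter_of_dominated_convergence (fun x => C * (weight d (x - z) * ‖φ x‖))
      (Eventually.of_forall fun R => aestronglyMeasurable_greenTrunc_mul hd2 h hb R z φ) ?_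
      ((integrable_weight_mul hd2 z φ).const_mul C) ?_
    · filter_upwards [eventually_ge_atTop (outerRadius k)] with R hR
      filter_upwards [ae_sub_ne_zero z] with x hx
      rw [norm_mul, ← mul_assoc]
      exact mul_le_mul_of_nonneg_right (hC R hR _ hx) (norm_nonneg _)
    · filter_upwards [ae_sub_ne_zero z] with x hx
      exact (tendsto_greenTrunc hd h hb hx).mul_const _
  simp_rw [integral_greenTrunc_mul hd2 h hb] at h1
  refine tendsto_nhds_unique h1 (Tendsto.const_mul _ ?_)
  exact (aecover_closedBall (μ := volume) (x := (0 : RVec d)) tendsto_id).integral_tendsto_of_countably_generated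
    (integrable_planeWave_div_symb hd2 h hb z φ)

theorem integrable_greenBdry_mul {d : ℕ} [NeZero d] (hd : d = 2 ∨ d = 3) {k γ : RVec d} (hk : k ≠ 0) (hγ : ‖γ‖ = 1)
    (hkγ : inner ℝ k γ = 0) (z : RVec d) (φ : 𝓢(RVec d, ℂ)) :
    Integrable (fun x => greenBdry k γ (x - z) * φ x) ∧
    Tendsto (fun ε : ℝ => ∫ x, green (shift k γ ε) (x - z) * φ x) (𝓝[>] 0)
      (𝓝 (∫ x, greenBdry k γ (x - z) * φ x)) := by
  have hd2 : 2 ≤ d := by omega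
  obtain ⟨C, -, hC⟩ := exists_green_shift_weight hd hk hγ hkγ
  obtain ⟨C', -, hC'⟩ := exists_greenBdry_weight hd hk hγ hkγ
  have hm : ∀ ε : ℝ, 0 < ε → AEStronglyMeasurable (fun x => green (shift k γ ε) (x - z) * φ x) volume := fun ε hε =>
    (integrable_green_mul hd (shift_orth hkγ ε) (imVec_shift_ne hγ hε) z φ).aestronglyMeasurable
  constructor
  · refine integrable_mul_of_weight hd2 hC' z ?_
    -- The sequence `1/(n+1)` keeps the parameter positive, where measurability is known for every
    -- index.
    refine aestronglyMeasurable_of_tendsto_ae atTop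
      (f := fun (n : ℕ) x => green (shift k γ (1 / ((n : ℝ) + 1))) (x - z) * φ x)
      (fun n => hm _ (by positivity)) ?_
    filter_upwards [ae_sub_ne_zero z] with x hx
    have h1 : Tendsto (fun n : ℕ => 1 / ((n : ℝ) + 1)) atTop (𝓝[>] 0) :=
      tendsto_nhdsWithin_iff.2 ⟨tendsto_one_div_add_atTop_nhds_zero_nat,
        Eventually.of_forall fun n => Set.mem_Ioi.2 (by positivity)⟩
    exact ((tendsto_green_shift hd hk hγ hkγ hx).comp h1).mul_const _
  · refine tendsto_integral_filter_of_dominated_convergence (fun x => C * (weight d (x - z) * ‖φ x‖)) ?_ ?_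
      ((integrable_weight_mul hd2 z φ).const_mul C) ?_
    · filter_upwards [self_mem_nhdsWithin] with ε hε using hm ε hε
    · filter_upwards [Ioc_mem_nhdsGT_zero] with ε hε
      filter_upwards [ae_sub_ne_zero z] with x hx
      rw [norm_mul, ← mul_assoc]
      exact mul_le_mul_of_nonneg_right (hC ε _ hε.1 hε.2 hx) (norm_nonneg _)
    · filter_upwards [ae_sub_ne_zero z] with x hx
      exact (tendsto_green_shift hd hk hγ hkγ hx).mul_const _

/-! ### Uniqueness of the function `H`. -/

open scoped ContDiff in
-- The fundamental lemma of the calculus of variations on `U` gives `D = 0` almost everywhere, and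
-- continuity extends this to every point. Working on `U` allows a weight that is singular on the
-- null complement.
theorem eq_zero_of_forall_integral_test {d : ℕ} {D w : RVec d → ℂ} {U : Set (RVec d)} (hU : IsOpen U)
    (hUae : ∀ᵐ ξ, ξ ∈ U) (hD : Continuous D) (hw : ContinuousOn w U) (hw0 : ∀ ξ ∈ U, w ξ ≠ 0)
    (H : ∀ χ : RVec d → ℝ, ContDiff ℝ ∞ χ → HasCompactSupport χ → tsupport χ ⊆ U →
      ∫ ξ, χ ξ • (D ξ * w ξ) = 0) : D = 0 := by
  have h1 : LocallyIntegrableOn (fun ξ => D ξ * w ξ) U volume :=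
    (hD.continuousOn.mul hw).locallyIntegrableOn hU.measurableSet
  have h2 := hU.ae_eq_zero_of_integral_contDiff_smul_eq_zero h1 H
  refine (hD.ae_eq_iff_eq volume continuous_const).1 ?_
  filter_upwards [h2, hUae] with ξ h3 h4
  exact (mul_eq_zero.1 (h3 h4)).resolve_right (hw0 ξ h4)

theorem integrable_test_div_symb {d : ℕ} [NeZero d] (hd : 2 ≤ d) {k : CVec d}
    (h : inner ℝ (imVec k) (reVec k) = 0) (hb : imVec k ≠ 0) {D : RVec d → ℂ} (hD : Continuous D)
    {χ : RVec d → ℝ} (hχ : Continuous χ) (hc : HasCompactSupport χ) :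
    Integrable fun ξ => D ξ * (χ ξ : ℂ) / symb k ξ := by
  have h1 : Continuous fun ξ => D ξ * (χ ξ : ℂ) := by fun_prop
  have h2 : HasCompactSupport fun ξ => D ξ * (χ ξ : ℂ) :=
    (hc.comp_left (g := fun t : ℝ => (t : ℂ)) Complex.ofReal_zero).mul_left
  obtain ⟨C, hC⟩ := h2.exists_bound_of_continuous h1
  exact integrable_div_symb hd h hb (h1.integrable_of_hasCompactSupport h2) hC

/-- Every bump function of `ξ` is the transform of a Schwartz function, so two representations can
be compared locally in `ξ`; the inverse symbol is continuous and nonzero on an open set of full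
measure. -/
theorem scatteringData_unique {d : ℕ} [NeZero d] (hd : 2 ≤ d) {k : CVec d}
    (h : inner ℝ (imVec k) (reVec k) = 0) (hb : imVec k ≠ 0) {ψ H₁ H₂ : RVec d → ℂ}
    (h₁ : IsScatteringData k ψ H₁) (h₂ : IsScatteringData k ψ H₂) : H₁ = H₂ := by
  have hc₁ : Continuous fun ξ => H₁ (-ξ) := h₁.1.comp continuous_neg
  have hc₂ : Continuous fun ξ => H₂ (-ξ) := h₂.1.comp continuous_neg
  have key : (fun ξ => H₁ (-ξ) - H₂ (-ξ)) = 0 := by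
    refine eq_zero_of_forall_integral_test (U := {ξ | symb k ξ ≠ 0}) (w := fun ξ => (symb k ξ)⁻¹)
      (isOpen_ne_fun (continuous_symb k) continuous_const) (symb_ne_zero_ae hb) (hc₁.sub hc₂)
      ((continuous_symb k).continuousOn.inv₀ fun ξ hξ => hξ) (fun ξ hξ => inv_ne_zero hξ) fun χ hχ hcs hsupp => ?_
    obtain ⟨φ, hφ⟩ := exists_integral_planeWave_eq hχ hcs
    have e := ((h₁.2.2 φ).2.symm.trans (h₂.2.2 φ).2)
    simp_rw [hφ] at e
    have i₁ := integrable_test_div_symb hd h hb hc₁ hχ.continuous hcs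
    have i₂ := integrable_test_div_symb hd h hb hc₂ hχ.continuous hcs
    have e2 := integral_sub i₁ i₂
    rw [neg_injective e, sub_self] at e2
    rw [← e2]
    congr 1; ext ξ
    rw [Complex.real_smul]; ring
  ext p
  have := congrFun key (-p)
  simpa [sub_eq_zero] using this

/-- Bump functions supported away from the sphere `|ξ + k| = |k|` keep the symbol bounded below
uniformly in `ε`, so the limit may be taken under the integral. The weight becomes `1/(|ξ + k|² -
|k|²)`, nonzero off a null set. -/
theorem scatteringDataBdry_unique {d : ℕ} [NeZero d] (hd : 2 ≤ d) {k γ : RVec d} (hk : k ≠ 0) (hγ : ‖γ‖ = 1)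
    (hkγ : inner ℝ k γ = 0) {ψ H₁ H₂ : RVec d → ℂ}
    (h₁ : IsScatteringDataBdry k γ ψ H₁) (h₂ : IsScatteringDataBdry k γ ψ H₂) : H₁ = H₂ := by
  have hc₁ : Continuous fun ξ => H₁ (-ξ) := h₁.1.comp continuous_neg
  have hc₂ : Continuous fun ξ => H₂ (-ξ) := h₂.1.comp continuous_neg
  have hq : Continuous fun ξ : RVec d => ‖ξ + k‖ ^ 2 - ‖k‖ ^ 2 := by fun_prop
  have hae : ∀ᵐ ξ : RVec d, ‖ξ + k‖ ^ 2 - ‖k‖ ^ 2 ≠ 0 := by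
    have h0 : volume (Metric.sphere (-k) ‖k‖) = 0 :=
      Measure.addHaar_sphere_of_ne_zero volume _ (norm_ne_zero_iff.2 hk)
    filter_upwards [measure_eq_zero_iff_ae_notMem.1 h0] with ξ hξ h3
    refine hξ ?_
    rw [mem_sphere_iff_norm, sub_neg_eq_add]
    exact (sq_eq_sq₀ (norm_nonneg _) (norm_nonneg _)).1 (by linarith)
  have key : (fun ξ => H₁ (-ξ) - H₂ (-ξ)) = 0 := by
    refine eq_zero_of_forall_integral_test (U := {ξ | ‖ξ + k‖ ^ 2 - ‖k‖ ^ 2 ≠ 0})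
      (w := fun ξ => ((‖ξ + k‖ ^ 2 - ‖k‖ ^ 2 : ℝ) : ℂ)⁻¹)
      (isOpen_ne_fun hq continuous_const) hae (hc₁.sub hc₂)
      ((Complex.continuous_ofReal.comp hq).continuousOn.inv₀ fun ξ hξ => Complex.ofReal_ne_zero.2 hξ)
      (fun ξ hξ => inv_ne_zero (Complex.ofReal_ne_zero.2 hξ)) fun χ hχ hcs hsupp => ?_
    obtain ⟨φ, hφ⟩ := exists_integral_planeWave_eq hχ hcs
    have e := (h₂.2.2 φ).2.sub (h₁.2.2 φ).2
    simp_rw [hφ, sub_self] at e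
    have hD : Continuous fun ξ => (H₁ (-ξ) - H₂ (-ξ)) * (χ ξ : ℂ) :=
      (hc₁.sub hc₂).mul (Complex.continuous_ofReal.comp hχ.continuous)
    have hDs : HasCompactSupport fun ξ => (H₁ (-ξ) - H₂ (-ξ)) * (χ ξ : ℂ) :=
      (hcs.comp_left (g := fun t : ℝ => (t : ℂ)) Complex.ofReal_zero).mul_left
    obtain ⟨M, hM⟩ := hcs.isCompact.exists_bound_of_continuousOn
      (f := fun ξ : RVec d => (‖ξ + k‖ ^ 2 - ‖k‖ ^ 2)⁻¹) (hq.continuousOn.inv₀ fun ξ hξ => hsupp hξ)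
    have hlim : Tendsto (fun ε : ℝ => ∫ ξ, (H₁ (-ξ) - H₂ (-ξ)) * (χ ξ : ℂ) * (symb (shift k γ ε) ξ)⁻¹) (𝓝[>] 0)
        (𝓝 (∫ ξ, (H₁ (-ξ) - H₂ (-ξ)) * (χ ξ : ℂ) * ((‖ξ + k‖ ^ 2 - ‖k‖ ^ 2 : ℝ) : ℂ)⁻¹)) := by
      refine tendsto_integral_filter_of_dominated_convergence
        (fun ξ => ‖(H₁ (-ξ) - H₂ (-ξ)) * (χ ξ : ℂ)‖ * M) ?_ ?_
        ((hD.integrable_of_hasCompactSupport hDs).norm.mul_const M) ?_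
      · exact Eventually.of_forall fun ε =>
          (hD.measurable.mul (continuous_symb _).measurable.inv).aestronglyMeasurable
      · refine Eventually.of_forall fun ε => Eventually.of_forall fun ξ => ?_
        rw [norm_mul]
        by_cases hξ : ξ ∈ tsupport χ
        · refine mul_le_mul_of_nonneg_left (le_trans ?_ (hM ξ hξ)) (norm_nonneg _)
          rw [← shiftedInv_eq hkγ, norm_inv]
          exact norm_shiftedInv_le (abs_pos.2 (hsupp hξ)) le_rfl ε γ
        · rw [image_eq_zero_of_notMem_tsupport hξ]; simp
      · filter_upwards [hae] with ξ hξ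
        simp_rw [← shiftedInv_eq hkγ]
        exact (tendsto_shiftedInv hξ γ).const_mul _
    have e3 : ∫ ξ, (H₁ (-ξ) - H₂ (-ξ)) * (χ ξ : ℂ) * ((‖ξ + k‖ ^ 2 - ‖k‖ ^ 2 : ℝ) : ℂ)⁻¹ = 0 := by
      refine tendsto_nhds_unique hlim (e.congr' ?_)
      filter_upwards [self_mem_nhdsWithin] with ε hε
      have i₁ := integrable_test_div_symb hd (shift_orth hkγ ε) (imVec_shift_ne hγ hε) hc₁ hχ.continuous hcs
      have i₂ := integrable_test_div_symb hd (shift_orth hkγ ε) (imVec_shift_ne hγ hε) hc₂ hχ.continuous hcs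
      rw [neg_sub_neg, ← integral_sub i₁ i₂]
      congr 1; ext ξ
      ring
    rw [← e3]
    congr 1; ext ξ
    rw [Complex.real_smul]; ring
  ext p
  have := congrFun key (-p)
  simpa [sub_eq_zero] using this

/-! ### Scattering data -/

/-- The function `H` of a superposition of Green functions with sources `z j` and charges `c j`. -/
noncomputable def sourceData {d n : ℕ} (c : Fin n → ℂ) (z : Fin n → RVec d) (p : RVec d) : ℂ :=
  fourierConst d * ∑ j, c j * planeWave p (z j)

theorem continuous_sourceData {d n : ℕ} (c : Fin n → ℂ) (z : Fin n → RVec d) : Continuous (sourceData c z) := by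
  have h : ∀ x : RVec d, Continuous fun p : RVec d => planeWave p x := fun x =>
    continuous_planeWave.comp (continuous_id.prodMk continuous_const)
  unfold sourceData
  exact continuous_const.mul (continuous_finsetSum _ fun j _ => continuous_const.mul (h _))

theorem sourceData_growth {d n : ℕ} (c : Fin n → ℂ) (z : Fin n → RVec d) :
    ∃ (C : ℝ) (s : ℕ), ∀ p, ‖sourceData c z p‖ ≤ C * (1 + ‖p‖) ^ s := by
  refine ⟨‖fourierConst d‖ * ∑ j, ‖c j‖, 0, fun p => ?_⟩
  rw [sourceData, norm_mul, pow_zero, mul_one]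
  refine mul_le_mul_of_nonneg_left ((norm_sum_le _ _).trans (le_of_eq ?_)) (norm_nonneg _)
  simp_rw [norm_mul, norm_planeWave, mul_one]

theorem ae_forall_ne {d n : ℕ} [NeZero d] (z : Fin n → RVec d) : ∀ᵐ x : RVec d, ∀ j, x ≠ z j :=
  ae_all_iff.2 fun j => Measure.ae_ne volume (z j)

theorem integral_sum_green_mul {d n : ℕ} [NeZero d] (hd : d = 2 ∨ d = 3) {k : CVec d}
    (h : inner ℝ (imVec k) (reVec k) = 0) (hb : imVec k ≠ 0) (c : Fin n → ℂ) (z : Fin n → RVec d)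
    (φ : 𝓢(RVec d, ℂ)) :
    ∑ j, c j * ∫ x, green k (x - z j) * φ x =
      -∫ ξ, sourceData c z (-ξ) * (∫ x, planeWave ξ x * φ x) / symb k ξ := by
  have h1 : ∀ ξ, sourceData c z (-ξ) * (∫ x, planeWave ξ x * φ x) / symb k ξ =
      ∑ j, fourierConst d * c j * (planeWave (-ξ) (z j) * (∫ x, planeWave ξ x * φ x) / symb k ξ) := by
    intro ξ
    rw [sourceData, Finset.mul_sum, Finset.sum_mul, Finset.sum_div]
    refine Finset.sum_congr rfl fun j _ => ?_
    ring
  simp_rw [h1]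
  rw [integral_finsetSum _ fun j _ => (integrable_planeWave_div_symb (by omega) h hb (z j) φ).const_mul _,
    ← Finset.sum_neg_distrib]
  refine Finset.sum_congr rfl fun j _ => ?_
  rw [integral_green_mul hd h hb, integral_const_mul]
  ring

theorem integrable_sum_mul {d n : ℕ} {F : RVec d → ℂ} {φ : 𝓢(RVec d, ℂ)} (c : Fin n → ℂ) (z : Fin n → RVec d)
    (hF : ∀ j, Integrable fun x => F (x - z j) * φ x) :
    Integrable (fun x => (∑ j, c j * F (x - z j)) * φ x) ∧
    ∫ x, (∑ j, c j * F (x - z j)) * φ x = ∑ j, c j * ∫ x, F (x - z j) * φ x := by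
  have h1 : ∀ x, (∑ j, c j * F (x - z j)) * φ x = ∑ j, c j * (F (x - z j) * φ x) := fun x => by
    rw [Finset.sum_mul]; exact Finset.sum_congr rfl fun j _ => mul_assoc _ _ _
  simp_rw [h1]
  refine ⟨integrable_finsetSum _ fun j _ => (hF j).const_mul _, ?_⟩
  rw [integral_finsetSum _ fun j _ => (hF j).const_mul _]
  simp_rw [integral_const_mul]

theorem isScatteringData_sourceData {d n : ℕ} [NeZero d] (hd : d = 2 ∨ d = 3) {k : CVec d}
    (h : inner ℝ (imVec k) (reVec k) = 0) (hb : imVec k ≠ 0) {c : Fin n → ℂ} {z : Fin n → RVec d} {ψ : RVec d → ℂ}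
    (hψ : ∀ x, (∀ j, x ≠ z j) → ψ x = expWave k x * (1 + ∑ j, c j * green k (x - z j))) :
    IsScatteringData k ψ (sourceData c z) := by
  refine ⟨continuous_sourceData c z, sourceData_growth c z, fun φ => ?_⟩
  have hae : (fun x => (ψ x / expWave k x - 1) * φ x) =ᵐ[volume]
      fun x => (∑ j, c j * green k (x - z j)) * φ x := by
    filter_upwards [ae_forall_ne z] with x hx
    rw [hψ x hx, mul_div_cancel_left₀ _ (show expWave k x ≠ 0 from Complex.exp_ne_zero _), add_sub_cancel_left]
  obtain ⟨h1, h2⟩ := integrable_sum_mul (F := green k) c z fun j => integrable_green_mul hd h hb (z j) φ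
  exact ⟨h1.congr hae.symm, by rw [integral_congr_ae hae, h2, integral_sum_green_mul hd h hb]⟩

/-- `H` does not depend on `ε`: at each `ε > 0` the regularised integral equals a pairing with
`green (shift k γ ε)`, and these pairings converge. -/
theorem isScatteringDataBdry_sourceData {d n : ℕ} [NeZero d] (hd : d = 2 ∨ d = 3) {k γ : RVec d} (hk : k ≠ 0)
    (hγ : ‖γ‖ = 1) (hkγ : inner ℝ k γ = 0) {c : Fin n → ℂ} {z : Fin n → RVec d} {ψ : RVec d → ℂ}
    (hψ : ∀ x, (∀ j, x ≠ z j) → ψ x = planeWave k x * (1 + ∑ j, c j * greenBdry k γ (x - z j))) :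
    IsScatteringDataBdry k γ ψ (sourceData c z) := by
  refine ⟨continuous_sourceData c z, sourceData_growth c z, fun φ => ?_⟩
  have hae : (fun x => (ψ x / planeWave k x - 1) * φ x) =ᵐ[volume]
      fun x => (∑ j, c j * greenBdry k γ (x - z j)) * φ x := by
    filter_upwards [ae_forall_ne z] with x hx
    rw [hψ x hx, mul_div_cancel_left₀ _ (planeWave_ne_zero _ _), add_sub_cancel_left]
  obtain ⟨h1, h2⟩ := integrable_sum_mul (F := greenBdry k γ) c z fun j =>
    (integrable_greenBdry_mul hd hk hγ hkγ (z j) φ).1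
  refine ⟨h1.congr hae.symm, ?_⟩
  rw [integral_congr_ae hae, h2]
  have h3 : Tendsto (fun ε : ℝ => ∑ j, c j * ∫ x, green (shift k γ ε) (x - z j) * φ x) (𝓝[>] 0)
      (𝓝 (∑ j, c j * ∫ x, greenBdry k γ (x - z j) * φ x)) :=
    tendsto_finsetSum _ fun j _ => (integrable_greenBdry_mul hd hk hγ hkγ (z j) φ).2.const_mul _
  refine h3.congr' ?_
  filter_upwards [self_mem_nhdsWithin] with ε hε
  exact integral_sum_green_mul hd (shift_orth hkγ ε) (imVec_shift_ne hγ hε) c z φ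

/-- Equal imaginary parts make `k - l` a real vector, so `h(k,l)` evaluates `H` at a real point. -/
theorem expWave_sub_eq {d : ℕ} {k l : CVec d} (h : imVec l = imVec k) (x : RVec d) :
    expWave (k - l) x = planeWave (reVec k - reVec l) x := by
  have h1 : reVec (k - l) = reVec k - reVec l := by ext i; simp [reVec]
  have h2 : imVec (k - l) = 0 := by
    have : imVec (k - l) = imVec k - imVec l := by ext i; simp [imVec]
    rw [this, h, sub_self]
  rw [expWave, cdot_eq, h1, h2, planeWave]
  simp

/-! ### Linear systems -/

/-- Cramer's rule: determinant and adjugate are continuous in the entries, and where the determinant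
is nonzero the solution is their quotient applied to `v`. -/
theorem tendsto_solution {ι : Type*} {l : Filter ι} {n : ℕ} {B : ι → Matrix (Fin n) (Fin n) ℂ}
    {A : Matrix (Fin n) (Fin n) ℂ} (hB : Tendsto B l (𝓝 A)) (hA : A.det ≠ 0) {c : ι → Fin n → ℂ} {v : Fin n → ℂ}
    (hc : ∀ᶠ i in l, (B i).mulVec (c i) = v) : Tendsto c l (𝓝 (A⁻¹.mulVec v)) := by
  have hdet : Tendsto (fun i => (B i).det) l (𝓝 A.det) :=
    ((continuous_id.matrix_det).tendsto A).comp hB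
  have hadj : Tendsto (fun i => (B i).adjugate) l (𝓝 A.adjugate) :=
    ((continuous_id.matrix_adjugate).tendsto A).comp hB
  have h1 : Tendsto (fun i => ((B i).det)⁻¹ • (B i).adjugate.mulVec v) l (𝓝 ((A.det)⁻¹ • A.adjugate.mulVec v)) := by
    refine (hdet.inv₀ hA).smul ?_
    exact ((Continuous.matrix_mulVec continuous_id continuous_const).tendsto A.adjugate).comp hadj
  have h2 : A⁻¹.mulVec v = (A.det)⁻¹ • A.adjugate.mulVec v := by
    rw [Matrix.inv_def, Ring.inverse_eq_inv', Matrix.smul_mulVec]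
  rw [h2]
  refine h1.congr' ?_
  filter_upwards [hc, hdet.eventually_ne hA] with i hi hdi
  rw [← hi, Matrix.mulVec_mulVec, Matrix.adjugate_mul, Matrix.smul_mulVec, Matrix.one_mulVec, smul_smul,
    inv_mul_cancel₀ hdi, one_smul]

theorem matReg_eq_tilde {d n : ℕ} {α : Fin n → ℝ} (z : Fin n → RVec d) {q : ℝ} (g : RVec d → ℂ)
    (h : ∀ m, 1 - α m * q ≠ 0) :
    matReg α z q g = Matrix.diagonal (fun m => ((1 - α m * q : ℝ) : ℂ)) * matTilde α z q g := by
  ext m j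
  rw [Matrix.diagonal_mul]
  simp only [matReg, matTilde, Matrix.of_apply]
  split_ifs with hmj
  · rw [mul_one]
  · have : ((1 - α m * q : ℝ) : ℂ) ≠ 0 := Complex.ofReal_ne_zero.2 (h m)
    rw [Complex.ofReal_mul, Complex.ofReal_inv]
    field_simp

theorem matReg_eq_cal {d n : ℕ} {α : Fin n → ℝ} (z : Fin n → RVec d) (q : ℝ) {e : RVec d → ℂ} (g : RVec d → ℂ)
    (he0 : ∀ x, e x ≠ 0) (he : ∀ x y, e (x - y) * e y = e x) (h : ∀ m, α m ≠ 0) :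
    matReg α z q g = Matrix.diagonal (fun m => (α m : ℂ) * (e (z m))⁻¹) * matCal α z q e g *
      Matrix.diagonal (fun j => e (z j)) := by
  ext m j
  rw [Matrix.mul_diagonal, Matrix.diagonal_mul]
  have hα : (α m : ℂ) ≠ 0 := Complex.ofReal_ne_zero.2 (h m)
  have hm := he0 (z m)
  simp only [matReg, matCal, Matrix.of_apply]
  split_ifs with hmj
  · subst hmj
    push_cast
    field_simp
  · have := he (z m) (z j)
    field_simp
    linear_combination g (z m - z j) * this

theorem spectralSingularity_iff_tilde {d n : ℕ} {α : Fin n → ℝ} (z : Fin n → RVec d) {q : ℝ} (g : RVec d → ℂ)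
    (h : ∀ m, 1 - α m * q ≠ 0) : IsSpectralSingularity α z q g ↔ (matTilde α z q g).det = 0 := by
  rw [IsSpectralSingularity, matReg_eq_tilde z g h, Matrix.det_mul, Matrix.det_diagonal, mul_eq_zero,
    or_iff_right]
  exact Finset.prod_ne_zero_iff.2 fun m _ => Complex.ofReal_ne_zero.2 (h m)

theorem spectralSingularity_iff_cal {d n : ℕ} {α : Fin n → ℝ} (z : Fin n → RVec d) (q : ℝ) {e : RVec d → ℂ}
    (g : RVec d → ℂ) (he0 : ∀ x, e x ≠ 0) (he : ∀ x y, e (x - y) * e y = e x) (h : ∀ m, α m ≠ 0) :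
    IsSpectralSingularity α z q g ↔ (matCal α z q e g).det = 0 := by
  rw [IsSpectralSingularity, matReg_eq_cal z q g he0 he h, Matrix.det_mul, Matrix.det_mul, Matrix.det_diagonal,
    Matrix.det_diagonal, mul_eq_zero, mul_eq_zero, or_iff_left, or_iff_right]
  · exact Finset.prod_ne_zero_iff.2 fun m _ => mul_ne_zero (Complex.ofReal_ne_zero.2 (h m)) (inv_ne_zero (he0 _))
  · exact Finset.prod_ne_zero_iff.2 fun m _ => he0 _

theorem isCoeff_inv {d n : ℕ} {α : Fin n → ℝ} {z : Fin n → RVec d} {q : ℝ} {e g : RVec d → ℂ}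
    (he0 : ∀ x, e x ≠ 0) (he : ∀ x y, e (x - y) * e y = e x) (h : ¬ IsSpectralSingularity α z q g) :
    IsCoeff α z q e g ((matReg α z q g)⁻¹.mulVec fun m => (α m : ℂ)) := by
  have hu : IsUnit (matReg α z q g).det := isUnit_iff_ne_zero.2 h
  set c := (matReg α z q g)⁻¹.mulVec fun m => (α m : ℂ) with hc
  have h1 : (matReg α z q g).mulVec c = fun m => (α m : ℂ) := by
    rw [hc, Matrix.mulVec_mulVec, Matrix.mul_nonsing_inv _ hu, Matrix.one_mulVec]
  refine ⟨h1, fun c' hc' => ?_, fun hq => ?_, fun hα => ?_⟩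
  · rw [hc, ← hc', Matrix.mulVec_mulVec, Matrix.nonsing_inv_mul _ hu, Matrix.one_mulVec]
  · rw [matReg_eq_tilde z g hq, ← Matrix.mulVec_mulVec] at h1
    ext m
    have h2 := congrFun h1 m
    rw [Matrix.mulVec_diagonal] at h2
    have h3 : ((1 - α m * q : ℝ) : ℂ) ≠ 0 := Complex.ofReal_ne_zero.2 (hq m)
    rw [vecTilde, Complex.ofReal_mul, Complex.ofReal_inv, ← h2]
    field_simp
  · rw [matReg_eq_cal z q g he0 he hα, ← Matrix.mulVec_mulVec, ← Matrix.mulVec_mulVec] at h1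
    have h4 : (Matrix.diagonal fun j => e (z j)).mulVec c = fun j => e (z j) * c j := by
      ext j; rw [Matrix.mulVec_diagonal]
    rw [h4] at h1
    ext m
    have h2 := congrFun h1 m
    rw [Matrix.mulVec_diagonal] at h2
    have h3 : (α m : ℂ) ≠ 0 := Complex.ofReal_ne_zero.2 (hα m)
    have h5 := he0 (z m)
    field_simp at h2
    linear_combination h2

/-! ### The regularized problem and its limit -/

/-- The sharp cut-off in `uHat` restricts to the ball of radius `N`, and its phase shifts the
argument by `z`, so every integral of the regularised problem is a truncated Green function. -/
theorem integrable_uHat_mul_div {d : ℕ} [NeZero d] (hd : 2 ≤ d) {k : CVec d}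
    (h : inner ℝ (imVec k) (reVec k) = 0) (hb : imVec k ≠ 0) (N : ℝ) (x z : RVec d) :
    Integrable (fun ξ => planeWave ξ x * uHat z N ξ / symb k ξ) ∧
    fourierConst d * ∫ ξ, planeWave ξ x * uHat z N ξ / symb k ξ = -greenTrunc k N (x - z) := by
  have e : (fun ξ => planeWave ξ x * uHat z N ξ / symb k ξ) =
      (Metric.closedBall (0 : RVec d) N).indicator fun ξ => planeWave ξ (x - z) / symb k ξ := by
    ext ξ
    by_cases hξ : ‖ξ‖ ≤ N
    · rw [Set.indicator_of_mem (mem_closedBall_zero_iff.2 hξ), uHat, if_pos hξ, sub_eq_add_neg, planeWave_add_right,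
        planeWave_neg_left]
    · rw [Set.indicator_of_notMem (fun h1 => hξ (mem_closedBall_zero_iff.1 h1)), uHat, if_neg hξ, mul_zero, zero_div]
  rw [e]
  constructor
  · rw [integrable_indicator_iff Metric.isClosed_closedBall.measurableSet]
    simp_rw [div_eq_mul_inv]
    exact integrableOn_planeWave_mul (integrableOn_inv_symb hd h hb N) _
  · rw [integral_indicator Metric.isClosed_closedBall.measurableSet, greenTrunc]
    ring

theorem uHat_neg_mul {d : ℕ} (z : RVec d) (N : ℝ) (y : RVec d) (ξ : RVec d) :
    uHat z N (-ξ) * uHat y N ξ = planeWave ξ z * uHat y N ξ := by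
  by_cases hξ : ‖ξ‖ ≤ N
  · rw [uHat, if_pos (by rwa [norm_neg]), neg_neg]
  · rw [uHat, uHat, if_neg hξ, mul_zero, mul_zero]

theorem matN_apply {d n : ℕ} [NeZero d] (hd : 2 ≤ d) {k : CVec d}
    (h : inner ℝ (imVec k) (reVec k) = 0) (hb : imVec k ≠ 0) (α : Fin n → ℝ) (z : Fin n → RVec d) (N : ℝ)
    (m j : Fin n) :
    matN α z N k m j = (if m = j then 1 else 0) - (coupling d (α m) N : ℂ) * greenTrunc k N (z m - z j) := by
  simp only [matN, Matrix.of_apply, uHat_neg_mul]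
  rw [(integrable_uHat_mul_div hd h hb N (z m) (z j)).2]
  ring

theorem greenTrunc_zero {d : ℕ} (k : CVec d) (N : ℝ) :
    greenTrunc k N 0 = -(fourierConst d * diagInt k N) := by
  simp only [greenTrunc, diagInt, planeWave_zero_right, one_div]
  ring

/-- The solution `-(∑ j, c_j û_j) / (ξ² + 2kξ)` with charges `c`. -/
noncomputable def sourceWave {d n : ℕ} (z : Fin n → RVec d) (N : ℝ) (k : CVec d) (c : Fin n → ℂ) (ξ : RVec d) : ℂ :=
  -(∑ j, c j * uHat (z j) N ξ) / symb k ξ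

theorem integrable_planeWave_mul_sourceWave {d n : ℕ} [NeZero d] (hd : 2 ≤ d) {k : CVec d}
    (h : inner ℝ (imVec k) (reVec k) = 0) (hb : imVec k ≠ 0) (z : Fin n → RVec d) (N : ℝ) (c : Fin n → ℂ)
    (x : RVec d) :
    Integrable (fun ξ => planeWave ξ x * sourceWave z N k c ξ) ∧
    fourierConst d * ∫ ξ, planeWave ξ x * sourceWave z N k c ξ = ∑ j, c j * greenTrunc k N (x - z j) := by
  have e : ∀ ξ, planeWave ξ x * sourceWave z N k c ξ =
      ∑ j, -c j * (planeWave ξ x * uHat (z j) N ξ / symb k ξ) := by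
    intro ξ
    rw [sourceWave, ← Finset.sum_neg_distrib, Finset.sum_div, Finset.mul_sum]
    refine Finset.sum_congr rfl fun j _ => ?_
    ring
  simp_rw [e]
  have hi : ∀ j ∈ (Finset.univ : Finset (Fin n)),
      Integrable fun ξ => -c j * (planeWave ξ x * uHat (z j) N ξ / symb k ξ) := fun j _ =>
    (integrable_uHat_mul_div hd h hb N x (z j)).1.const_mul _
  refine ⟨integrable_finsetSum _ hi, ?_⟩
  rw [integral_finsetSum _ hi, Finset.mul_sum]
  refine Finset.sum_congr rfl fun j _ => ?_
  rw [integral_const_mul]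
  linear_combination (-c j) * (integrable_uHat_mul_div hd h hb N x (z j)).2

theorem uHat_neg_mul_sourceWave {d n : ℕ} (z : Fin n → RVec d) (N : ℝ) (k : CVec d) (c : Fin n → ℂ) (y ξ : RVec d) :
    uHat y N (-ξ) * sourceWave z N k c ξ = planeWave ξ y * sourceWave z N k c ξ := by
  by_cases hξ : ‖ξ‖ ≤ N
  · rw [uHat, if_pos (by rwa [norm_neg]), neg_neg]
  · have : sourceWave z N k c ξ = 0 := by simp [sourceWave, uHat, hξ]
    rw [this, mul_zero, mul_zero]

theorem muN_eq {d n : ℕ} [NeZero d] (hd : 2 ≤ d) {k : CVec d}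
    (h : inner ℝ (imVec k) (reVec k) = 0) (hb : imVec k ≠ 0) (α : Fin n → ℝ) (z : Fin n → RVec d) (N : ℝ)
    (x : RVec d) : muN α z N k x = 1 + ∑ j, coeffN α z N k j * greenTrunc k N (x - z j) := by
  rw [← (integrable_planeWave_mul_sourceWave hd h hb z N (coeffN α z N k) x).2, muN]
  congr 3; ext ξ
  exact mul_comm _ _

theorem matN_mulVec {d n : ℕ} [NeZero d] (hd : 2 ≤ d) {k : CVec d}
    (h : inner ℝ (imVec k) (reVec k) = 0) (hb : imVec k ≠ 0) (α : Fin n → ℝ) (z : Fin n → RVec d) (N : ℝ)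
    (c : Fin n → ℂ) (m : Fin n) : (matN α z N k).mulVec c m =
      c m - (coupling d (α m) N : ℂ) * ∑ j, c j * greenTrunc k N (z m - z j) := by
  simp only [Matrix.mulVec, dotProduct, matN_apply hd h hb, sub_mul, ite_mul, one_mul, zero_mul]
  rw [Finset.sum_sub_distrib, Finset.sum_ite_eq, if_pos (Finset.mem_univ m), Finset.mul_sum]
  congr 1
  refine Finset.sum_congr rfl fun j _ => ?_
  ring

/-- Since the potential has finite rank, any solution is `sourceWave` with charges `ε_j(N)` times
its own moments. Substituting this form into the moments is exactly the system `A_N c = b_N`, whose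
invertibility gives existence and uniqueness. -/
theorem solvesNonlocal_muTildeN {d n : ℕ} [NeZero d] (hd : 2 ≤ d) {k : CVec d}
    (h : inner ℝ (imVec k) (reVec k) = 0) (hb : imVec k ≠ 0) {α : Fin n → ℝ} {z : Fin n → RVec d} {N : ℝ}
    (hN : 0 ≤ N) (hdet : (matN α z N k).det ≠ 0) :
    SolvesNonlocal α z N k (muTildeN α z N k) ∧
      ∀ w, SolvesNonlocal α z N k w → w =ᵐ[volume] muTildeN α z N k := by
  have hu : IsUnit (matN α z N k).det := isUnit_iff_ne_zero.2 hdet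
  have h0 : ∀ y : RVec d, uHat y N 0 = 1 := fun y => by
    rw [uHat, if_pos (by rwa [norm_zero]), neg_zero]; simp [planeWave]
  have hmu : muTildeN α z N k = sourceWave z N k (coeffN α z N k) := rfl
  have hint : ∀ (c : Fin n → ℂ) (m : Fin n),
      fourierConst d * ∫ η, uHat (z m) N (-η) * sourceWave z N k c η = ∑ j, c j * greenTrunc k N (z m - z j) := by
    intro c m
    simp_rw [uHat_neg_mul_sourceWave]
    exact (integrable_planeWave_mul_sourceWave hd h hb z N c (z m)).2
  have hcoeff : (matN α z N k).mulVec (coeffN α z N k) = fun m => (coupling d (α m) N : ℂ) := by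
    rw [coeffN, Matrix.mulVec_mulVec, Matrix.mul_nonsing_inv _ hu, Matrix.one_mulVec]
  constructor
  · rw [hmu]
    refine ⟨fun j => ?_, ?_⟩
    · simp_rw [uHat_neg_mul_sourceWave]
      exact (integrable_planeWave_mul_sourceWave hd h hb z N _ (z j)).1
    · filter_upwards [symb_ne_zero_ae hb] with ξ hξ
      simp_rw [hint, h0]
      rw [sourceWave, mul_div_cancel₀ _ hξ, neg_add_eq_zero]
      refine Finset.sum_congr rfl fun m _ => ?_
      have := congrFun hcoeff m
      rw [matN_mulVec hd h hb] at this
      linear_combination (uHat (z m) N ξ) * this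
  · rintro w ⟨hwi, hw⟩
    set c : Fin n → ℂ := fun j => (coupling d (α j) N : ℂ) *
      (1 + fourierConst d * ∫ η, uHat (z j) N (-η) * w η) with hc
    have hwc : w =ᵐ[volume] sourceWave z N k c := by
      filter_upwards [hw, symb_ne_zero_ae hb] with ξ h1 hξ
      rw [sourceWave, eq_div_iff hξ, eq_neg_iff_add_eq_zero, ← h1, mul_comm]
      congr 1
      refine Finset.sum_congr rfl fun j _ => ?_
      rw [h0, hc]; ring
    have hcc : c = coeffN α z N k := by
      have h1 : (matN α z N k).mulVec c = fun m => (coupling d (α m) N : ℂ) := by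
        ext m
        have h2 : ∫ η, uHat (z m) N (-η) * w η = ∫ η, uHat (z m) N (-η) * sourceWave z N k c η := by
          refine integral_congr_ae ?_
          filter_upwards [hwc] with η hη
          rw [hη]
        have h3 : c m = (coupling d (α m) N : ℂ) * (1 + fourierConst d * ∫ η, uHat (z m) N (-η) * w η) := rfl
        rw [h2, hint] at h3
        rw [matN_mulVec hd h hb]
        linear_combination h3
      rw [coeffN, ← h1, Matrix.mulVec_mulVec, Matrix.nonsing_inv_mul _ hu, Matrix.one_mulVec]
    rw [hmu, ← hcc]
    exact hwc

theorem coupling_eq {d : ℕ} (a N : ℝ) : coupling d a N = a * (1 - a * divTerm d N)⁻¹ := by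
  unfold coupling divTerm
  split_ifs
  · rw [mul_div_assoc]
  · congr 3; ring

theorem tendsto_divTerm (d : ℕ) : Tendsto (divTerm d) atTop atTop := by
  have hpi := Real.pi_pos
  unfold divTerm
  split_ifs
  · exact tendsto_id.atTop_div_const (by positivity)
  · exact Real.tendsto_log_atTop.atTop_div_const (by positivity)

theorem eventually_coupling_ne (d : ℕ) (a : ℝ) : ∀ᶠ N in atTop, 1 - a * divTerm d N ≠ 0 := by
  rcases eq_or_ne a 0 with rfl | ha
  · simp
  · filter_upwards [(tendsto_divTerm d).eventually_gt_atTop a⁻¹] with N hN h0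
    have : a * divTerm d N = 1 := by linarith
    rw [eq_inv_of_mul_eq_one_right this] at hN
    exact lt_irrefl _ hN

/-- The matrix `A_N` with its rows multiplied by the divergent factors. -/
noncomputable def scaledMatN {d n : ℕ} (α : Fin n → ℝ) (z : Fin n → RVec d) (k : CVec d) (N : ℝ) :
    Matrix (Fin n) (Fin n) ℂ :=
  Matrix.diagonal (fun m => ((1 - α m * divTerm d N : ℝ) : ℂ)) * matN α z N k

/-- This is the renormalisation. The scaling factor is the denominator of `ε_m(N)`, so off the
diagonal only `-α_m g_N(z_m - z_j)` remains; on the diagonal the divergence of `g_N(0)` cancels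
against the factor itself and leaves `-α_m q(k)`. -/
theorem tendsto_scaledMatN {d n : ℕ} [NeZero d] (hd : d = 2 ∨ d = 3) {k : CVec d}
    (h : inner ℝ (imVec k) (reVec k) = 0) (hb : imVec k ≠ 0) (α : Fin n → ℝ) {z : Fin n → RVec d}
    (hz : Function.Injective z) :
    Tendsto (scaledMatN α z k) atTop (𝓝 (matReg α z (diagTerm k) (green k))) := by
  have hentry : ∀ m j : Fin n, ∀ᶠ N in atTop, (((1 - α m * divTerm d N : ℝ) : ℂ) * (if m = j then 1 else 0)) -
      α m * greenTrunc k N (z m - z j) = scaledMatN α z k N m j := by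
    intro m j
    filter_upwards [eventually_coupling_ne d (α m)] with N hN
    rw [scaledMatN, Matrix.diagonal_mul, matN_apply (by omega) h hb, coupling_eq]
    have : ((1 - α m * divTerm d N : ℝ) : ℂ) ≠ 0 := Complex.ofReal_ne_zero.2 hN
    rw [Complex.ofReal_mul (α m) _, Complex.ofReal_inv]
    field_simp
  refine tendsto_pi_nhds.2 fun m => tendsto_pi_nhds.2 fun j => ?_
  by_cases hmj : m = j
  · subst hmj
    have h1 := ((tendsto_diag hd h hb).const_mul (α m : ℂ)).const_add 1
    have h2 : (1 : ℂ) + α m * -(diagTerm k : ℂ) = matReg α z (diagTerm k) (green k) m m := by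
      simp only [matReg, Matrix.of_apply, if_true]
      push_cast; ring
    rw [h2] at h1
    refine h1.congr' ?_
    filter_upwards [hentry m m] with N hN
    rw [← hN, if_pos rfl, sub_self, greenTrunc_zero]
    push_cast; ring
  · have h1 := (tendsto_greenTrunc hd h hb (sub_ne_zero.2 (hz.ne hmj))).const_mul (-(α m : ℂ))
    have h2 : -(α m : ℂ) * green k (z m - z j) = matReg α z (diagTerm k) (green k) m j := by
      simp only [matReg, Matrix.of_apply, if_neg hmj]
    rw [h2] at h1
    refine h1.congr' ?_
    filter_upwards [hentry m j] with N hN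
    rw [← hN, if_neg hmj]
    ring

theorem eventually_matN_det_ne {d n : ℕ} [NeZero d] (hd : d = 2 ∨ d = 3) {k : CVec d}
    (h : inner ℝ (imVec k) (reVec k) = 0) (hb : imVec k ≠ 0) {α : Fin n → ℝ} {z : Fin n → RVec d}
    (hz : Function.Injective z) (hs : ¬ IsSpectralSingularity α z (diagTerm k) (green k)) :
    ∀ᶠ N in atTop, (matN α z N k).det ≠ 0 := by
  have hdet := ((continuous_id.matrix_det).tendsto (matReg α z (diagTerm k) (green k))).comp
    (tendsto_scaledMatN hd h hb α hz)
  filter_upwards [hdet.eventually_ne hs] with N hN h0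
  refine hN ?_
  simp only [Function.comp_apply, id, scaledMatN]
  rw [Matrix.det_mul, h0, mul_zero]

theorem tendsto_coeffN {d n : ℕ} [NeZero d] (hd : d = 2 ∨ d = 3) {k : CVec d}
    (h : inner ℝ (imVec k) (reVec k) = 0) (hb : imVec k ≠ 0) {α : Fin n → ℝ} {z : Fin n → RVec d}
    (hz : Function.Injective z) (hs : ¬ IsSpectralSingularity α z (diagTerm k) (green k)) :
    Tendsto (fun N => coeffN α z N k) atTop
      (𝓝 ((matReg α z (diagTerm k) (green k))⁻¹.mulVec fun m => (α m : ℂ))) := by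
  refine tendsto_solution (tendsto_scaledMatN hd h hb α hz) hs ?_
  filter_upwards [eventually_matN_det_ne hd h hb hz hs, eventually_all.2 fun m => eventually_coupling_ne d (α m)]
    with N hN hne
  have hu : IsUnit (matN α z N k).det := isUnit_iff_ne_zero.2 hN
  rw [scaledMatN, ← Matrix.mulVec_mulVec, coeffN, Matrix.mulVec_mulVec _ (matN α z N k), Matrix.mul_nonsing_inv _ hu,
    Matrix.one_mulVec]
  ext m
  rw [Matrix.mulVec_diagonal, coupling_eq, ← Complex.ofReal_mul, mul_left_comm, mul_inv_cancel₀ (hne m), mul_one]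

theorem tendsto_psi {d n : ℕ} [NeZero d] (hd : d = 2 ∨ d = 3) {k : CVec d}
    (h : inner ℝ (imVec k) (reVec k) = 0) (hb : imVec k ≠ 0) {α : Fin n → ℝ} {z : Fin n → RVec d}
    (hz : Function.Injective z) (hs : ¬ IsSpectralSingularity α z (diagTerm k) (green k)) {c : Fin n → ℂ}
    (hc : c = (matReg α z (diagTerm k) (green k))⁻¹.mulVec fun m => (α m : ℂ)) {x : RVec d} (hx : ∀ j, x ≠ z j) :
    Tendsto (fun N : ℝ => expWave k x * muN α z N k x) atTop (𝓝 (psi α z k x)) ∧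
      psi α z k x = expWave k x * (1 + ∑ j, c j * green k (x - z j)) := by
  have h1 : Tendsto (fun N : ℝ => muN α z N k x) atTop (𝓝 (1 + ∑ j, c j * green k (x - z j))) := by
    simp_rw [muN_eq (show 2 ≤ d by omega) h hb]
    refine (tendsto_finsetSum _ fun j _ => ?_).const_add 1
    refine Tendsto.mul ?_ (tendsto_greenTrunc hd h hb (sub_ne_zero.2 (hx j)))
    rw [hc]
    exact tendsto_pi_nhds.1 (tendsto_coeffN hd h hb hz hs) j
  have h2 : psi α z k x = expWave k x * (1 + ∑ j, c j * green k (x - z j)) := by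
    rw [psi, h1.limUnder_eq]
  exact ⟨h2 ▸ h1.const_mul _, h2⟩

/-! ### Boundary values of the linear system and of the eigenfunctions. -/

theorem tendsto_diagTerm_shift {d : ℕ} {k γ : RVec d} (hk : k ≠ 0) (hγ : ‖γ‖ = 1) :
    Tendsto (fun ε : ℝ => diagTerm (shift k γ ε)) (𝓝[>] 0) (𝓝 (diagTermBdry k)) := by
  have h1 : ∀ ε : ℝ, ‖imVec (shift k γ ε)‖ = |ε| := fun ε => by
    rw [imVec_shift, norm_smul, hγ, mul_one, Real.norm_eq_abs]
  have h2 : Tendsto (fun ε : ℝ => |ε|) (𝓝[>] 0) (𝓝 0) := by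
    have : Tendsto (fun ε : ℝ => |ε|) (𝓝 0) (𝓝 |0|) := continuous_abs.tendsto 0
    rw [abs_zero] at this
    exact this.mono_left nhdsWithin_le_nhds
  simp only [diagTerm, diagTermBdry, h1, reVec_shift]
  split_ifs
  · simpa using h2.div_const (4 * Real.pi)
  · refine (Tendsto.log ?_ (norm_ne_zero_iff.2 hk)).div_const _
    simpa using h2.const_add ‖k‖

theorem tendsto_matReg_shift {d n : ℕ} [NeZero d] (hd : d = 2 ∨ d = 3) {k γ : RVec d} (hk : k ≠ 0) (hγ : ‖γ‖ = 1)
    (hkγ : inner ℝ k γ = 0) (α : Fin n → ℝ) {z : Fin n → RVec d} (hz : Function.Injective z) :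
    Tendsto (fun ε : ℝ => matReg α z (diagTerm (shift k γ ε)) (green (shift k γ ε))) (𝓝[>] 0)
      (𝓝 (matReg α z (diagTermBdry k) (greenBdry k γ))) := by
  refine tendsto_pi_nhds.2 fun m => tendsto_pi_nhds.2 fun j => ?_
  simp only [matReg, Matrix.of_apply]
  split_ifs with hmj
  · exact (Complex.continuous_ofReal.tendsto _).comp (((tendsto_diagTerm_shift hk hγ).const_mul (α m)).const_sub 1)
  · exact (tendsto_green_shift hd hk hγ hkγ (sub_ne_zero.2 (hz.ne hmj))).const_mul _

theorem tendsto_vecTilde_shift {d n : ℕ} {k γ : RVec d} (hk : k ≠ 0) (hγ : ‖γ‖ = 1) {α : Fin n → ℝ}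
    (h : ∀ m, 1 - α m * diagTermBdry k ≠ 0) :
    Tendsto (fun ε : ℝ => vecTilde α (diagTerm (shift k γ ε))) (𝓝[>] 0) (𝓝 (vecTilde α (diagTermBdry k))) := by
  refine tendsto_pi_nhds.2 fun m => ?_
  exact (Complex.continuous_ofReal.tendsto _).comp
    (((((tendsto_diagTerm_shift hk hγ).const_mul (α m)).const_sub 1).inv₀ (h m)).const_mul (α m))

theorem tendsto_matTilde_shift {d n : ℕ} [NeZero d] (hd : d = 2 ∨ d = 3) {k γ : RVec d} (hk : k ≠ 0) (hγ : ‖γ‖ = 1)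
    (hkγ : inner ℝ k γ = 0) {α : Fin n → ℝ} {z : Fin n → RVec d} (hz : Function.Injective z)
    (h : ∀ m, 1 - α m * diagTermBdry k ≠ 0) :
    Tendsto (fun ε : ℝ => matTilde α z (diagTerm (shift k γ ε)) (green (shift k γ ε))) (𝓝[>] 0)
      (𝓝 (matTilde α z (diagTermBdry k) (greenBdry k γ))) := by
  refine tendsto_pi_nhds.2 fun m => tendsto_pi_nhds.2 fun j => ?_
  simp only [matTilde, Matrix.of_apply]
  split_ifs with hmj
  · exact tendsto_const_nhds
  · exact (tendsto_pi_nhds.1 (tendsto_vecTilde_shift hk hγ h) m).neg.mul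
      (tendsto_green_shift hd hk hγ hkγ (sub_ne_zero.2 (hz.ne hmj)))

theorem continuous_expWave_shift {d : ℕ} (k γ x : RVec d) : Continuous fun ε : ℝ => expWave (shift k γ ε) x := by
  have := continuous_cdot_shift k γ x
  unfold expWave; fun_prop

theorem expWave_shift_zero {d : ℕ} (k γ x : RVec d) : expWave (shift k γ 0) x = planeWave k x := by
  rw [expWave, cdot_eq, reVec_shift, imVec_shift, zero_smul, inner_zero_left, planeWave]
  simp

/-- The determinant is nonzero in the limit, hence for all small `ε > 0`. There the formula for
`psi` at `k + iεγ` is available, and each of its ingredients converges. -/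
theorem tendsto_psi_shift {d n : ℕ} [NeZero d] (hd : d = 2 ∨ d = 3) {k γ : RVec d} (hk : k ≠ 0) (hγ : ‖γ‖ = 1)
    (hkγ : inner ℝ k γ = 0) {α : Fin n → ℝ} {z : Fin n → RVec d} (hz : Function.Injective z)
    (hs : ¬ IsSpectralSingularity α z (diagTermBdry k) (greenBdry k γ)) {c : Fin n → ℂ}
    (hc : c = (matReg α z (diagTermBdry k) (greenBdry k γ))⁻¹.mulVec fun m => (α m : ℂ)) {x : RVec d}
    (hx : ∀ j, x ≠ z j) :
    Tendsto (fun ε : ℝ => psi α z (shift k γ ε) x) (𝓝[>] 0) (𝓝 (psiBdry α z k γ x)) ∧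
      psiBdry α z k γ x = planeWave k x * (1 + ∑ j, c j * greenBdry k γ (x - z j)) := by
  have hmat := tendsto_matReg_shift hd hk hγ hkγ α hz
  have hdet : ∀ᶠ ε : ℝ in 𝓝[>] 0, (matReg α z (diagTerm (shift k γ ε)) (green (shift k γ ε))).det ≠ 0 :=
    (((continuous_id.matrix_det).tendsto _).comp hmat).eventually_ne hs
  have hcoef : Tendsto (fun ε : ℝ => (matReg α z (diagTerm (shift k γ ε)) (green (shift k γ ε)))⁻¹.mulVec
      fun m => (α m : ℂ)) (𝓝[>] 0) (𝓝 c) := by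
    rw [hc]
    refine tendsto_solution hmat hs ?_
    filter_upwards [hdet] with ε hε
    rw [Matrix.mulVec_mulVec, Matrix.mul_nonsing_inv _ (isUnit_iff_ne_zero.2 hε), Matrix.one_mulVec]
  have h1 : Tendsto (fun ε : ℝ => psi α z (shift k γ ε) x) (𝓝[>] 0)
      (𝓝 (planeWave k x * (1 + ∑ j, c j * greenBdry k γ (x - z j)))) := by
    have h2 : Tendsto (fun ε : ℝ => expWave (shift k γ ε) x) (𝓝[>] 0) (𝓝 (planeWave k x)) := by
      rw [← expWave_shift_zero k γ x]
      exact ((continuous_expWave_shift k γ x).tendsto 0).mono_left nhdsWithin_le_nhds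
    have h3 := h2.mul ((tendsto_finsetSum Finset.univ fun j _ => (tendsto_pi_nhds.1 hcoef j).mul
      (tendsto_green_shift hd hk hγ hkγ (sub_ne_zero.2 (hx j)))).const_add 1)
    refine h3.congr' ?_
    filter_upwards [hdet, self_mem_nhdsWithin] with ε hε hε0
    exact (tendsto_psi hd (shift_orth hkγ ε) (imVec_shift_ne hγ hε0) hz hε rfl hx).2.symm
  have h4 : psiBdry α z k γ x = planeWave k x * (1 + ∑ j, c j * greenBdry k γ (x - z j)) := h1.limUnder_eq
  exact ⟨h4 ▸ h1, h4⟩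

theorem expWave_ne_zero {d : ℕ} (k : CVec d) (x : RVec d) : expWave k x ≠ 0 := Complex.exp_ne_zero _

theorem expWave_sub_mul {d : ℕ} (k : CVec d) (x y : RVec d) : expWave k (x - y) * expWave k y = expWave k x := by
  rw [expWave, expWave, expWave, ← Complex.exp_add, ← mul_add]
  congr 2
  simp only [cdot, ← Finset.sum_add_distrib, ← mul_add, ← Complex.ofReal_add, PiLp.sub_apply, sub_add_cancel]

theorem planeWave_sub_mul {d : ℕ} (k : RVec d) (x y : RVec d) : planeWave k (x - y) * planeWave k y = planeWave k x := by
  rw [← planeWave_add_right, sub_add_cancel]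

end MultipointFaddeev

/-! ### Assembly of the theorem. -/

theorem theorem3p1 (d n : ℕ) (hd : d = 2 ∨ d = 3)
    (α : Fin n → ℝ) (z : Fin n → RVec d) (hz : Function.Injective z) :
    -- complex momenta at real energy
    (∀ (k : CVec d) (E : ℝ), imVec k ≠ 0 → csq k = (E : ℂ) →
      -- the Green function is well defined
      (∀ x : RVec d, x ≠ 0 → Tendsto (fun R : ℝ => greenTrunc k R x) atTop (𝓝 (green k x))) ∧
      -- spectral singularities in terms of the other two forms of the linear system
      ((∀ m, 1 - α m * diagTerm k ≠ 0) →
        (IsSpectralSingularity α z (diagTerm k) (green k) ↔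
          (matTilde α z (diagTerm k) (green k)).det = 0)) ∧
      ((∀ m, α m ≠ 0) →
        (IsSpectralSingularity α z (diagTerm k) (green k) ↔
          (matCal α z (diagTerm k) (expWave k) (green k)).det = 0)) ∧
      (¬ IsSpectralSingularity α z (diagTerm k) (green k) →
        -- for large `N`, the function `μ_N` is the Faddeev solution for `V_N`
        (∀ᶠ N : ℝ in atTop, (matN α z N k).det ≠ 0 ∧
          SolvesNonlocal α z N k (muTildeN α z N k) ∧
          ∀ w, SolvesNonlocal α z N k w → w =ᵐ[volume] muTildeN α z N k) ∧
        ∃ c : Fin n → ℂ, IsCoeff α z (diagTerm k) (expWave k) (green k) c ∧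
          -- the limiting eigenfunction
          (∀ x : RVec d, (∀ j, x ≠ z j) →
            Tendsto (fun N : ℝ => expWave k x * muN α z N k x) atTop (𝓝 (psi α z k x)) ∧
            psi α z k x = expWave k x * (1 + ∑ j, c j * green k (x - z j))) ∧
          -- the generalized scattering data `h(k,l) = H(k,k-l)`
          (∃! H, IsScatteringData k (psi α z k) H) ∧
          ∀ H, IsScatteringData k (psi α z k) H →
            ∀ l : CVec d, imVec l = imVec k → csq l = (E : ℂ) →
              H (reVec k - reVec l) = fourierConst d * ∑ j, c j * expWave (k - l) (z j))) ∧
    -- boundary values at real momenta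
    (∀ (k γ : RVec d), k ≠ 0 → ‖γ‖ = 1 → inner ℝ k γ = 0 →
      (∀ x : RVec d, x ≠ 0 →
        Tendsto (fun ε : ℝ => green (shift k γ ε) x) (𝓝[>] 0) (𝓝 (greenBdry k γ x))) ∧
      Tendsto (fun ε : ℝ => matReg α z (diagTerm (shift k γ ε)) (green (shift k γ ε))) (𝓝[>] 0)
        (𝓝 (matReg α z (diagTermBdry k) (greenBdry k γ))) ∧
      ((∀ m, 1 - α m * diagTermBdry k ≠ 0) →
        Tendsto (fun ε : ℝ => matTilde α z (diagTerm (shift k γ ε)) (green (shift k γ ε)))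
          (𝓝[>] 0) (𝓝 (matTilde α z (diagTermBdry k) (greenBdry k γ))) ∧
        Tendsto (fun ε : ℝ => vecTilde α (diagTerm (shift k γ ε)))
          (𝓝[>] 0) (𝓝 (vecTilde α (diagTermBdry k))) ∧
        (IsSpectralSingularity α z (diagTermBdry k) (greenBdry k γ) ↔
          (matTilde α z (diagTermBdry k) (greenBdry k γ)).det = 0)) ∧
      ((∀ m, α m ≠ 0) →
        (IsSpectralSingularity α z (diagTermBdry k) (greenBdry k γ) ↔
          (matCal α z (diagTermBdry k) (planeWave k) (greenBdry k γ)).det = 0)) ∧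
      (¬ IsSpectralSingularity α z (diagTermBdry k) (greenBdry k γ) →
        ∃ c : Fin n → ℂ, IsCoeff α z (diagTermBdry k) (planeWave k) (greenBdry k γ) c ∧
          (∀ x : RVec d, (∀ j, x ≠ z j) →
            Tendsto (fun ε : ℝ => psi α z (shift k γ ε) x) (𝓝[>] 0) (𝓝 (psiBdry α z k γ x)) ∧
            psiBdry α z k γ x =
              planeWave k x * (1 + ∑ j, c j * greenBdry k γ (x - z j))) ∧
          (∃! H, IsScatteringDataBdry k γ (psiBdry α z k γ) H) ∧
          ∀ H, IsScatteringDataBdry k γ (psiBdry α z k γ) H →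
            ∀ l : RVec d, l ≠ 0 → ‖l‖ = ‖k‖ →
              H (k - l) = fourierConst d * ∑ j, c j * planeWave (k - l) (z j))) := by
  have : NeZero d := ⟨by omega⟩
  constructor
  · intro k E hb hE
    -- The analysis uses the reality of the energy only through the orthogonality of `Re k` and `Im
    -- k`.
    have h := inner_re_im hE
    refine ⟨fun x hx => tendsto_greenTrunc hd h hb hx, fun hq => spectralSingularity_iff_tilde z _ hq,
      fun hα => spectralSingularity_iff_cal z _ _ (expWave_ne_zero k) (expWave_sub_mul k) hα, fun hs => ⟨?_, ?_⟩⟩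
    · filter_upwards [eventually_matN_det_ne hd h hb hz hs, eventually_ge_atTop 0] with N hN hN0
      exact ⟨hN, solvesNonlocal_muTildeN (by omega) h hb hN0 hN⟩
    · have hψ := fun (x : RVec d) (hx : ∀ j, x ≠ z j) => tendsto_psi hd h hb hz hs rfl hx
      have hH := isScatteringData_sourceData hd h hb fun x hx => (hψ x hx).2
      refine ⟨_, isCoeff_inv (expWave_ne_zero k) (expWave_sub_mul k) hs, hψ,
        ⟨_, hH, fun H hH' => scatteringData_unique (by omega) h hb hH' hH⟩, fun H hH' l hl _ => ?_⟩
      rw [scatteringData_unique (by omega) h hb hH' hH, sourceData]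
      simp_rw [expWave_sub_eq hl]
  · intro k γ hk hγ hkγ
    refine ⟨fun x hx => tendsto_green_shift hd hk hγ hkγ hx, tendsto_matReg_shift hd hk hγ hkγ α hz,
      fun hq => ⟨tendsto_matTilde_shift hd hk hγ hkγ hz hq, tendsto_vecTilde_shift hk hγ hq,
        spectralSingularity_iff_tilde z _ hq⟩,
      fun hα => spectralSingularity_iff_cal z _ _ (planeWave_ne_zero k) (planeWave_sub_mul k) hα, fun hs => ?_⟩
    have hψ := fun (x : RVec d) (hx : ∀ j, x ≠ z j) => tendsto_psi_shift hd hk hγ hkγ hz hs rfl hx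
    have hH := isScatteringDataBdry_sourceData hd hk hγ hkγ fun x hx => (hψ x hx).2
    refine ⟨_, isCoeff_inv (planeWave_ne_zero k) (planeWave_sub_mul k) hs, hψ,
      ⟨_, hH, fun H hH' => scatteringDataBdry_unique (by omega) hk hγ hkγ hH' hH⟩, fun H hH' l _ _ => ?_⟩
    rw [scatteringDataBdry_unique (by omega) hk hγ hkγ hH' hH, sourceData]
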